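/- **Setting.** There are keys $[n]$ and a finite set $\mathcal S$ of scenarios; scenario $s$ consists of a finite sequence of nonempty keychains $C_1(s),\dots,C_{m(s)}(s)\subseteq[n]$ and a correct key $k^*(s)\in[n]$. Let $m=\max_s m(s)$. An information set is a nonempty prefix $o=(C_1(s),\dots,C_t(s))$ of a keychain sequence, $\mathcal O$ is the set of all of them and $P(s)$ the set of those that occur in $s$. An (admissible, deterministic, exploitative) policy is a map $\pi:\mathcal O\to[n]\cup\{\perp\}$ that takes no key twice on any $P(s)$; $\pi(o)=k$ means that $k$ is first tested at $o$. Its utility in scenario $s$ is $u_s(\pi)=\sum_k\sum_{o\in P(s)} r_{k,o,s}\mathbf 1\{\pi(o)=k\}$, where for $o=(C_1(s),\dots,C_t(s))$ we put $r_{k,o,s}=\mathbf 1\{k\in C_t(s),\,k=k^*(s)\}\cdot|\{t'\ge t: k\in C_{t'}(s)\}|$. For a prior $p\in\Delta(\mathcal S)$ let $u(p,\pi)=\sum_s p_s u_s(\pi)$. An $\alpha$-approximation oracle $\mathcal A$ assigns to each $p\in\Delta(\mathcal S)$ a probability distribution $\mathcal A(p)$ on policies with $\mathbb E_{\pi\sim\mathcal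 A(p)}u(p,\pi)\ge\alpha\max_\pi u(p,\pi)$; each call draws a fresh sample. **Algorithm.** Let $\mathcal K\subseteq\Delta(\mathcal S)$ be nonempty, closed and convex, and let $\varepsilon>0$. Put $$T=\max\Big\{1,\Big\lceil \tfrac{4m^2\ln|\mathcal S|}{\varepsilon^2}\Big\rceil\Big\},\qquad \eta=\frac{\sqrt{\ln|\mathcal S|}}{m\sqrt T}$$ (with the convention $x/0=0$ in the trivial cases $m=0$ or $|\mathcal S|=1$). In round $t=1,\dots,T$ the algorithm (follow the regularized leader with entropy regularizer) chooses $p^t\in\mathcal K$ minimizing $$F_t(p)=\sum_{\tau<t}u(p,\pi^\tau)+\frac1\eta\sum_s p_s\ln p_s$$ over $\mathcal K$, and samples $\pi^t\sim\mathcal A(p^t)$. It returns the randomized policy $\mathrm{Uniform}(\pi^1,\dots,\pi^T)$. Thus it invokes $\mathcal A$ exactly $T\le 4m^2\ln|\mathcal S|/\varepsilon^2+1$ times. **Proposition.** 1. The minimizers exist, and for every real $\alpha$ and every $\alpha$-approximation oracle $\mathcal A$ the output satisfies $$\mathbb E\Big[\min_{p\in\mathcal K}\frac1T\sum_{t=1}^T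 u(p,\pi^t)\Big]\ \ge\ \alpha\min_{p\in\mathcal K}\max_\pi u(p,\pi)-\varepsilon ,$$ where the outer expectation is over the randomness of $\mathcal A$. The same holds if, in each round, $p^t\in\mathcal K$ minimizes $F_t$ over $\mathcal K$ only up to an additive error $\delta\in[0,\varepsilon/64]$. 2. Every iteration takes polynomial time. Precisely, consider a real RAM (unit-cost arithmetic, comparisons, square root and logarithm on reals, arithmetic and addressing by natural numbers, no rounding) with access to a separation oracle for $\mathcal K$: queried at $z\in\mathbb R^{\mathcal S}$, it reports whether $z\in\mathcal K$, and if not, returns a vector $w$ with $\langle w,x\rangle<\langle w,z\rangle$ for all $x\in\mathcal K$; a query costs $|\mathcal S|+1$ steps. There are one program and one constant $c$ such that the following holds for all instances, all $\mathcal K$ and $\varepsilon$ as above and all separation oracles for $\mathcal K$. As usual for convex sets given by a separation oracle, the input describes, besides the scenarios, $n$, $m$, $|\mathcal S|$, $T$ and $\varepsilon$, the affine hull of $\mathcal K$ (by its dimension, a point and an orthonormal basis of its direction space) and contains a number $r>0$ such that $\mathcal K$ contains a ball of radius $r$ of its affine hull. In every round the program, given its memory from the previous round and the table of the policy $\pi^{t-1}$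 just sampled, halts after at most $$c\,\big(n+|\mathcal S|+m+\ln(1+1/\varepsilon)+\ln(1+1/r)\big)^{c}$$ steps with a point $p^t\in\mathcal K$ that minimizes $F_t$ over $\mathcal K$ up to an additive error $\varepsilon/64$. Sampling $\pi^t\sim\mathcal A(p^t)$ in each of the $T$ rounds, the returned policy $\mathrm{Uniform}(\pi^1,\dots,\pi^T)$ satisfies the inequality of part 1. -/

import Mathlib

noncomputable section

namespace Keychain

/-! ### The Probabilistic Scenarios setting -/

/-- An environment with keys `[n]` and `N` scenarios. Scenario `s` consists of a finite sequence of
nonempty keychains and of one correct key. -/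
structure Env (n N : ℕ) where
  chains : Fin N → List (Finset (Fin n))
  chains_nonempty : ∀ s, ∀ C ∈ chains s, C.Nonempty
  key : Fin N → Fin n

namespace Env

variable {n N : ℕ} (I : Env n N)

/-- `m(s)`, the number of rounds of scenario `s`. -/
def rounds (s : Fin N) : ℕ := (I.chains s).length

/-- `m`, the maximum number of rounds over all scenarios. -/
def maxRounds : ℕ := Finset.univ.sup I.rounds

/-- `P(s)`: the nonempty prefixes of the keychain sequence of `s`. -/
def infoSetsOf (s : Fin N) : Finset (List (Finset (Fin n))) :=
  ((I.chains s).inits.filter (fun o => o ≠ [])).toFinset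

/-- The collection of all information sets. -/
def infoSets : Finset (List (Finset (Fin n))) := Finset.univ.biUnion I.infoSetsOf

abbrev InfoSet : Type := {o // o ∈ I.infoSets}

/-- Deterministic exploitative policies: maps from information sets to a key tested there for the
first time, or to `none` (no new key). A policy is admissible if along every scenario no key is
tested for the first time twice. -/
abbrev Policy : Type :=
  {π : I.InfoSet → Option (Fin n) //
    ∀ s, ∀ o o' : I.InfoSet, o.1 ∈ I.infoSetsOf s → o'.1 ∈ I.infoSetsOf s →
      ∀ k, π o = some k → π o' = some k → o = o'}

instance : Fintype I.Policy := Fintype.ofFinite _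

/-- The reward in scenario `s` of first testing key `k` at information set `o = (C_1, …, C_t)`: zero
unless `o` occurs in `s`, `k ∈ C_t` and `k` is the correct key, and then the number of keychains
among `C_t, …, C_{m(s)}` that contain `k`. -/
def reward (k : Fin n) (o : List (Finset (Fin n))) (s : Fin N) : ℕ :=
  if o ∈ I.infoSetsOf s ∧ (∃ C ∈ o.getLast?, k ∈ C) ∧ k = I.key s then
    ((I.chains s).drop (o.length - 1)).countP (fun C => decide (k ∈ C))
  else 0

/-- The utility `u_s(π)` of a policy in scenario `s`. -/
def scenarioUtility (π : I.Policy) (s : Fin N) : ℝ :=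
  ∑ k : Fin n, ∑ o : I.InfoSet with o.1 ∈ I.infoSetsOf s,
    (I.reward k o.1 s : ℝ) * (if π.1 o = some k then 1 else 0)

/-- The expected utility `u(p, π)` under the prior `p`. -/
def utility (p : Fin N → ℝ) (π : I.Policy) : ℝ := ∑ s, p s * I.scenarioUtility π s

/-- `max_π u(p, π)` over the (finitely many) admissible policies. -/
def optimum (p : Fin N → ℝ) : ℝ := ⨆ π : I.Policy, I.utility p π

/-- A randomized `α`-approximation oracle for the Probabilistic Scenarios problem: for each prior a
distribution over policies, approximately optimal in expectation. -/
def IsApproxOracle (α : ℝ) (A : (Fin N → ℝ) → PMF I.Policy) : Prop :=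
  ∀ p ∈ stdSimplex ℝ (Fin N), ∑ π, (A p π).toReal * I.utility p π ≥ α * I.optimum p

/-! ### Follow the regularized leader against the oracle -/

/-- A rule choosing the prior of the next round from the policies sampled so far. -/
abbrev PriorRule : Type := (t : ℕ) → (Fin t → I.Policy) → Fin N → ℝ

/-- The joint law of `π^1, …, π^T` when in each round one policy is sampled, with fresh randomness,
from `A` at the prior that the rule prescribes: one invocation of `A` per round. -/
def runLaw (A : (Fin N → ℝ) → PMF I.Policy) (rule : I.PriorRule) :
    (T : ℕ) → PMF (Fin T → I.Policy)
  | 0 => PMF.pure Fin.elim0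
  | T + 1 => (runLaw A rule T).bind fun h =>
      (A (rule T h)).map fun π => (Fin.snoc h π : Fin (T + 1) → I.Policy)

/-- Expected utility under `p` of the randomized policy `Uniform(π^1, …, π^T)`. -/
def uniformUtility {T : ℕ} (h : Fin T → I.Policy) (p : Fin N → ℝ) : ℝ :=
  (∑ t, I.utility p (h t)) / T

/-- `𝔼 [min_{p ∈ K} 𝔼_{π ∼ Uniform(π^1, …, π^T)} u(p, π)]`, the outer expectation being over the
randomness of the oracle. -/
def expectedWorstCase (K : Set (Fin N → ℝ)) (A : (Fin N → ℝ) → PMF I.Policy)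
    (rule : I.PriorRule) (T : ℕ) : ℝ :=
  ∑ h : Fin T → I.Policy, (I.runLaw A rule T h).toReal * ⨅ p : K, I.uniformUtility h p

/-- `min_{p ∈ K} max_π u(p, π)`. -/
def minimax (K : Set (Fin N → ℝ)) : ℝ := ⨅ p : K, I.optimum p

/-- The number of rounds, `⌈4 m² ln |S| / ε²⌉` but at least one. -/
def horizon (ε : ℝ) : ℕ := max 1 ⌈4 * (I.maxRounds : ℝ) ^ 2 * Real.log N / ε ^ 2⌉₊

/-- The learning rate `η = √(ln |S|) / (m √T)`. -/
def learningRate (ε : ℝ) : ℝ :=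
  √(Real.log N) / (I.maxRounds * √(I.horizon ε))

/-- The objective `∑_{τ < t} u(p, π^τ) + (1/η) ∑_s p_s ln p_s`. -/
def ftrlObjective (ε : ℝ) {t : ℕ} (h : Fin t → I.Policy) (p : Fin N → ℝ) : ℝ :=
  ∑ τ, I.utility p (h τ) + 1 / I.learningRate ε * ∑ s, p s * Real.log (p s)

/-- In each of the rounds, and after every history, the rule picks a point of `K` that minimizes the
objective over `K` up to an additive error `δ`. For `δ = 0` this is the exact argmin. -/
def IsFTRL (K : Set (Fin N → ℝ)) (ε δ : ℝ) (rule : I.PriorRule) : Prop :=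
  ∀ t < I.horizon ε, ∀ h : Fin t → I.Policy, rule t h ∈ K ∧
    ∀ q ∈ K, I.ftrlObjective ε h (rule t h) ≤ I.ftrlObjective ε h q + δ

end Env

/-! ### Access to the set of priors -/

/-- A (strong) separation oracle: it recognizes the points of `K`, and for any other point `z` it
returns a vector `c` with `⟨c, x⟩ < ⟨c, z⟩` for all `x ∈ K`. -/
def IsSeparationOracle {N : ℕ} (K : Set (Fin N → ℝ))
    (sep : (Fin N → ℝ) → Option (Fin N → ℝ)) : Prop :=
  ∀ z, (z ∈ K → sep z = none) ∧
    (z ∉ K → ∃ c, sep z = some c ∧ ∀ x ∈ K, c ⬝ᵥ x < c ⬝ᵥ z)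

/-- The affine hull of `K` is `a + span (b 0, …, b (d - 1))` with `b` orthonormal, and `K` contains a
ball of radius `r` of its affine hull. Every nonempty convex set has such data. -/
structure IsInnerBallData {N d : ℕ} (K : Set (Fin N → ℝ)) (a : Fin N → ℝ)
    (b : Fin d → Fin N → ℝ) (r : ℝ) : Prop where
  radius_pos : 0 < r
  orthonormal : ∀ i j, b i ⬝ᵥ b j = if i = j then 1 else 0
  subset_affine : ∀ x ∈ K, ∃ y : Fin d → ℝ, x = a + ∑ i, y i • b i
  ball_subset : ∃ y₀ : Fin d → ℝ, ∀ y : Fin d → ℝ,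
    ∑ i, (y i - y₀ i) ^ 2 ≤ r ^ 2 → a + ∑ i, y i • b i ∈ K

/-! ### A real RAM with a separation oracle, and its step count -/

/-- Memory: countably many arrays of natural numbers and of reals. -/
structure Mem where
  nat : ℕ → ℕ → ℕ
  real : ℕ → ℕ → ℝ

namespace Mem

def setNat (σ : Mem) (arr i v : ℕ) : Mem :=
  { σ with nat := Function.update σ.nat arr (Function.update (σ.nat arr) i v) }

def setReal (σ : Mem) (arr i : ℕ) (v : ℝ) : Mem :=
  { σ with real := Function.update σ.real arr (Function.update (σ.real arr) i v) }

/-- The vector stored in the first `N` cells of a real array. -/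
def readVec (σ : Mem) (N arr : ℕ) : Fin N → ℝ := fun s => σ.real arr s

/-- Overwrite the first `N` cells of a real array. -/
def writeVec {N : ℕ} (σ : Mem) (arr : ℕ) (v : Fin N → ℝ) : Mem :=
  { σ with
    real := Function.update σ.real arr fun i => if h : i < N then v ⟨i, h⟩ else σ.real arr i }

end Mem

/-- Expressions for natural numbers (`sub` is truncated); `cell arr i` is indirect addressing. -/
inductive NatExp
  | lit (k : ℕ)
  | cell (arr : ℕ) (i : NatExp)
  | add (x y : NatExp)
  | sub (x y : NatExp)
  | mul (x y : NatExp)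

def NatExp.eval (σ : Mem) : NatExp → ℕ
  | lit k => k
  | cell arr i => σ.nat arr (i.eval σ)
  | add x y => x.eval σ + y.eval σ
  | sub x y => x.eval σ - y.eval σ
  | mul x y => x.eval σ * y.eval σ

/-- Real expressions: field operations, square root and natural logarithm. There is no rounding and
no conversion from reals to natural numbers. -/
inductive RealExp
  | ofNat (k : NatExp)
  | cell (arr : ℕ) (i : NatExp)
  | add (x y : RealExp)
  | sub (x y : RealExp)
  | mul (x y : RealExp)
  | div (x y : RealExp)
  | sqrt (x : RealExp)
  | log (x : RealExp)

def RealExp.eval (σ : Mem) : RealExp → ℝ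
  | ofNat k => (k.eval σ : ℝ)
  | cell arr i => σ.real arr (i.eval σ)
  | add x y => x.eval σ + y.eval σ
  | sub x y => x.eval σ - y.eval σ
  | mul x y => x.eval σ * y.eval σ
  | div x y => x.eval σ / y.eval σ
  | sqrt x => √(x.eval σ)
  | log x => Real.log (x.eval σ)

inductive Test
  | natLt (x y : NatExp)
  | natEq (x y : NatExp)
  | realLt (x y : RealExp)

def Test.Holds (σ : Mem) : Test → Prop
  | natLt x y => x.eval σ < y.eval σ
  | natEq x y => x.eval σ = y.eval σ
  | realLt x y => x.eval σ < y.eval σ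

/-- Programs. `separate x f c` queries the separation oracle at the vector in real array `x`, stores
in cell `0` of the natural array `f` whether it lies in `K` (`1` or `0`), and if it does not, stores
the separating vector in real array `c`. -/
inductive Cmd
  | skip
  | setNat (arr : ℕ) (i e : NatExp)
  | setReal (arr : ℕ) (i : NatExp) (e : RealExp)
  | separate (x f c : ℕ)
  | seq (P Q : Cmd)
  | ite (b : Test) (P Q : Cmd)
  | loop (b : Test) (P : Cmd)

/-- The effect on memory of one query to the separation oracle. -/
def oracleStep {N : ℕ} (sep : (Fin N → ℝ) → Option (Fin N → ℝ)) (x f c : ℕ) (σ : Mem) : Mem :=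
  match sep (σ.readVec N x) with
  | none => σ.setNat f 0 1
  | some v => (σ.setNat f 0 0).writeVec c v

/-- `Exec sep P σ k σ'`: started in memory `σ`, program `P` halts in memory `σ'` after `k` steps.
Assignments and tests count one step (a fixed program has expressions of bounded size only), an
oracle query counts `N + 1` steps. `loop b P` repeats `P` as long as `b` holds. -/
inductive Exec {N : ℕ} (sep : (Fin N → ℝ) → Option (Fin N → ℝ)) : Cmd → Mem → ℕ → Mem → Prop
  | skip (σ : Mem) : Exec sep .skip σ 1 σ
  | setNat (arr : ℕ) (i e : NatExp) (σ : Mem) :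
      Exec sep (.setNat arr i e) σ 1 (σ.setNat arr (i.eval σ) (e.eval σ))
  | setReal (arr : ℕ) (i : NatExp) (e : RealExp) (σ : Mem) :
      Exec sep (.setReal arr i e) σ 1 (σ.setReal arr (i.eval σ) (e.eval σ))
  | separate (x f c : ℕ) (σ : Mem) :
      Exec sep (.separate x f c) σ (N + 1) (oracleStep sep x f c σ)
  | seq {P Q : Cmd} {σ σ' σ'' : Mem} {k l : ℕ} :
      Exec sep P σ k σ' → Exec sep Q σ' l σ'' → Exec sep (.seq P Q) σ (k + l) σ''
  | ite_true {b : Test} {P Q : Cmd} {σ σ' : Mem} {k : ℕ} :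
      b.Holds σ → Exec sep P σ k σ' → Exec sep (.ite b P Q) σ (k + 1) σ'
  | ite_false {b : Test} {P Q : Cmd} {σ σ' : Mem} {k : ℕ} :
      ¬ b.Holds σ → Exec sep Q σ k σ' → Exec sep (.ite b P Q) σ (k + 1) σ'
  | loop_true {b : Test} {P : Cmd} {σ σ' σ'' : Mem} {k l : ℕ} :
      b.Holds σ → Exec sep P σ k σ' → Exec sep (.loop b P) σ' l σ'' →
        Exec sep (.loop b P) σ (k + l + 1) σ''
  | loop_false {b : Test} {P : Cmd} {σ : Mem} :
      ¬ b.Holds σ → Exec sep (.loop b P) σ 1 σ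

namespace Env

variable {n N : ℕ} (I : Env n N)

/-- The input in memory. Natural arrays: `0` holds `n, N, m, T, d`; `1` the numbers of rounds; `2` the
correct keys; `3` the bits `[k ∈ C_{t+1}(s)]` at address `(s * m + t) * n + k`. Real arrays: `0` holds
`ε, r`; `1` the point `a`; `2` the vectors `b i`, entry `s` at address `i * N + s`. All other cells,
among them natural array `4`, which is to hold the last sampled policy, are zero. -/
def inputMem {d : ℕ} (ε r : ℝ) (a : Fin N → ℝ) (b : Fin d → Fin N → ℝ) : Mem where
  nat := fun arr j =>
    if arr = 0 then [n, N, I.maxRounds, I.horizon ε, d].getD j 0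
    else if arr = 1 then (if h : j < N then I.rounds ⟨j, h⟩ else 0)
    else if arr = 2 then (if h : j < N then (I.key ⟨j, h⟩ : ℕ) else 0)
    else if arr = 3 then
      (if h : j / n / I.maxRounds < N then
        (if ∃ k ∈ (I.chains ⟨_, h⟩).getD (j / n % I.maxRounds) ∅, (k : ℕ) = j % n then 1 else 0)
      else 0)
    else 0
  real := fun arr j =>
    if arr = 0 then [ε, r].getD j 0
    else if arr = 1 then (if h : j < N then a ⟨j, h⟩ else 0)
    else if arr = 2 then
      (if h : j / N < d ∧ j % N < N then b ⟨j / N, h.1⟩ ⟨j % N, h.2⟩ else 0)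
    else 0

/-- The action of a policy in round `t + 1` of scenario `s`, coded as `k + 1` for key `k` and as `0`
for no key. -/
def actionCode (π : I.Policy) (s : Fin N) (t : ℕ) : ℕ :=
  if h : t < I.rounds s ∧ (I.chains s).take (t + 1) ∈ I.infoSets then
    (match π.1 ⟨_, h.2⟩ with
    | none => 0
    | some k => (k : ℕ) + 1)
  else 0

/-- Handing a sampled policy to the machine: natural array `4` receives its table of actions, round
`t + 1` of scenario `s` at address `s * m + t`. -/
def storePolicy (σ : Mem) (π : I.Policy) : Mem :=
  { σ with
    nat := Function.update σ.nat 4 fun j =>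
      if h : j / I.maxRounds < N then I.actionCode π ⟨_, h⟩ (j % I.maxRounds) else 0 }

/-- `mem t h` is the memory when the machine has run `body` in round `t + 1` after the sampled policies
`h`: the first round starts from the input, every later one from the memory left by the previous round
with the newly sampled policy stored in it. Every round takes at most `B` steps. -/
def IsRun (sep : (Fin N → ℝ) → Option (Fin N → ℝ)) (body : Cmd) (σ₀ : Mem) (T : ℕ) (B : ℝ)
    (mem : (t : ℕ) → (Fin t → I.Policy) → Mem) : Prop :=
  (∀ h : Fin 0 → I.Policy, ∃ k : ℕ, (k : ℝ) ≤ B ∧ Exec sep body σ₀ k (mem 0 h)) ∧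
  ∀ t, t + 1 < T → ∀ (h : Fin t → I.Policy) (π : I.Policy), ∃ k : ℕ, (k : ℝ) ≤ B ∧
    Exec sep body (I.storePolicy (mem t h) π) k (mem (t + 1) (Fin.snoc h π))

/-- The priors handed to the approximation oracle: the content of real array `3` after each run. -/
def ruleOfRun (mem : (t : ℕ) → (Fin t → I.Policy) → Mem) : I.PriorRule :=
  fun t h => (mem t h).readVec N 3

end Env

end Keychain

end

noncomputable section

namespace Keychain

/-! ### Strong convexity of the negative entropy in the `ℓ¹` norm -/

/-! The sampled policies act as an online sequence of linear losses on `K`: round t charges a prior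
p the amount u(p, π^t), whose coefficients lie in [0, m] because admissibility allows at most one
successful first test per scenario. Negative entropy is strongly convex in the ℓ¹ norm on the
simplex, so the regularized leader with weight κ = 1/η has regret at most κ ln N + T m²/(2κ) against
each q in `K`, plus a term for inexact minimization (`leader_regret`). The choices of T and η push
this below Tε (`regret_error_le`).

The regret bound holds for each realized history (`history_regret`), so q may depend on the samples
and the minimum over `K` may stand inside the expectation. On the other side, the prior of a round
is fixed before its policy is drawn, so for α ≥ 0 the oracle makes every round worth at least α
times the minimax value in conditional expectation (`expected_play_ge`). Dividing by T gives
`expectedWorstCase_ge`.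

For the running time, each round minimizes its objective over `K` by the central-cut ellipsoid
method inside the affine hull. The objective sees the history only through N cumulative utilities,
and shifting the entropy by a small θ gives it a finite gradient on all of `K`. A set of
near-minimizers contains a ball whose radius is a controlled fraction of r
(`exists_near_minimizers`), whereas each cut multiplies a d × d determinant by at most
exp(-1/(2(d+2))) as long as no point that good has been found (`CutState.step`). Comparing volumes
bounds the number of cuts by d² times logarithms (`CutState.optimal`), so 1/ε and 1/r enter the step
count only logarithmically. The method is written out as the program `roundCmd`; `Runs` is a
Hoare-style calculus with time bounds that matches its arrays with the mathematical objects
(`runs_cutLoop`, `runs_roundCmd`), and `runMem` chains the rounds. -/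

lemma sq_le_entropy_gap {z : ℝ} (h0 : 0 ≤ z) (h1 : z ≤ 1) :
    z ^ 2 ≤ (1 + z) * Real.log (1 + z) + (1 - z) * Real.log (1 - z) := by
  let f : ℝ → ℝ := fun z => (1 + z) * Real.log (1 + z) + (1 - z) * Real.log (1 - z) - z ^ 2
  have hd : ∀ x ∈ Set.Ioo (0 : ℝ) 1,
      HasDerivAt f (Real.log (1 + x) - Real.log (1 - x) - 2 * x) x := by
    intro x hx
    have e1 : HasDerivAt (fun x : ℝ => 1 + x) 1 x := (hasDerivAt_id x).const_add 1
    have e2 : HasDerivAt (fun x : ℝ => 1 - x) (-1) x := (hasDerivAt_id x).const_sub 1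
    have p1 : (1 + x) ≠ 0 := by linarith [hx.1]
    have p2 : (1 - x) ≠ 0 := by linarith [hx.2]
    have := ((e1.mul (e1.log p1)).add (e2.mul (e2.log p2))).sub ((hasDerivAt_id x).pow 2)
    refine this.congr_deriv ?_
    simp only [id]
    field_simp
    ring
  have hm : MonotoneOn f (Set.Icc 0 1) := by
    apply monotoneOn_of_deriv_nonneg (convex_Icc 0 1)
    · apply Continuous.continuousOn
      have c := Real.continuous_mul_log
      have c1 : Continuous fun z : ℝ => (1 + z) * Real.log (1 + z) :=
        c.comp (by fun_prop : Continuous fun z : ℝ => 1 + z)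
      have c2 : Continuous fun z : ℝ => (1 - z) * Real.log (1 - z) :=
        c.comp (by fun_prop : Continuous fun z : ℝ => 1 - z)
      exact (c1.add c2).sub (by fun_prop)
    · intro x hx
      rw [interior_Icc] at hx
      exact (hd x hx).differentiableAt.differentiableWithinAt
    · intro x hx
      rw [interior_Icc] at hx
      rw [(hd x hx).deriv]
      have h1x : 0 < 1 - x := by linarith [hx.2]
      -- The bound 2y/(y+2) ≤ ln(1+y) at y = 2x/(1-x) reads 2x ≤ ln((1+x)/(1-x)), which is the sign
      -- of the derivative.
      have h := Real.le_log_one_add_of_nonneg (x := 2 * x / (1 - x))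
        (div_nonneg (by linarith [hx.1]) h1x.le)
      have e1 : 1 + 2 * x / (1 - x) = (1 + x) / (1 - x) := by field_simp; ring
      have e2 : 2 * (2 * x / (1 - x)) / (2 * x / (1 - x) + 2) = 2 * x := by
        field_simp; ring
      rw [e1, e2, Real.log_div (by linarith [hx.1]) h1x.ne'] at h
      linarith
  have := hm (Set.left_mem_Icc.2 zero_le_one) ⟨h0, h1⟩ h0
  simp [f] at this
  linarith

/-- Homogeneity: with a = μ(1+z) and b = μ(1-z), the right side is μ times the one-variable gap of
`sq_le_entropy_gap`. The endpoint z = 1 relies on 0 · ln 0 = 0. -/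
lemma mul_log_midpoint_gap {a b : ℝ} (ha : 0 ≤ a) (hb : 0 ≤ b) :
    (a - b) ^ 2 / (a + b) / 2 ≤
      a * Real.log a + b * Real.log b - 2 * ((a + b) / 2 * Real.log ((a + b) / 2)) := by
  wlog hab : b ≤ a generalizing a b
  · have := this hb ha (le_of_not_ge hab)
    rw [add_comm b a] at this
    calc _ = (b - a) ^ 2 / (a + b) / 2 := by ring
      _ ≤ _ := by linarith
  rcases ha.eq_or_lt with rfl | ha'
  · have : b = 0 := le_antisymm hab hb
    simp [this]
  have hs : 0 < a + b := by linarith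
  set μ := (a + b) / 2 with hμ
  set z := (a - b) / (a + b) with hz
  have hμ0 : 0 < μ := by positivity
  have hz0 : 0 ≤ z := div_nonneg (by linarith) hs.le
  have hz1 : z ≤ 1 := by rw [hz, div_le_one hs]; linarith
  have ea : a = μ * (1 + z) := by rw [hμ, hz]; field_simp; ring
  have eb : b = μ * (1 - z) := by rw [hμ, hz]; field_simp; ring
  have la : a * Real.log a = a * Real.log μ + μ * ((1 + z) * Real.log (1 + z)) := by
    conv_lhs => rw [ea, Real.log_mul hμ0.ne' (by linarith)]
    conv_rhs => rw [ea]
    ring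
  have lb : b * Real.log b = b * Real.log μ + μ * ((1 - z) * Real.log (1 - z)) := by
    rcases hz1.eq_or_lt with h | h
    · have : b = 0 := by rw [eb, h]; ring
      simp [this, h]
    · conv_lhs => rw [eb, Real.log_mul hμ0.ne' (by linarith)]
      conv_rhs => rw [eb]
      ring
  have key := mul_le_mul_of_nonneg_left (sq_le_entropy_gap hz0 hz1) hμ0.le
  have e : (a - b) ^ 2 / (a + b) / 2 = μ * z ^ 2 := by rw [hμ, hz]; field_simp
  rw [e, la, lb]
  have h2 : a * Real.log μ + b * Real.log μ = 2 * (μ * Real.log μ) := by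
    rw [← add_mul, hμ]; ring
  linarith

/-- The negative entropy. -/
def negEntropy {N : ℕ} (p : Fin N → ℝ) : ℝ := ∑ s, p s * Real.log (p s)

/-- The `ℓ¹` distance. -/
def dist1 {N : ℕ} (p q : Fin N → ℝ) : ℝ := ∑ s, |p s - q s|

variable {N : ℕ}

lemma dist1_nonneg (p q : Fin N → ℝ) : 0 ≤ dist1 p q :=
  Finset.sum_nonneg fun _ _ => abs_nonneg _

lemma dist1_comm (p q : Fin N → ℝ) : dist1 p q = dist1 q p := by
  simp [dist1, abs_sub_comm]

/-- Strong convexity (a form of Pinsker's inequality) stated at midpoints only, so that no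
derivative at the boundary of the simplex is needed. -/
lemma negEntropy_midpoint {p q : Fin N → ℝ} (hp : p ∈ stdSimplex ℝ (Fin N))
    (hq : q ∈ stdSimplex ℝ (Fin N)) :
    negEntropy (fun s => (p s + q s) / 2) ≤
      (negEntropy p + negEntropy q) / 2 - dist1 p q ^ 2 / 8 := by
  set D := dist1 p q with hD
  -- A termwise AM-GM replaces Cauchy-Schwarz: as p + q has total mass 2, the left sides add up to
  -- D² - D²/2.
  have h1 : ∀ s, D * |p s - q s| - D ^ 2 * (p s + q s) / 4 ≤
      2 * (p s * Real.log (p s) + q s * Real.log (q s)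
        - 2 * ((p s + q s) / 2 * Real.log ((p s + q s) / 2))) := by
    intro s
    have h := mul_log_midpoint_gap (hp.1 s) (hq.1 s)
    have : D * |p s - q s| - D ^ 2 * (p s + q s) / 4 ≤ (p s - q s) ^ 2 / (p s + q s) := by
      rcases (add_nonneg (hp.1 s) (hq.1 s)).eq_or_lt with h0 | h0
      · have a1 : p s = 0 := by linarith [hp.1 s, hq.1 s]
        have a2 : q s = 0 := by linarith [hp.1 s, hq.1 s]
        simp [a1, a2]
      · rw [le_div_iff₀ h0, ← sq_abs (p s - q s)]
        nlinarith [sq_nonneg (|p s - q s| - D * (p s + q s) / 2)]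
    linarith
  have h2 := Finset.sum_le_sum fun s (_ : s ∈ Finset.univ) => h1 s
  have e1 : ∑ s, (D * |p s - q s| - D ^ 2 * (p s + q s) / 4) = D ^ 2 / 2 := by
    rw [Finset.sum_sub_distrib, ← Finset.mul_sum, ← Finset.sum_div, ← Finset.mul_sum,
      Finset.sum_add_distrib, hp.2, hq.2]
    change D * D - _ = _
    ring
  have e2 : ∑ s, 2 * (p s * Real.log (p s) + q s * Real.log (q s)
        - 2 * ((p s + q s) / 2 * Real.log ((p s + q s) / 2))) =
      2 * (negEntropy p + negEntropy q - 2 * negEntropy (fun s => (p s + q s) / 2)) := by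
    simp only [negEntropy, Finset.mul_sum, ← Finset.sum_add_distrib, ← Finset.sum_sub_distrib]
  rw [e1, e2] at h2
  linarith

lemma continuous_negEntropy : Continuous (negEntropy (N := N)) :=
  continuous_finsetSum _ fun s _ => Real.continuous_mul_log.comp (continuous_apply s)

lemma negEntropy_nonpos {p : Fin N → ℝ} (hp : p ∈ stdSimplex ℝ (Fin N)) : negEntropy p ≤ 0 := by
  apply Finset.sum_nonpos
  intro s _
  have h1 : p s ≤ 1 := by
    rw [← hp.2]; exact Finset.single_le_sum (fun i _ => hp.1 i) (Finset.mem_univ s)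
  exact mul_nonpos_of_nonneg_of_nonpos (hp.1 s) (Real.log_nonpos (hp.1 s) h1)

/-- Apply 1 - 1/x ≤ ln x to x = N · p s and sum. -/
lemma negEntropy_ge {p : Fin N → ℝ} (hp : p ∈ stdSimplex ℝ (Fin N)) :
    -Real.log N ≤ negEntropy p := by
  have hN : (0 : ℝ) < N := by
    rcases Nat.eq_zero_or_pos N with h | h
    · subst h; have := hp.2; simp at this
    · exact_mod_cast h
  have h1 : ∀ s, p s - 1 / N ≤ p s * Real.log (p s) + p s * Real.log N := by
    intro s
    rcases (hp.1 s).eq_or_lt with h | h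
    · rw [← h]; simp
    · rw [← mul_add, ← Real.log_mul h.ne' hN.ne']
      have := Real.one_sub_inv_le_log_of_pos (mul_pos h hN)
      have h2 := mul_le_mul_of_nonneg_left this h.le
      have : p s * (1 - (p s * N)⁻¹) = p s - 1 / N := by field_simp
      linarith
  have h2 := Finset.sum_le_sum fun s (_ : s ∈ Finset.univ) => h1 s
  rw [Finset.sum_sub_distrib, Finset.sum_add_distrib, ← Finset.sum_mul, hp.2] at h2
  simp [hN.ne'] at h2
  unfold negEntropy
  linarith

/-! ### Regret of the regularized leader -/

/-- Cumulative linear loss plus `κ` times the negative entropy. -/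
def leaderObjective (κ : ℝ) (g : ℕ → Fin N → ℝ) (t : ℕ) (p : Fin N → ℝ) : ℝ :=
  ∑ τ ∈ Finset.range t, ∑ s, p s * g τ s + κ * negEntropy p

lemma exists_leader {K : Set (Fin N → ℝ)} (hK : IsCompact K) (hne : K.Nonempty)
    (κ : ℝ) (g : ℕ → Fin N → ℝ) (t : ℕ) :
    ∃ x ∈ K, ∀ q ∈ K, leaderObjective κ g t x ≤ leaderObjective κ g t q := by
  have h : Continuous (leaderObjective κ g t) := by
    unfold leaderObjective
    have := continuous_negEntropy (N := N)
    fun_prop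
  obtain ⟨x, hx, hm⟩ := hK.exists_isMinOn hne h.continuousOn
  exact ⟨x, hx, fun q hq => hm hq⟩

/-- The minimizer x is no worse than the midpoint of x and q, and the midpoint beats the average of
the two values by κ/8 times the squared distance. -/
lemma leader_growth {K : Set (Fin N → ℝ)} (hK : K ⊆ stdSimplex ℝ (Fin N)) (hc : Convex ℝ K)
    {κ : ℝ} (hκ : 0 ≤ κ) {g : ℕ → Fin N → ℝ} {t : ℕ} {x q : Fin N → ℝ} (hx : x ∈ K)
    (hmin : ∀ q ∈ K, leaderObjective κ g t x ≤ leaderObjective κ g t q) (hq : q ∈ K) :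
    leaderObjective κ g t x + κ / 4 * dist1 x q ^ 2 ≤ leaderObjective κ g t q := by
  have hm : (fun s => (x s + q s) / 2) ∈ K := by
    have := hc hx hq (a := 1 / 2) (b := 1 / 2) (by norm_num) (by norm_num) (by norm_num)
    convert this using 1
    ext s
    simp
    ring
  have h1 := hmin _ hm
  have h2 := mul_le_mul_of_nonneg_left (negEntropy_midpoint (hK hx) (hK hq)) hκ
  have h3 : ∑ τ ∈ Finset.range t, ∑ s, (x s + q s) / 2 * g τ s =
      (∑ τ ∈ Finset.range t, ∑ s, x s * g τ s + ∑ τ ∈ Finset.range t, ∑ s, q s * g τ s) / 2 := by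
    rw [← Finset.sum_add_distrib, Finset.sum_div]
    refine Finset.sum_congr rfl fun τ _ => ?_
    rw [← Finset.sum_add_distrib, Finset.sum_div]
    exact Finset.sum_congr rfl fun s _ => by ring
  unfold leaderObjective at *
  rw [h3] at h1
  linarith

/-- Both points have mass 1, so w may be recentred to w - m/2, of absolute value at most m/2. This
halves the Lipschitz constant. -/
lemma linear_diff_le {p q w : Fin N → ℝ} (hp : p ∈ stdSimplex ℝ (Fin N))
    (hq : q ∈ stdSimplex ℝ (Fin N)) {m : ℝ} (h0 : ∀ s, 0 ≤ w s) (h1 : ∀ s, w s ≤ m) :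
    ∑ s, p s * w s - ∑ s, q s * w s ≤ m / 2 * dist1 p q := by
  have e : ∑ s, p s * w s - ∑ s, q s * w s = ∑ s, (p s - q s) * (w s - m / 2) := by
    simp only [sub_mul, mul_sub, Finset.sum_sub_distrib, ← Finset.sum_mul, hp.2, hq.2]
    ring
  rw [e, dist1, Finset.mul_sum]
  apply Finset.sum_le_sum
  intro s _
  calc (p s - q s) * (w s - m / 2) ≤ |(p s - q s) * (w s - m / 2)| := le_abs_self _
    _ = |w s - m / 2| * |p s - q s| := by rw [abs_mul, mul_comm]
    _ ≤ _ := by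
      gcongr
      rw [abs_le]
      constructor <;> linarith [h0 s, h1 s]

/-- Three comparisons add up: the played point with the exact leader, each leader with the next one,
and the one-step-ahead leaders with q. -/
theorem leader_regret {K : Set (Fin N → ℝ)} (hK : K ⊆ stdSimplex ℝ (Fin N)) (hc : Convex ℝ K)
    (hcp : IsCompact K) {κ m δ : ℝ} (hκ : 0 < κ) (hm : 0 ≤ m)
    {g : ℕ → Fin N → ℝ} (h0 : ∀ t s, 0 ≤ g t s) (h1 : ∀ t s, g t s ≤ m) (T : ℕ)
    {p : ℕ → Fin N → ℝ}
    (hp : ∀ t < T, p t ∈ K ∧ ∀ q ∈ K, leaderObjective κ g t (p t) ≤ leaderObjective κ g t q + δ)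
    {q : Fin N → ℝ} (hq : q ∈ K) :
    ∑ t ∈ Finset.range T, ∑ s, p t s * g t s ≤ ∑ t ∈ Finset.range T, ∑ s, q s * g t s +
      κ * Real.log N + T * (m ^ 2 / (2 * κ) + m * √(δ / κ)) := by
  choose x hxK hx using exists_leader hcp ⟨q, hq⟩ κ g
  -- Adding the growth inequalities of consecutive leaders gives (κ/2)D² ≤ (m/2)D, hence D ≤ m/κ.
  have hstab : ∀ t, ∑ s, x t s * g t s - ∑ s, x (t + 1) s * g t s ≤ m ^ 2 / (2 * κ) := by
    intro t
    have a1 := leader_growth hK hc hκ.le (hxK t) (hx t) (hxK (t + 1))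
    have a2 := leader_growth hK hc hκ.le (hxK (t + 1)) (hx (t + 1)) (hxK t)
    have a3 := linear_diff_le (hK (hxK t)) (hK (hxK (t + 1))) (h0 t) (h1 t)
    rw [dist1_comm] at a2
    have e : ∀ y, leaderObjective κ g (t + 1) y = leaderObjective κ g t y + ∑ s, y s * g t s := by
      intro y; simp only [leaderObjective, Finset.sum_range_succ]; ring
    rw [e, e] at a2
    set D := dist1 (x t) (x (t + 1))
    have b1 : κ / 2 * D ^ 2 ≤ m / 2 * D := by linarith
    have hD : 0 ≤ D := dist1_nonneg _ _
    have b2 : D ≤ m / κ := by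
      rw [le_div_iff₀ hκ]
      rcases hD.eq_or_lt with h | h
      · rw [← h]; simpa using hm
      · nlinarith
    calc _ ≤ m / 2 * D := a3
      _ ≤ m / 2 * (m / κ) := by gcongr
      _ = _ := by field_simp
  -- Here growth around the exact leader gives (κ/4)D² ≤ δ.
  have happ : ∀ t < T, ∑ s, p t s * g t s - ∑ s, x t s * g t s ≤ m * √(δ / κ) := by
    intro t ht
    obtain ⟨hpK, hpm⟩ := hp t ht
    have a1 := leader_growth hK hc hκ.le (hxK t) (hx t) hpK
    have a2 := hpm _ (hxK t)
    have a3 := linear_diff_le (hK hpK) (hK (hxK t)) (h0 t) (h1 t)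
    rw [dist1_comm] at a1
    set D := dist1 (p t) (x t)
    have b : D / 2 ≤ √(δ / κ) := by
      apply Real.le_sqrt_of_sq_le
      rw [le_div_iff₀ hκ]
      linarith
    calc _ ≤ m / 2 * D := a3
      _ = m * (D / 2) := by ring
      _ ≤ _ := by gcongr
  -- "Be the leader": playing the leader of the following round has no regret beyond the
  -- regularizer.
  have hbtl : ∀ t, κ * negEntropy (x 0) + ∑ τ ∈ Finset.range t, ∑ s, x (τ + 1) s * g τ s ≤
      leaderObjective κ g t (x t) := by
    intro t
    induction t with
    | zero => simp [leaderObjective]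
    | succ t ih =>
      have := hx t _ (hxK (t + 1))
      rw [Finset.sum_range_succ]
      have e : leaderObjective κ g (t + 1) (x (t + 1)) =
          leaderObjective κ g t (x (t + 1)) + ∑ s, x (t + 1) s * g t s := by
        simp only [leaderObjective, Finset.sum_range_succ]; ring
      linarith
  have hb := (hbtl T).trans (hx T q hq)
  have hH := mul_le_mul_of_nonneg_left (negEntropy_ge (hK (hxK 0))) hκ.le
  have hH2 := mul_nonpos_of_nonneg_of_nonpos hκ.le (negEntropy_nonpos (hK hq))
  have hs : ∑ t ∈ Finset.range T, ∑ s, p t s * g t s ≤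
      ∑ t ∈ Finset.range T,
        (∑ s, x (t + 1) s * g t s + (m ^ 2 / (2 * κ) + m * √(δ / κ))) := by
    apply Finset.sum_le_sum
    intro t ht
    have := hstab t
    have := happ t (Finset.mem_range.1 ht)
    linarith
  rw [Finset.sum_add_distrib, Finset.sum_const, Finset.card_range, nsmul_eq_mul] at hs
  unfold leaderObjective at hb
  linarith

end Keychain
end

/-! ### Utilities round by round, and the guarantee of the algorithm -/

noncomputable section

namespace Keychain

lemma countP_drop_eq_sum {α : Type*} (l : List α) (P : α → Bool) (a : α) (t : ℕ) :
    (l.drop t).countP P = ∑ j ∈ Finset.range l.length, if t ≤ j ∧ P (l.getD j a) then 1 else 0 := by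
  induction l generalizing t with
  | nil => simp
  | cons x l ih =>
    rw [List.length_cons, Finset.sum_range_succ']
    cases t with
    | zero =>
      rw [List.drop_zero, List.countP_cons]
      have := ih 0
      rw [List.drop_zero] at this
      rw [this]
      simp
    | succ t =>
      rw [List.drop_succ_cons, ih t]
      simp

lemma PMF.sum_toReal_eq_one {α : Type*} [Fintype α] (p : PMF α) : ∑ x, (p x).toReal = 1 := by
  rw [← ENNReal.toReal_sum fun x _ => p.apply_ne_top x, ← tsum_fintype (L := .unconditional _),
    p.tsum_coe, ENNReal.toReal_one]

namespace Env

variable {n N : ℕ} (I : Env n N)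

/-! ### Utilities as sums over rounds -/

/-- Whether the correct key of `s` belongs to the keychain of round `t + 1`. -/
def keyBit (s : Fin N) (t : ℕ) : ℕ := if I.key s ∈ (I.chains s).getD t ∅ then 1 else 0

/-- Whether `π` first tests the correct key of `s` in round `t + 1`, and with success. -/
def hit (π : I.Policy) (s : Fin N) (t : ℕ) : ℕ :=
  if I.actionCode π s t = I.key s + 1 then I.keyBit s t else 0

lemma rounds_le (s : Fin N) : I.rounds s ≤ I.maxRounds :=
  Finset.le_sup (f := I.rounds) (Finset.mem_univ s)

lemma mem_infoSetsOf {s : Fin N} {o : List (Finset (Fin n))} :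
    o ∈ I.infoSetsOf s ↔ ∃ t < I.rounds s, o = (I.chains s).take (t + 1) := by
  simp only [infoSetsOf, List.mem_toFinset, List.mem_filter, List.mem_inits, decide_eq_true_eq]
  constructor
  · rintro ⟨h, hne⟩
    have hl := h.length_le
    have h0 : 0 < o.length := List.length_pos_iff.2 hne
    refine ⟨o.length - 1, by unfold rounds; omega, ?_⟩
    rw [Nat.sub_add_cancel h0]
    exact List.prefix_iff_eq_take.1 h
  · rintro ⟨t, ht, rfl⟩
    refine ⟨List.take_prefix _ _, ?_⟩
    intro h
    have := congrArg List.length h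
    rw [List.length_take, List.length_nil] at this
    unfold rounds at ht
    omega

lemma take_mem_infoSetsOf {s : Fin N} {t : ℕ} (ht : t < I.rounds s) :
    (I.chains s).take (t + 1) ∈ I.infoSetsOf s := I.mem_infoSetsOf.2 ⟨t, ht, rfl⟩

lemma take_mem_infoSets {s : Fin N} {t : ℕ} (ht : t < I.rounds s) :
    (I.chains s).take (t + 1) ∈ I.infoSets :=
  Finset.mem_biUnion.2 ⟨s, Finset.mem_univ s, I.take_mem_infoSetsOf ht⟩

lemma take_injective {s : Fin N} {t t' : ℕ} (ht : t < I.rounds s) (ht' : t' < I.rounds s)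
    (h : (I.chains s).take (t + 1) = (I.chains s).take (t' + 1)) : t = t' := by
  have := congrArg List.length h
  simp only [List.length_take, rounds] at this ht ht'
  omega

lemma actionCode_eq_iff {π : I.Policy} {s : Fin N} {t : ℕ} (ht : t < I.rounds s) (k : Fin n) :
    I.actionCode π s t = k + 1 ↔ π.1 ⟨_, I.take_mem_infoSets ht⟩ = some k := by
  have h : t < I.rounds s ∧ (I.chains s).take (t + 1) ∈ I.infoSets := ⟨ht, I.take_mem_infoSets ht⟩
  rw [actionCode, dif_pos h]
  generalize π.1 ⟨_, h.2⟩ = x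
  cases x with
  | none => simp
  | some k' => simp [Fin.val_inj]

lemma reward_take {s : Fin N} {t : ℕ} (ht : t < I.rounds s) :
    I.reward (I.key s) ((I.chains s).take (t + 1)) s =
      I.keyBit s t * ((I.chains s).drop t).countP (fun C => decide (I.key s ∈ C)) := by
  have ht' : t < (I.chains s).length := ht
  have e1 : ((I.chains s).take (t + 1)).getLast? = some (I.chains s)[t] := by
    rw [List.getLast?_take]; simp [ht']
  have e2 : ((I.chains s).take (t + 1)).length - 1 = t := by
    rw [List.length_take]; omega
  unfold reward keyBit
  rw [e1, e2]
  simp [I.take_mem_infoSetsOf ht, ht']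

/-- Only the correct key earns a reward, and the information sets of s correspond bijectively to its
rounds. -/
lemma scenarioUtility_eq (π : I.Policy) (s : Fin N) :
    I.scenarioUtility π s = ∑ t ∈ Finset.range (I.rounds s),
      (I.hit π s t : ℝ) * (((I.chains s).drop t).countP (fun C => decide (I.key s ∈ C)) : ℕ) := by
  unfold scenarioUtility
  rw [Finset.sum_eq_single (I.key s)]
  · symm
    refine Finset.sum_bij (fun t ht => (⟨_, I.take_mem_infoSets (Finset.mem_range.1 ht)⟩ : I.InfoSet))
      ?_ ?_ ?_ ?_
    · intro t ht
      simp [I.take_mem_infoSetsOf (Finset.mem_range.1 ht)]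
    · intro t ht t' ht' h
      exact I.take_injective (Finset.mem_range.1 ht) (Finset.mem_range.1 ht')
        (congrArg Subtype.val h)
    · intro o ho
      obtain ⟨t, ht, h⟩ := I.mem_infoSetsOf.1 (Finset.mem_filter.1 ho).2
      exact ⟨t, Finset.mem_range.2 ht, Subtype.ext h.symm⟩
    · intro t ht
      have ht' := Finset.mem_range.1 ht
      simp only [hit, I.actionCode_eq_iff ht', I.reward_take ht']
      split_ifs <;> simp
  · intro k _ hk
    apply Finset.sum_eq_zero
    intro o _
    simp [reward, hk]
  · simp

lemma hit_le_one (π : I.Policy) (s : Fin N) (t : ℕ) : I.hit π s t ≤ 1 := by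
  unfold hit keyBit; split_ifs <;> simp

lemma hit_unique (π : I.Policy) {s : Fin N} {t t' : ℕ} (ht : t < I.rounds s)
    (ht' : t' < I.rounds s) (h : I.hit π s t ≠ 0) (h' : I.hit π s t' ≠ 0) : t = t' := by
  have a : ∀ {t}, t < I.rounds s → I.hit π s t ≠ 0 → I.actionCode π s t = I.key s + 1 := by
    intro t _ h
    by_contra hc
    exact h (by simp [hit, hc])
  have b := (I.actionCode_eq_iff ht _).1 (a ht h)
  have b' := (I.actionCode_eq_iff ht' _).1 (a ht' h')
  exact I.take_injective ht ht' (congrArg Subtype.val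
    (π.2 s _ _ (I.take_mem_infoSetsOf ht) (I.take_mem_infoSetsOf ht') _ b b'))

lemma scenarioUtility_nonneg (π : I.Policy) (s : Fin N) : 0 ≤ I.scenarioUtility π s := by
  rw [scenarioUtility_eq]; positivity

/-- Admissibility leaves at most one nonzero summand, and that one counts at most m keychains. -/
lemma scenarioUtility_le (π : I.Policy) (s : Fin N) : I.scenarioUtility π s ≤ I.maxRounds := by
  rw [scenarioUtility_eq]
  by_cases h : ∃ t < I.rounds s, I.hit π s t ≠ 0
  · obtain ⟨t, ht, h⟩ := h
    rw [Finset.sum_eq_single t]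
    · have h1 := I.hit_le_one π s t
      have h2 : ((I.chains s).drop t).countP (fun C => decide (I.key s ∈ C)) ≤ I.maxRounds := by
        refine (List.countP_le_length).trans ?_
        rw [List.length_drop]
        exact (Nat.sub_le _ _).trans (I.rounds_le s)
      exact_mod_cast (Nat.mul_le_mul h1 h2).trans (one_mul _).le
    · intro t' ht' hne
      by_cases h' : I.hit π s t' = 0
      · simp [h']
      · exact absurd (I.hit_unique π (Finset.mem_range.1 ht') ht h' h) hne
    · intro h'; exact absurd (Finset.mem_range.2 ht) h'
  · push Not at h
    rw [Finset.sum_eq_zero]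
    · positivity
    · intro t ht
      simp [h t (Finset.mem_range.1 ht)]

lemma keyBit_eq_zero {s : Fin N} {t : ℕ} (ht : I.rounds s ≤ t) : I.keyBit s t = 0 := by
  unfold rounds at ht
  rw [keyBit, List.getD_eq_default _ _ ht]
  simp

/-- The utility of a policy from the running number of successful first tests. -/
lemma scenarioUtility_eq_prefix (π : I.Policy) (s : Fin N) :
    I.scenarioUtility π s = ((∑ t ∈ Finset.range I.maxRounds,
      (∑ j ∈ Finset.range (t + 1), I.hit π s j) * I.keyBit s t : ℕ) : ℝ) := by
  rw [scenarioUtility_eq]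
  norm_cast
  have e1 : ∀ t, ((I.chains s).drop t).countP (fun C => decide (I.key s ∈ C)) =
      ∑ j ∈ Finset.range (I.rounds s), if t ≤ j then I.keyBit s j else 0 := by
    intro t
    rw [countP_drop_eq_sum _ _ ∅]
    refine Finset.sum_congr rfl fun j _ => ?_
    simp only [keyBit, decide_eq_true_eq]
    split_ifs <;> simp_all
  have hsub := Finset.range_subset_range.2 (I.rounds_le s)
  rw [← Finset.sum_subset hsub (fun t _ ht => by
    rw [I.keyBit_eq_zero (by simpa using ht), mul_zero])]
  simp only [e1, Finset.mul_sum]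
  -- Each round j is now charged with the hits up to j. This form can be evaluated in one pass with
  -- a running counter, which is what the program does.
  rw [Finset.sum_comm]
  refine Finset.sum_congr rfl fun t ht => ?_
  rw [Finset.sum_mul]
  have hs : Finset.range (t + 1) ⊆ Finset.range (I.rounds s) :=
    Finset.range_subset_range.2 (Finset.mem_range.1 ht)
  rw [← Finset.sum_subset hs]
  · refine Finset.sum_congr rfl fun j hj => ?_
    rw [if_pos (by have := Finset.mem_range.1 hj; omega)]
  · intro j _ hj
    rw [if_neg (by simp at hj; omega), mul_zero]

/-! ### Elementary bounds -/

instance : Nonempty I.Policy := ⟨⟨fun _ => none, by simp⟩⟩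

lemma utility_nonneg {p : Fin N → ℝ} (hp : p ∈ stdSimplex ℝ (Fin N)) (π : I.Policy) :
    0 ≤ I.utility p π :=
  Finset.sum_nonneg fun s _ => mul_nonneg (hp.1 s) (I.scenarioUtility_nonneg π s)

lemma optimum_nonneg {p : Fin N → ℝ} (hp : p ∈ stdSimplex ℝ (Fin N)) : 0 ≤ I.optimum p :=
  Real.iSup_nonneg fun π => I.utility_nonneg hp π

lemma minimax_nonneg {K : Set (Fin N → ℝ)} (hK : K ⊆ stdSimplex ℝ (Fin N)) : 0 ≤ I.minimax K :=
  Real.iInf_nonneg fun p => I.optimum_nonneg (hK p.2)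

lemma minimax_le {K : Set (Fin N → ℝ)} (hK : K ⊆ stdSimplex ℝ (Fin N)) {p : Fin N → ℝ}
    (hp : p ∈ K) : I.minimax K ≤ I.optimum p :=
  ciInf_le (f := fun p : K => I.optimum p)
    ⟨0, by rintro _ ⟨q, rfl⟩; exact I.optimum_nonneg (hK q.2)⟩ ⟨p, hp⟩

lemma horizon_pos (ε : ℝ) : 0 < I.horizon ε := lt_of_lt_of_le one_pos (le_max_left _ _)

lemma horizon_ge (ε : ℝ) :
    4 * (I.maxRounds : ℝ) ^ 2 * Real.log N / ε ^ 2 ≤ I.horizon ε :=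
  (Nat.le_ceil _).trans (Nat.cast_le.2 (le_max_right _ _))

lemma horizon_le (ε : ℝ) :
    (I.horizon ε : ℝ) ≤ 4 * ((I.maxRounds : ℝ) ^ 2 * Real.log N / ε ^ 2) + 1 := by
  have h0 : 0 ≤ 4 * (I.maxRounds : ℝ) ^ 2 * Real.log N / ε ^ 2 := by
    have : 0 ≤ Real.log N := Real.log_natCast_nonneg N
    positivity
  have h := (Nat.ceil_lt_add_one h0).le
  unfold horizon
  rw [Nat.cast_max, max_le_iff]
  constructor
  · have : 4 * ((I.maxRounds : ℝ) ^ 2 * Real.log N / ε ^ 2) =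
      4 * (I.maxRounds : ℝ) ^ 2 * Real.log N / ε ^ 2 := by ring
    rw [this]; push_cast; linarith
  · refine h.trans (le_of_eq ?_); ring

/-- With l = √L and t = √T, the regret terms are m·l·t and m·l·t/2, and the choice of T says 2ml ≤
εt. Together they cost at most (3/4)Tε, which leaves a quarter for inexact minimization. -/
lemma regret_error_le {m L T ε δ : ℝ} (hm : 0 < m) (hL : 0 < L) (hT : 0 < T) (hε : 0 < ε)
    (hδε : δ ≤ ε / 64) (h : 4 * m ^ 2 * L / ε ^ 2 ≤ T) :
    1 / (√L / (m * √T)) * L +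
      T * (m ^ 2 / (2 * (1 / (√L / (m * √T)))) + m * √(δ / (1 / (√L / (m * √T))))) ≤ T * ε := by
  obtain ⟨l, hl, rfl⟩ : ∃ l, 0 < l ∧ l ^ 2 = L := ⟨√L, Real.sqrt_pos.2 hL, Real.sq_sqrt hL.le⟩
  obtain ⟨t, ht, rfl⟩ : ∃ t, 0 < t ∧ t ^ 2 = T := ⟨√T, Real.sqrt_pos.2 hT, Real.sq_sqrt hT.le⟩
  rw [Real.sqrt_sq hl.le, Real.sqrt_sq ht.le]
  have h2 : 2 * m * l ≤ ε * t := by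
    rw [div_le_iff₀ (by positivity)] at h
    apply le_of_sq_le_sq _ (by positivity)
    nlinarith
  have e1 : 1 / (l / (m * t)) = m * t / l := by field_simp
  rw [e1]
  have a1 : m * t / l * l ^ 2 = m * l * t := by field_simp
  have a2 : t ^ 2 * (m ^ 2 / (2 * (m * t / l))) = m * l * t / 2 := by field_simp
  -- The square is δml/t ≤ ε²/128, and 128 > 11². Then 3/4 + 1/11 < 1.
  have a3 : m * √(δ / (m * t / l)) ≤ ε / 11 := by
    rw [← le_div_iff₀' hm]
    apply Real.sqrt_le_iff.2 ⟨by positivity, ?_⟩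
    rw [div_pow, div_div_eq_mul_div, div_le_div_iff₀ (by positivity) (by positivity)]
    have : δ * l * (2 * m) ≤ ε / 64 * (ε * t) := by
      calc δ * l * (2 * m) = δ * (2 * m * l) := by ring
        _ ≤ _ := by gcongr
    have h3 : 0 ≤ ε * ε * t * m := by positivity
    nlinarith [mul_le_mul_of_nonneg_left this hm.le]
  rw [a1, mul_add, a2]
  have h4 : t * (2 * m * l) ≤ t * (ε * t) := by gcongr
  have h5 : t ^ 2 * (m * √(δ / (m * t / l))) ≤ t ^ 2 * (ε / 11) := by gcongr
  have h6 : 0 < t ^ 2 * ε := by positivity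
  nlinarith

/-! ### The guarantee of the algorithm -/

lemma utility_eq_zero {p : Fin N → ℝ} (h : I.maxRounds = 0) (π : I.Policy) : I.utility p π = 0 := by
  apply Finset.sum_eq_zero
  intro s _
  have h1 := I.scenarioUtility_nonneg π s
  have h2 := I.scenarioUtility_le π s
  rw [h, Nat.cast_zero] at h2
  rw [le_antisymm h2 h1, mul_zero]

lemma pos_of_mem_stdSimplex {p : Fin N → ℝ} (hp : p ∈ stdSimplex ℝ (Fin N)) : 0 < N := by
  rcases Nat.eq_zero_or_pos N with h | h
  · subst h; have := hp.2; simp at this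
  · exact h

/-- The first `t` entries of a history. -/
def past {T : ℕ} (h : Fin T → I.Policy) (t : Fin T) : Fin t → I.Policy :=
  fun i => h ⟨i, i.2.trans t.2⟩

/-- The total utility of the policies of a history, each under the prior of its round. -/
def playValue (rule : I.PriorRule) {T : ℕ} (h : Fin T → I.Policy) : ℝ :=
  ∑ t : Fin T, I.utility (rule t (I.past h t)) (h t)

/-- A statement about every single history, without expectation; this lets the comparison point q be
chosen after the samples are known. -/
theorem history_regret {K : Set (Fin N → ℝ)} (hK : K ⊆ stdSimplex ℝ (Fin N)) (hc : Convex ℝ K)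
    (hcl : IsClosed K) {ε δ : ℝ} (hε : 0 < ε) (hδε : δ ≤ ε / 64) {rule : I.PriorRule}
    (hr : I.IsFTRL K ε δ rule) (h : Fin (I.horizon ε) → I.Policy) {q : Fin N → ℝ} (hq : q ∈ K) :
    I.playValue rule h ≤ ∑ t, I.utility q (h t) + I.horizon ε * ε := by
  have hpos : 0 < I.horizon ε * ε := mul_pos (by exact_mod_cast I.horizon_pos ε) hε
  -- If m = 0 or N = 1, the convention x/0 = 0 makes the entropy weight vanish and strong convexity
  -- is lost. But then all utilities are zero, or the simplex is a single point.
  rcases Nat.eq_zero_or_pos I.maxRounds with hm | hm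
  · simp only [playValue, I.utility_eq_zero hm, Finset.sum_const_zero]; linarith
  have hN := pos_of_mem_stdSimplex (hK hq)
  rcases Nat.lt_or_ge 1 N with hN1 | hN1
  swap
  · obtain rfl : N = 1 := by omega
    unfold playValue
    have : ∀ t : Fin (I.horizon ε), rule t (I.past h t) = q := by
      intro t
      have h1 := (hK (hr t t.2 (I.past h t)).1).2
      have h2 := (hK hq).2
      simp only [Fin.sum_univ_one] at h1 h2
      ext s
      rw [Fin.fin_one_eq_zero s, h1, h2]
    simp only [this]
    linarith
  have hL : 0 < Real.log N := Real.log_pos (by exact_mod_cast hN1)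
  have hT : (0 : ℝ) < I.horizon ε := by exact_mod_cast I.horizon_pos ε
  have hm' : (0 : ℝ) < I.maxRounds := by exact_mod_cast hm
  let g : ℕ → Fin N → ℝ := fun t s => if ht : t < I.horizon ε then I.scenarioUtility (h ⟨t, ht⟩) s else 0
  let p : ℕ → Fin N → ℝ := fun t => if ht : t < I.horizon ε then rule t (I.past h ⟨t, ht⟩) else q
  have hcp : IsCompact K := (isCompact_stdSimplex ℝ (Fin N)).of_isClosed_subset hcl hK
  have hκ : 0 < 1 / I.learningRate ε := by unfold learningRate; positivity
  have hobj : ∀ (t : Fin (I.horizon ε)) y,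
      leaderObjective (1 / I.learningRate ε) g t y = I.ftrlObjective ε (I.past h t) y := by
    intro t y
    unfold leaderObjective ftrlObjective
    rw [Finset.sum_range]
    congr 1
    refine Finset.sum_congr rfl fun τ _ => ?_
    simp only [utility, past, g, dif_pos (τ.2.trans t.2)]
  have key := leader_regret hK hc hcp hκ hm'.le (δ := δ) (g := g) (p := p) ?_ ?_ (I.horizon ε) ?_ hq
  · have herr := regret_error_le hm' hL hT hε hδε (I.horizon_ge ε)
    rw [Finset.sum_range, Finset.sum_range] at key
    simp only [g, p, Fin.is_lt, dif_pos, Fin.eta] at key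
    unfold learningRate at key
    unfold playValue utility
    linarith
  · intro t s
    simp only [g]; split_ifs
    · exact I.scenarioUtility_nonneg _ s
    · exact le_rfl
  · intro t s
    simp only [g]; split_ifs
    · exact I.scenarioUtility_le _ s
    · positivity
  · intro t ht
    have := hr t ht (I.past h ⟨t, ht⟩)
    simp only [p, dif_pos ht]
    refine ⟨this.1, fun q hq => ?_⟩
    rw [hobj ⟨t, ht⟩, hobj ⟨t, ht⟩]
    exact this.2 q hq

lemma runLaw_snoc (A : (Fin N → ℝ) → PMF I.Policy) (rule : I.PriorRule) (T : ℕ)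
    (h : Fin T → I.Policy) (π : I.Policy) :
    I.runLaw A rule (T + 1) (Fin.snoc h π) = I.runLaw A rule T h * A (rule T h) π := by
  rw [runLaw, PMF.bind_apply, tsum_eq_single h]
  · congr 1
    rw [PMF.map_apply, tsum_eq_single π]
    · simp
    · intro π' hne
      rw [if_neg]
      intro he
      have := congrFun he (Fin.last T)
      simp at this
      exact hne this.symm
  · intro h' hne
    rw [PMF.map_apply, ENNReal.tsum_eq_zero.2, mul_zero]
    intro π'
    rw [if_neg]
    intro he
    apply hne
    have := congrArg Fin.init he
    simpa using this.symm

lemma sum_runLaw_succ (A : (Fin N → ℝ) → PMF I.Policy) (rule : I.PriorRule) (T : ℕ)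
    (f : (Fin (T + 1) → I.Policy) → ℝ) :
    ∑ h, (I.runLaw A rule (T + 1) h).toReal * f h =
      ∑ h, (I.runLaw A rule T h).toReal * ∑ π, (A (rule T h) π).toReal * f (Fin.snoc h π) := by
  rw [← (Fin.snocEquiv fun _ => I.Policy).sum_comp, Fintype.sum_prod_type, Finset.sum_comm]
  refine Finset.sum_congr rfl fun h _ => ?_
  rw [Finset.mul_sum]
  refine Finset.sum_congr rfl fun π _ => ?_
  change (I.runLaw A rule (T + 1) (Fin.snoc h π)).toReal * f (Fin.snoc h π) = _
  rw [runLaw_snoc, ENNReal.toReal_mul, mul_assoc]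

/-- Conditionally on the past the prior is a fixed point of `K`, so the fresh call to the oracle
earns at least α times the optimum there, which is at least α times the minimax value since α ≥ 0.
-/
lemma expected_play_ge {K : Set (Fin N → ℝ)} (hK : K ⊆ stdSimplex ℝ (Fin N)) {α : ℝ} (hα : 0 ≤ α)
    {A : (Fin N → ℝ) → PMF I.Policy} (hA : I.IsApproxOracle α A) {rule : I.PriorRule} (T : ℕ)
    (hr : ∀ t < T, ∀ h, rule t h ∈ K) :
    T * (α * I.minimax K) ≤
      ∑ h, (I.runLaw A rule T h).toReal * I.playValue rule h := by
  induction T with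
  | zero => simp [playValue]
  | succ T ih =>
    have ih := ih fun t ht => hr t (by omega)
    rw [sum_runLaw_succ]
    -- The priors of the earlier rounds depend only on the common prefix, so one more sample adds
    -- one summand.
    have e : ∀ (h : Fin T → I.Policy) (π : I.Policy),
        I.playValue rule (Fin.snoc h π : Fin (T + 1) → I.Policy) =
        I.playValue rule h + I.utility (rule T h) π := by
      intro h π
      unfold playValue
      rw [Fin.sum_univ_castSucc]
      congr 1
      · refine Finset.sum_congr rfl fun t _ => ?_
        rw [Fin.snoc_castSucc]
        congr 2
        ext1 i
        have := Fin.snoc_castSucc (α := fun _ => I.Policy) π h ⟨i, i.2.trans t.2⟩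
        exact this
      · rw [Fin.snoc_last]
        congr 2
        ext1 i
        have := Fin.snoc_castSucc (α := fun _ => I.Policy) π h i
        exact this
    have step : ∀ h : Fin T → I.Policy,
        I.playValue rule h + α * I.minimax K ≤
        ∑ π, (A (rule T h) π).toReal *
          I.playValue rule (Fin.snoc h π : Fin (T + 1) → I.Policy) := by
      intro h
      simp only [e, mul_add, Finset.sum_add_distrib, ← Finset.sum_mul, PMF.sum_toReal_eq_one,
        one_mul]
      have h1 := hA _ (hK (hr T (by omega) h))
      have h2 := mul_le_mul_of_nonneg_left (I.minimax_le hK (hr T (by omega) h)) hα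
      linarith
    calc ((T + 1 : ℕ) : ℝ) * (α * I.minimax K) = T * (α * I.minimax K) + 1 * (α * I.minimax K) := by
          push_cast; ring
      _ ≤ ∑ h, (I.runLaw A rule T h).toReal *
            (I.playValue rule h + α * I.minimax K) := by
          simp only [mul_add (ENNReal.toReal _), Finset.sum_add_distrib, ← Finset.sum_mul,
            PMF.sum_toReal_eq_one]
          linarith
      _ ≤ _ := Finset.sum_le_sum fun h _ =>
          mul_le_mul_of_nonneg_left (step h) ENNReal.toReal_nonneg

theorem expectedWorstCase_ge {K : Set (Fin N → ℝ)} (hK : K ⊆ stdSimplex ℝ (Fin N))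
    (hc : Convex ℝ K) (hcl : IsClosed K) (hne : K.Nonempty) {ε δ α : ℝ} (hε : 0 < ε)
    (hδε : δ ≤ ε / 64) {A : (Fin N → ℝ) → PMF I.Policy} (hA : I.IsApproxOracle α A)
    {rule : I.PriorRule} (hr : I.IsFTRL K ε δ rule) :
    I.expectedWorstCase K A rule (I.horizon ε) ≥ α * I.minimax K - ε := by
  have hT : (0 : ℝ) < I.horizon ε := by exact_mod_cast I.horizon_pos ε
  have : Nonempty K := hne.to_subtype
  unfold expectedWorstCase
  rcases lt_or_ge α 0 with hα | hα
  -- For negative α the oracle guarantee is not needed: utilities are nonnegative.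
  · have h1 : α * I.minimax K ≤ 0 := mul_nonpos_of_nonpos_of_nonneg hα.le (I.minimax_nonneg hK)
    have h2 : 0 ≤ ∑ h, (I.runLaw A rule (I.horizon ε) h).toReal * ⨅ p : K, I.uniformUtility h p :=
      Finset.sum_nonneg fun h _ => mul_nonneg ENNReal.toReal_nonneg <| Real.iInf_nonneg fun p =>
        div_nonneg (Finset.sum_nonneg fun t _ => I.utility_nonneg (hK p.2) _) hT.le
    linarith
  · have h1 := I.expected_play_ge hK hα hA (I.horizon ε) fun t ht h => (hr t ht h).1
    have h2 : ∀ h : Fin (I.horizon ε) → I.Policy,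
        (I.playValue rule h) / I.horizon ε - ε ≤
          ⨅ p : K, I.uniformUtility h p := by
      intro h
      apply le_ciInf
      intro p
      have := I.history_regret hK hc hcl hε hδε hr h p.2
      unfold uniformUtility
      rw [sub_le_iff_le_add, div_le_iff₀ hT, add_mul, div_mul_cancel₀ _ hT.ne']
      linarith
    have h3 := Finset.sum_le_sum fun h (_ : h ∈ Finset.univ) =>
      mul_le_mul_of_nonneg_left (h2 h) (ENNReal.toReal_nonneg (a := I.runLaw A rule (I.horizon ε) h))
    simp only [mul_sub, Finset.sum_sub_distrib, ← Finset.sum_mul, PMF.sum_toReal_eq_one,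
      mul_div_assoc', ← Finset.sum_div] at h3
    have h4 := (le_div_iff₀' hT).2 h1
    linarith

theorem exists_isFTRL {K : Set (Fin N → ℝ)} (hK : K ⊆ stdSimplex ℝ (Fin N)) (hcl : IsClosed K)
    (hne : K.Nonempty) (ε : ℝ) : ∃ rule : I.PriorRule, I.IsFTRL K ε 0 rule := by
  have hcp : IsCompact K := (isCompact_stdSimplex ℝ (Fin N)).of_isClosed_subset hcl hK
  have : ∀ (t : ℕ) (h : Fin t → I.Policy), ∃ x ∈ K, ∀ q ∈ K,
      I.ftrlObjective ε h x ≤ I.ftrlObjective ε h q := by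
    intro t h
    have hcont : Continuous (I.ftrlObjective ε h) := by
      have h1 := continuous_negEntropy (N := N)
      change Continuous fun p => ∑ τ, I.utility p (h τ) + 1 / I.learningRate ε * negEntropy p
      unfold utility
      fun_prop
    obtain ⟨x, hx, hm⟩ := hcp.exists_isMinOn hne hcont.continuousOn
    exact ⟨x, hx, fun q hq => hm hq⟩
  choose rule h1 h2 using this
  exact ⟨rule, fun t _ h => ⟨h1 t h, fun q hq => by simpa using h2 t h q hq⟩⟩

end Env
end Keychain
end

noncomputable section

namespace Keychain

/-! ### Bounded-time execution with a postcondition -/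

namespace Mem

@[simp] lemma setNat_nat (σ : Mem) (A i v B j : ℕ) :
    (σ.setNat A i v).nat B j = if B = A then (if j = i then v else σ.nat A j) else σ.nat B j := by
  by_cases h : B = A
  · subst h; simp [setNat, Function.update_apply]
  · simp [setNat, h]

@[simp] lemma setNat_real (σ : Mem) (A i v : ℕ) : (σ.setNat A i v).real = σ.real := rfl

@[simp] lemma setReal_nat (σ : Mem) (A i : ℕ) (v : ℝ) : (σ.setReal A i v).nat = σ.nat := rfl

@[simp] lemma setReal_real (σ : Mem) (A i : ℕ) (v : ℝ) (B j : ℕ) :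
    (σ.setReal A i v).real B j =
      if B = A then (if j = i then v else σ.real A j) else σ.real B j := by
  by_cases h : B = A
  · subst h; simp [setReal, Function.update_apply]
  · simp [setReal, h]

lemma setNat_nat_ne (σ : Mem) {A B : ℕ} (i v : ℕ) (h : B ≠ A) :
    (σ.setNat A i v).nat B = σ.nat B := by
  simp [setNat, h]

lemma setReal_real_ne (σ : Mem) {A B : ℕ} (i : ℕ) (v : ℝ) (h : B ≠ A) :
    (σ.setReal A i v).real B = σ.real B := by
  simp [setReal, h]

@[simp] lemma writeVec_nat {N : ℕ} (σ : Mem) (A : ℕ) (v : Fin N → ℝ) :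
    (σ.writeVec A v).nat = σ.nat := rfl

lemma writeVec_real_ne {N : ℕ} (σ : Mem) {A B : ℕ} (v : Fin N → ℝ) (h : B ≠ A) :
    (σ.writeVec A v).real B = σ.real B := by
  simp [writeVec, h]

@[simp] lemma writeVec_real {N : ℕ} (σ : Mem) (A : ℕ) (v : Fin N → ℝ) (s : Fin N) :
    (σ.writeVec A v).real A s = v s := by
  simp [writeVec]

end Mem

variable {N : ℕ} {sep : (Fin N → ℝ) → Option (Fin N → ℝ)}

/-- From `σ`, the program halts within `B` steps in a memory satisfying `Q`. -/
def Runs (sep : (Fin N → ℝ) → Option (Fin N → ℝ)) (P : Cmd) (σ : Mem) (B : ℕ) (Q : Mem → Prop) :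
    Prop := ∃ k ≤ B, ∃ σ', Exec sep P σ k σ' ∧ Q σ'

namespace Runs

lemma mono {P : Cmd} {σ : Mem} {B B' : ℕ} {Q Q' : Mem → Prop} (h : Runs sep P σ B Q)
    (hB : B ≤ B') (hQ : ∀ σ', Q σ' → Q' σ') : Runs sep P σ B' Q' := by
  obtain ⟨k, hk, σ', he, hq⟩ := h
  exact ⟨k, hk.trans hB, σ', he, hQ _ hq⟩

lemma skip {σ : Mem} {Q : Mem → Prop} (h : Q σ) : Runs sep .skip σ 1 Q :=
  ⟨1, le_rfl, σ, .skip σ, h⟩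

lemma setNat {A : ℕ} {i e : NatExp} {σ : Mem} {Q : Mem → Prop}
    (h : Q (σ.setNat A (i.eval σ) (e.eval σ))) : Runs sep (.setNat A i e) σ 1 Q :=
  ⟨1, le_rfl, _, .setNat A i e σ, h⟩

lemma setReal {A : ℕ} {i : NatExp} {e : RealExp} {σ : Mem} {Q : Mem → Prop}
    (h : Q (σ.setReal A (i.eval σ) (e.eval σ))) : Runs sep (.setReal A i e) σ 1 Q :=
  ⟨1, le_rfl, _, .setReal A i e σ, h⟩

lemma separate {x f c : ℕ} {σ : Mem} {Q : Mem → Prop} (h : Q (oracleStep sep x f c σ)) :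
    Runs sep (.separate x f c) σ (N + 1) Q :=
  ⟨N + 1, le_rfl, _, .separate x f c σ, h⟩

lemma seq {P P' : Cmd} {σ : Mem} {B B' : ℕ} {Q R : Mem → Prop} (h : Runs sep P σ B R)
    (h' : ∀ σ', R σ' → Runs sep P' σ' B' Q) : Runs sep (.seq P P') σ (B + B') Q := by
  obtain ⟨k, hk, σ', he, hr⟩ := h
  obtain ⟨l, hl, σ'', he', hq⟩ := h' σ' hr
  exact ⟨k + l, add_le_add hk hl, σ'', .seq he he', hq⟩

lemma ite {b : Test} {P P' : Cmd} {σ : Mem} {B B' : ℕ} {Q : Mem → Prop}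
    (h : b.Holds σ → Runs sep P σ B Q) (h' : ¬ b.Holds σ → Runs sep P' σ B' Q) :
    Runs sep (.ite b P P') σ (B + B' + 1) Q := by
  by_cases hb : b.Holds σ
  · obtain ⟨k, hk, σ', he, hq⟩ := h hb
    exact ⟨k + 1, by omega, σ', .ite_true hb he, hq⟩
  · obtain ⟨k, hk, σ', he, hq⟩ := h' hb
    exact ⟨k + 1, by omega, σ', .ite_false hb he, hq⟩

lemma loop {b : Test} {P : Cmd} {B L : ℕ} {Inv : ℕ → Mem → Prop}
    (hbody : ∀ k < L, ∀ σ, Inv k σ → b.Holds σ ∧ Runs sep P σ B (Inv (k + 1)))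
    (hend : ∀ σ, Inv L σ → ¬ b.Holds σ) {σ : Mem} (h0 : Inv 0 σ) :
    Runs sep (.loop b P) σ (L * (B + 1) + 1) (Inv L) := by
  suffices h : ∀ j k σ, k + j = L → Inv k σ →
      Runs sep (.loop b P) σ (j * (B + 1) + 1) (Inv L) from h L 0 σ (by omega) h0
  intro j
  induction j with
  | zero =>
    intro k σ hk hi
    obtain rfl : k = L := by omega
    exact ⟨1, by omega, σ, .loop_false (hend σ hi), hi⟩
  | succ j ih =>
    intro k σ hk hi
    obtain ⟨hb, l, hl, σ', he, hi'⟩ := hbody k (by omega) σ hi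
    obtain ⟨l', hl', σ'', he', hq⟩ := ih (k + 1) σ' (by omega) hi'
    exact ⟨l + l' + 1, by rw [Nat.add_mul]; omega, σ'', .loop_true hb he he', hq⟩

end Runs

/-! ### Loops over index ranges -/

/-- `for i < e do P`, the counter `i` being cell `0` of the natural array `ctr`. -/
def forLoop (ctr : ℕ) (e : NatExp) (P : Cmd) : Cmd :=
  .seq (.setNat ctr (.lit 0) (.lit 0)) (.loop (.natLt (.cell ctr (.lit 0)) e)
    (.seq P (.setNat ctr (.lit 0) (.add (.cell ctr (.lit 0)) (.lit 1)))))

/-- A pass costs its body, one increment and one test; the final 2 pays for the initialization and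
the failing test. `hctr` demands an invariant that does not depend on the counter, whose value is
supplied separately. -/
lemma Runs.forLoop {ctr : ℕ} {e : NatExp} {P : Cmd} {B L : ℕ} {Inv : ℕ → Mem → Prop}
    (hctr : ∀ k σ v, Inv k σ → Inv k (σ.setNat ctr 0 v))
    (he : ∀ k σ, Inv k σ → e.eval σ = L)
    (hbody : ∀ k < L, ∀ σ, Inv k σ → σ.nat ctr 0 = k →
      Runs sep P σ B fun σ' => σ'.nat ctr 0 = k ∧ Inv (k + 1) σ')
    {σ : Mem} (h0 : Inv 0 σ) :
    Runs sep (forLoop ctr e P) σ (L * (B + 2) + 2) (Inv L) := by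
  have hl := Runs.loop (sep := sep) (b := .natLt (.cell ctr (.lit 0)) e)
    (P := .seq P (.setNat ctr (.lit 0) (.add (.cell ctr (.lit 0)) (.lit 1)))) (B := B + 1) (L := L)
    (Inv := fun k σ => σ.nat ctr 0 = k ∧ Inv k σ) ?_ ?_
    (σ := σ.setNat ctr 0 0) ⟨by simp, hctr 0 σ 0 h0⟩
  · have h := Runs.seq (sep := sep) (P := .setNat ctr (.lit 0) (.lit 0)) (σ := σ)
      (R := fun σ' => σ' = σ.setNat ctr 0 0) (Runs.setNat (by simp [NatExp.eval])) (by
        rintro _ rfl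
        exact hl)
    exact h.mono (le_of_eq (by ring)) fun _ h => h.2
  · rintro k hk σ ⟨hc, hi⟩
    refine ⟨?_, ?_⟩
    · change σ.nat ctr 0 < e.eval σ
      rw [he k σ hi, hc]; exact hk
    · refine Runs.seq (hbody k hk σ hi hc) ?_
      rintro σ' ⟨hc', hi'⟩
      apply Runs.setNat
      simp only [NatExp.eval]
      exact ⟨by simp [hc'], hctr _ _ _ hi'⟩
  · rintro σ ⟨hc, hi⟩ hlt
    change σ.nat ctr 0 < e.eval σ at hlt
    rw [he L σ hi, hc] at hlt
    exact lt_irrefl _ hlt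

/-- `σ'` differs from `σ` at most in the loop counters, the accumulator and real array `A`. -/
structure Same (A : ℕ) (σ σ' : Mem) : Prop where
  nat : ∀ k, k ≠ 5 → k ≠ 6 → σ'.nat k = σ.nat k
  real : ∀ k, k ≠ A → k ≠ 10 → σ'.real k = σ.real k

namespace Same

lemma refl (A : ℕ) (σ : Mem) : Same A σ σ := ⟨fun _ _ _ => rfl, fun _ _ _ => rfl⟩

lemma setNat {A : ℕ} {σ σ' : Mem} (h : Same A σ σ') {c : ℕ} (hc : c = 5 ∨ c = 6) (i v : ℕ) :
    Same A σ (σ'.setNat c i v) :=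
  ⟨fun k h5 h6 => by rw [Mem.setNat_nat_ne _ _ _ (by rcases hc with rfl | rfl <;> assumption),
    h.nat k h5 h6], h.real⟩

lemma setReal {A : ℕ} {σ σ' : Mem} (h : Same A σ σ') {c : ℕ} (hc : c = A ∨ c = 10) (i : ℕ)
    (v : ℝ) : Same A σ (σ'.setReal c i v) :=
  ⟨h.nat, fun k h5 h6 => by rw [Mem.setReal_real_ne _ _ _
    (by rcases hc with rfl | rfl <;> assumption), h.real k h5 h6]⟩

end Same

/-- `for i < e₁ do A[i] := E'`, where `E'` may refer to `∑ j < e₂, E` in cell `0` of real array `10`.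
The counters `i` and `j` are in the natural arrays `5` and `6`. -/
def mapSum (A : ℕ) (e₁ e₂ : NatExp) (E E' : RealExp) : Cmd :=
  forLoop 5 e₁ (.seq (.setReal 10 (.lit 0) (.ofNat (.lit 0)))
    (.seq (forLoop 6 e₂ (.setReal 10 (.lit 0) (.add (.cell 10 (.lit 0)) E)))
      (.setReal A (.cell 5 (.lit 0)) E')))

/-- During `mapSum`: entries of `A` from `i` on are still unchanged. -/
structure Midway (A : ℕ) (σ : Mem) (i : ℕ) (σ' : Mem) : Prop extends Same A σ σ' where
  rest : ∀ k, i ≤ k → σ'.real A k = σ.real A k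
  ctr : σ'.nat 5 0 = i

/-- The hypotheses on the expressions are stated for `Midway` memories, where the entries from i on
are still old. So an array may be updated in place by an expression that reads its own entry i. -/
lemma Runs.mapSum {A L₁ L₂ : ℕ} (hA : A ≠ 10) {e₁ e₂ : NatExp} {E E' : RealExp} {σ : Mem}
    (f : Fin L₁ → Fin L₂ → ℝ) (g : Fin L₁ → ℝ)
    (he₁ : ∀ σ', Same A σ σ' → e₁.eval σ' = L₁) (he₂ : ∀ σ', Same A σ σ' → e₂.eval σ' = L₂)
    (hE : ∀ (i : Fin L₁) (j : Fin L₂) σ', Midway A σ i σ' → σ'.nat 6 0 = j → E.eval σ' = f i j)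
    (hE' : ∀ (i : Fin L₁) σ', Midway A σ i σ' → σ'.real 10 0 = ∑ j, f i j → E'.eval σ' = g i) :
    Runs sep (mapSum A e₁ e₂ E E') σ (6 * (L₁ + 1) * (L₂ + 1)) fun σ' =>
      Same A σ σ' ∧ (∀ i : Fin L₁, σ'.real A i = g i) ∧ ∀ i, L₁ ≤ i → σ'.real A i = σ.real A i := by
  let Inv : ℕ → Mem → Prop := fun i σ' => Same A σ σ' ∧
    (∀ j : Fin L₁, (j : ℕ) < i → σ'.real A j = g j) ∧ ∀ j, i ≤ j → σ'.real A j = σ.real A j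
  refine (Runs.forLoop (sep := sep) (L := L₁) (B := 3 * L₂ + 4) (Inv := Inv) ?_ ?_ ?_
    ⟨Same.refl A σ, by simp, by simp⟩).mono (by nlinarith [Nat.zero_le (L₁ * L₂)])
    (fun σ' h => ⟨h.1, fun i => h.2.1 i i.2, h.2.2⟩)
  · rintro k σ' v ⟨h1, h2, h3⟩
    exact ⟨h1.setNat (.inl rfl) _ _, h2, h3⟩
  · rintro k σ' ⟨h1, -, -⟩
    exact he₁ σ' h1
  rintro i hi σ₁ ⟨h1, h2, h3⟩ hc
  let F : ℕ → ℝ := fun l => if h : l < L₂ then f ⟨i, hi⟩ ⟨l, h⟩ else 0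
  let Inn : ℕ → Mem → Prop := fun j σ' => Inv i σ' ∧ σ'.nat 5 0 = i ∧
    σ'.real 10 0 = ∑ l ∈ Finset.range j, F l
  refine (Runs.seq (B := 1) (B' := (L₂ * (1 + 2) + 2) + 1) (R := Inn 0) ?_ ?_).mono (by omega)
    fun _ h => h
  · apply Runs.setReal
    refine ⟨⟨h1.setReal (.inr rfl) _ _, ?_, ?_⟩, by simpa using hc, by simp [NatExp.eval, RealExp.eval]⟩
    · intro j hj; simpa [hA] using h2 j hj
    · intro j hj; simpa [hA] using h3 j hj
  intro σ₂ hσ₂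
  refine Runs.seq (R := Inn L₂) (Runs.forLoop (sep := sep) ?_ ?_ ?_ hσ₂) ?_
  · rintro k σ' v ⟨⟨h1, h2, h3⟩, h4, h5⟩
    exact ⟨⟨h1.setNat (.inr rfl) _ _, h2, h3⟩, by simpa using h4, h5⟩
  · rintro k σ' ⟨⟨h1, -, -⟩, -, -⟩
    exact he₂ σ' h1
  · rintro j hj σ₃ ⟨⟨h1, h2, h3⟩, h4, h5⟩ hc6
    have hv := hE ⟨i, hi⟩ ⟨j, hj⟩ σ₃ ⟨h1, h3, h4⟩ hc6
    apply Runs.setReal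
    refine ⟨by simpa using hc6, ⟨h1.setReal (.inr rfl) _ _, ?_, ?_⟩, by simpa using h4, ?_⟩
    · intro j hj; simpa [hA] using h2 j hj
    · intro j hj; simpa [hA] using h3 j hj
    · simp [NatExp.eval, RealExp.eval, h5, hv, Finset.sum_range_succ, F, hj]
  · rintro σ₃ ⟨⟨h1, h2, h3⟩, h4, h5⟩
    have hs : ∑ l ∈ Finset.range L₂, F l = ∑ j, f ⟨i, hi⟩ j := by
      rw [Finset.sum_range]; exact Finset.sum_congr rfl fun j _ => by simp [F]
    have hv := hE' ⟨i, hi⟩ σ₃ ⟨h1, h3, h4⟩ (h5.trans hs)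
    apply Runs.setReal
    refine ⟨by simpa using h4, h1.setReal (.inl rfl) _ _, ?_, ?_⟩
    · intro j hj
      simp only [NatExp.eval, h4, hv, Mem.setReal_real, if_true]
      split_ifs with hji
      · congr 1; exact Fin.ext hji.symm
      · exact h2 j (by omega)
    · intro j hj
      simp only [NatExp.eval, h4, hv, Mem.setReal_real, if_true]
      rw [if_neg (by omega)]
      exact h3 j (by omega)

/-- `for i < e₁ do for j < e₂ do A[i * e₂ + j] := E`. -/
def gridMap (A : ℕ) (e₁ e₂ : NatExp) (E : RealExp) : Cmd :=
  forLoop 5 e₁ (forLoop 6 e₂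
    (.setReal A (.add (.mul (.cell 5 (.lit 0)) e₂) (.cell 6 (.lit 0))) E))

/-- The invariant is indexed by the flat address i · L₂ + j. As in `Runs.mapSum`, the expression may
read the old value of the cell being written. -/
lemma Runs.gridMap {A L₁ L₂ : ℕ} {e₁ e₂ : NatExp} {E : RealExp} {σ : Mem}
    (f : Fin L₁ → Fin L₂ → ℝ)
    (he₁ : ∀ σ', Same A σ σ' → e₁.eval σ' = L₁) (he₂ : ∀ σ', Same A σ σ' → e₂.eval σ' = L₂)
    (hE : ∀ (i : Fin L₁) (j : Fin L₂) σ', Same A σ σ' → σ'.nat 5 0 = i → σ'.nat 6 0 = j →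
      σ'.real A (i * L₂ + j) = σ.real A (i * L₂ + j) → E.eval σ' = f i j) :
    Runs sep (gridMap A e₁ e₂ E) σ (6 * (L₁ + 1) * (L₂ + 1)) fun σ' =>
      Same A σ σ' ∧ ∀ (i : Fin L₁) (j : Fin L₂), σ'.real A (i * L₂ + j) = f i j := by
  let Inv : ℕ → Mem → Prop := fun c σ' => Same A σ σ' ∧
    (∀ (i : Fin L₁) (j : Fin L₂), (i * L₂ + j : ℕ) < c → σ'.real A (i * L₂ + j) = f i j) ∧
    ∀ j, c ≤ j → σ'.real A j = σ.real A j
  refine (Runs.forLoop (sep := sep) (L := L₁) (B := 3 * L₂ + 2) (Inv := fun i => Inv (i * L₂)) ?_ ?_ ?_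
    ⟨Same.refl A σ, by simp, by simp⟩).mono (by nlinarith [Nat.zero_le (L₁ * L₂)])
    (fun σ' h => ⟨h.1, fun i j => h.2.1 i j ?_⟩)
  · rintro k σ' v ⟨h1, h2, h3⟩
    exact ⟨h1.setNat (.inl rfl) _ _, h2, h3⟩
  · rintro k σ' ⟨h1, -, -⟩
    exact he₁ σ' h1
  · rintro i hi σ₁ hσ₁ hc
    refine (Runs.forLoop (sep := sep) (L := L₂) (B := 1)
      (Inv := fun j σ' => Inv (i * L₂ + j) σ' ∧ σ'.nat 5 0 = i) ?_ ?_ ?_ ⟨by simpa using hσ₁, hc⟩).mono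
      (by omega) fun σ' h => ⟨h.2, by simpa [Nat.add_mul] using h.1⟩
    · rintro k σ' v ⟨⟨h1, h2, h3⟩, h4⟩
      exact ⟨⟨h1.setNat (.inr rfl) _ _, h2, h3⟩, by simpa using h4⟩
    · rintro k σ' ⟨⟨h1, -, -⟩, -⟩
      exact he₂ σ' h1
    · rintro j hj σ₃ ⟨⟨h1, h2, h3⟩, h4⟩ hc6
      have hv := hE ⟨i, hi⟩ ⟨j, hj⟩ σ₃ h1 h4 hc6 (h3 _ le_rfl)
      have hL := he₂ σ₃ h1
      apply Runs.setReal
      refine ⟨by simpa using hc6, ⟨h1.setReal (.inl rfl) _ _, ?_, ?_⟩, by simpa using h4⟩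
      · intro i' j' hlt
        simp only [NatExp.eval, h4, hc6, hL, hv, Mem.setReal_real, if_true]
        split_ifs with he
        · have hpos : 0 < L₂ := by omega
          have hdiv : ∀ a b : ℕ, b < L₂ → (a * L₂ + b) / L₂ = a := fun a b hb => by
            rw [Nat.mul_comm, Nat.mul_add_div hpos, Nat.div_eq_of_lt hb, add_zero]
          have e1 : i = i' := by
            rw [← hdiv i j hj, ← he, hdiv _ _ j'.2]
          have e2 : (j' : ℕ) = j := by rw [e1] at he; omega
          congr 1
          · exact Fin.ext e1
          · exact Fin.ext e2.symm
        · exact h2 i' j' (by omega)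
      · intro c hc
        simp only [NatExp.eval, h4, hc6, hL, Mem.setReal_real, if_true]
        rw [if_neg (by omega)]
        exact h3 c (by omega)
  · calc (i * L₂ + j : ℕ) < i * L₂ + L₂ := by omega
      _ = (i + 1) * L₂ := by ring
      _ ≤ L₁ * L₂ := Nat.mul_le_mul_right _ i.2

end Keychain
end

noncomputable section

namespace Keychain

/-! ### Ellipsoids and central cuts -/

variable {N d : ℕ}

/-- The image of the unit ball under `u ↦ c + ∑ i, u i • B i`. -/
def ellipsoid (c : Fin N → ℝ) (B : Fin d → Fin N → ℝ) : Set (Fin N → ℝ) :=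
  {x | ∃ u : Fin d → ℝ, ∑ i, u i ^ 2 ≤ 1 ∧ ∀ s, x s = c s + ∑ i, u i * B i s}

/-- The volume-optimal shift would be 1/(d+1), but for d = 1 it makes 1 - 2 · shift, the radicand in
`cutGrow`, vanish. The slightly smaller shift treats all d > 0 alike and still shrinks the volume
enough. -/
def cutShift (d : ℕ) : ℝ := 1 / (d + 2)

/-- The factor by which the ellipsoid shrinks in the direction of the cut. -/
def cutShrink (d : ℕ) : ℝ := 1 - cutShift d

/-- The factor by which the ellipsoid grows orthogonally to the cut. -/
def cutGrow (d : ℕ) : ℝ := cutShrink d / √(1 - 2 * cutShift d)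

/-- The functional w in ellipsoid coordinates: at c + ∑ u i • B i it exceeds its value at c by the
pairing of u with this vector. -/
def cutDir (B : Fin d → Fin N → ℝ) (w : Fin N → ℝ) (i : Fin d) : ℝ := ∑ s, B i s * w s

def cutNorm (B : Fin d → Fin N → ℝ) (w : Fin N → ℝ) : ℝ := √(∑ i, cutDir B w i ^ 2)

def cutAxis (B : Fin d → Fin N → ℝ) (w : Fin N → ℝ) (s : Fin N) : ℝ :=
  (∑ i, cutDir B w i * B i s) / cutNorm B w

def cutCenter (c : Fin N → ℝ) (B : Fin d → Fin N → ℝ) (w : Fin N → ℝ) (s : Fin N) : ℝ :=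
  c s - cutShift d * cutAxis B w s

def cutBasis (B : Fin d → Fin N → ℝ) (w : Fin N → ℝ) (i : Fin d) (s : Fin N) : ℝ :=
  cutGrow d * B i s +
    (cutShrink d - cutGrow d) * (cutDir B w i / cutNorm B w) * cutAxis B w s

lemma cutShift_pos (d : ℕ) : 0 < cutShift d := by unfold cutShift; positivity

lemma two_cutShift_lt {d : ℕ} (hd : 0 < d) : 2 * cutShift d < 1 := by
  have : (0 : ℝ) < d := by exact_mod_cast hd
  unfold cutShift
  rw [mul_one_div, div_lt_one (by positivity)]
  linarith

lemma cutShrink_pos (d : ℕ) : 0 < cutShrink d := by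
  unfold cutShrink cutShift
  rw [sub_pos, div_lt_one (by positivity)]
  have : (0 : ℝ) ≤ d := by positivity
  linarith

lemma cutGrow_pos {d : ℕ} (hd : 0 < d) : 0 < cutGrow d :=
  div_pos (cutShrink_pos d) (Real.sqrt_pos.2 (by linarith [two_cutShift_lt hd]))

lemma cutGrow_sq {d : ℕ} (hd : 0 < d) :
    cutGrow d ^ 2 * (1 - 2 * cutShift d) = cutShrink d ^ 2 := by
  have h := two_cutShift_lt hd
  rw [cutGrow, div_pow, Real.sq_sqrt (by linarith), div_mul_cancel₀ _ (by linarith)]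

lemma sum_sq_div_cutNorm {B : Fin d → Fin N → ℝ} {w : Fin N → ℝ} (h : 0 < cutNorm B w) :
    ∑ i, (cutDir B w i / cutNorm B w) ^ 2 = 1 := by
  simp only [div_pow, ← Finset.sum_div]
  rw [div_eq_one_iff_eq (by positivity), cutNorm, Real.sq_sqrt (by positivity)]

/-- In coordinates the claim concerns the half ball t = ⟨u, v⟩ ≤ 0 with v the unit normal. By the
relation `cutGrow_sq`, a boundary point of the ball gets new squared norm 1 + 2σt(1+t)/β², which is
at most 1 for -1 ≤ t ≤ 0. No independence of the spanning vectors is required. -/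
lemma mem_ellipsoid_cut {c x w : Fin N → ℝ} {B : Fin d → Fin N → ℝ} (h : 0 < cutNorm B w)
    (hx : x ∈ ellipsoid c B) (hw : ∑ s, w s * x s ≤ ∑ s, w s * c s) :
    x ∈ ellipsoid (cutCenter c B w) (cutBasis B w) := by
  obtain ⟨u, hu, hx⟩ := hx
  have hd : 0 < d := by
    rcases Nat.eq_zero_or_pos d with rfl | h0
    · simp [cutNorm] at h
    · exact h0
  set v : Fin d → ℝ := fun i => cutDir B w i / cutNorm B w with hv
  have hv1 : ∑ i, v i ^ 2 = 1 := sum_sq_div_cutNorm h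
  set t := ∑ i, u i * v i with ht
  have hax : ∀ s, cutAxis B w s = ∑ i, v i * B i s := by
    intro s
    simp only [cutAxis, hv, Finset.sum_div]
    exact Finset.sum_congr rfl fun i _ => by ring
  have ht0 : t ≤ 0 := by
    have e : ∑ s, w s * x s = ∑ s, w s * c s + ∑ i, u i * cutDir B w i := by
      simp only [hx, mul_add, Finset.sum_add_distrib, cutDir, Finset.mul_sum]
      rw [Finset.sum_comm]
      congr 1
      exact Finset.sum_congr rfl fun i _ => Finset.sum_congr rfl fun s _ => by ring
    have e2 : t = (∑ i, u i * cutDir B w i) / cutNorm B w := by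
      rw [ht, Finset.sum_div]; exact Finset.sum_congr rfl fun i _ => by simp only [hv]; ring
    rw [e2]
    exact div_nonpos_of_nonpos_of_nonneg (by linarith) h.le
  have ht1 : -1 ≤ t := by
    have := Finset.sum_nonneg fun i (_ : i ∈ Finset.univ) => sq_nonneg (u i + v i)
    have e : ∑ i, (u i + v i) ^ 2 = ∑ i, u i ^ 2 + 2 * t + ∑ i, v i ^ 2 := by
      rw [ht, Finset.mul_sum, ← Finset.sum_add_distrib, ← Finset.sum_add_distrib]
      exact Finset.sum_congr rfl fun i _ => by ring
    linarith
  have ha := cutGrow_pos hd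
  have hb := cutShrink_pos d
  set α := cutGrow d
  set β := cutShrink d with hβ
  set σ := cutShift d with hσ
  have hαβ : α ^ 2 * (1 - 2 * σ) = β ^ 2 := cutGrow_sq hd
  have hβσ : β = 1 - σ := rfl
  -- The component of u orthogonal to v is rescaled by 1/α, and the one along v is moved by the
  -- shift σ and rescaled by 1/β.
  refine ⟨fun i => (u i - t * v i) / α + (t + σ) / β * v i, ?_, ?_⟩
  · have e : ∑ i, ((u i - t * v i) / α + (t + σ) / β * v i) ^ 2 =
        (∑ i, u i ^ 2 - t ^ 2) / α ^ 2 + ((t + σ) / β) ^ 2 := by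
      have e1 : ∀ i, ((u i - t * v i) / α + (t + σ) / β * v i) ^ 2 =
          u i ^ 2 * (1 / α ^ 2) + u i * v i * (2 * ((t + σ) / β) / α - 2 * t / α ^ 2) +
            v i ^ 2 * (t ^ 2 / α ^ 2 - 2 * t * ((t + σ) / β) / α + ((t + σ) / β) ^ 2) := by
        intro i; field_simp; ring
      simp only [e1, Finset.sum_add_distrib, ← Finset.sum_mul, hv1, ← ht]
      field_simp; ring
    rw [e]
    have h1 : (∑ i, u i ^ 2 - t ^ 2) / α ^ 2 ≤ (1 - t ^ 2) / α ^ 2 := by gcongr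
    have h2 : (1 - t ^ 2) / α ^ 2 = (1 - t ^ 2) * (1 - 2 * σ) / β ^ 2 := by
      rw [← hαβ]
      have : 1 - 2 * σ ≠ 0 := by linarith [two_cutShift_lt hd]
      field_simp
    have h3 : (1 - t ^ 2) * (1 - 2 * σ) / β ^ 2 + ((t + σ) / β) ^ 2 ≤ 1 := by
      rw [div_pow, ← add_div, div_le_one (by positivity), hβσ]
      have : 0 ≤ σ * (-t) * (t + 1) :=
        mul_nonneg (mul_nonneg (cutShift_pos d).le (by linarith)) (by linarith)
      nlinarith
    linarith
  · intro s
    rw [hx s]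
    simp only [cutCenter, cutBasis]
    change c s + _ = c s - σ * cutAxis B w s +
      ∑ i, ((u i - t * v i) / α + (t + σ) / β * v i) *
        (α * B i s + (β - α) * v i * cutAxis B w s)
    have e1 : ∀ i, ((u i - t * v i) / α + (t + σ) / β * v i) *
        (α * B i s + (β - α) * v i * cutAxis B w s) =
        u i * B i s + v i * B i s * (α * ((t + σ) / β) - t) +
        u i * v i * ((β - α) / α * cutAxis B w s) +
        v i ^ 2 * ((β - α) * cutAxis B w s * ((t + σ) / β - t / α)) := by
      intro i; field_simp; ring
    simp only [e1, Finset.sum_add_distrib, ← Finset.sum_mul, hv1, ← ht, ← hax]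
    field_simp
    ring

/-- The matrix by which a cut changes the spanning vectors of the ellipsoid. -/
def cutMatrix (B : Fin d → Fin N → ℝ) (w : Fin N → ℝ) : Matrix (Fin d) (Fin d) ℝ :=
  cutGrow d • (1 : Matrix (Fin d) (Fin d) ℝ) + (cutShrink d - cutGrow d) •
    Matrix.vecMulVec (fun i => cutDir B w i / cutNorm B w) (fun i => cutDir B w i / cutNorm B w)

lemma cutBasis_eq (B : Fin d → Fin N → ℝ) (w : Fin N → ℝ) (i : Fin d) (s : Fin N) :
    cutBasis B w i s = ∑ j, cutMatrix B w i j * B j s := by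
  simp only [cutBasis, cutMatrix, cutAxis, Matrix.add_apply, Matrix.smul_apply, smul_eq_mul,
    Matrix.one_apply, Matrix.vecMulVec_apply, add_mul, Finset.sum_add_distrib, Finset.mul_sum,
    Finset.sum_div]
  congr 1
  · simp
  · exact Finset.sum_congr rfl fun j _ => by ring

/-- A rank-one update of a scalar matrix: `cutShrink` along v, `cutGrow` on the complement. -/
lemma det_cutMatrix {B : Fin d → Fin N → ℝ} {w : Fin N → ℝ} (h : 0 < cutNorm B w) :
    (cutMatrix B w).det = cutGrow d ^ d * (cutShrink d / cutGrow d) := by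
  have hd : 0 < d := by
    rcases Nat.eq_zero_or_pos d with rfl | h0
    · simp [cutNorm] at h
    · exact h0
  have ha := cutGrow_pos hd
  set v : Fin d → ℝ := fun i => cutDir B w i / cutNorm B w with hv
  have hv1 : ∑ i, v i ^ 2 = 1 := sum_sq_div_cutNorm h
  have e : cutMatrix B w = cutGrow d • (1 + Matrix.replicateCol Unit
      (((cutShrink d - cutGrow d) / cutGrow d) • v) * Matrix.replicateRow Unit v) := by
    ext i j
    simp only [cutMatrix, Matrix.add_apply, Matrix.smul_apply, smul_eq_mul, Matrix.vecMulVec_apply,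
      Matrix.mul_apply, Matrix.replicateCol_apply, Matrix.replicateRow_apply, Pi.smul_apply,
      Finset.univ_unique, Finset.sum_singleton]
    rw [mul_add]
    congr 1
    have hn := h.ne'
    simp only [hv]
    field_simp
  rw [e, Matrix.det_smul, Matrix.det_one_add_replicateCol_mul_replicateRow, Fintype.card_fin]
  congr 1
  have : v ⬝ᵥ (((cutShrink d - cutGrow d) / cutGrow d) • v) =
      (cutShrink d - cutGrow d) / cutGrow d := by
    rw [dotProduct_smul, smul_eq_mul]
    have : v ⬝ᵥ v = 1 := by rw [← hv1]; exact Finset.sum_congr rfl fun i _ => by ring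
    rw [this, mul_one]
  rw [this]
  field_simp
  ring

/-- Squaring removes the root in `cutGrow`. With d = e + 1, its square is 1 + 1/((e+1)(e+3)), so the
e orthogonal directions contribute at most exp(1/(e+3)), against exp(-2/(e+3)) from the cut
direction. -/
lemma det_cutMatrix_le {B : Fin d → Fin N → ℝ} {w : Fin N → ℝ} (h : 0 < cutNorm B w) :
    |(cutMatrix B w).det| ≤ Real.exp (-(1 / (2 * (d + 2)))) := by
  rw [det_cutMatrix h]
  obtain ⟨e, rfl⟩ : ∃ e, d = e + 1 := by
    rcases d with _ | e
    · simp [cutNorm] at h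
    · exact ⟨e, rfl⟩
  have ha := cutGrow_pos (Nat.succ_pos e)
  have hb := cutShrink_pos (e + 1)
  have hs := two_cutShift_lt (Nat.succ_pos e)
  have he0 : (0 : ℝ) ≤ e := by positivity
  have e1 : cutGrow (e + 1) ^ (e + 1) * (cutShrink (e + 1) / cutGrow (e + 1)) =
      cutGrow (e + 1) ^ e * cutShrink (e + 1) := by
    rw [pow_succ]; field_simp
  rw [e1]
  apply abs_le_of_sq_le_sq _ (Real.exp_pos _).le
  have hβ : cutShrink (e + 1) ^ 2 ≤ Real.exp (-(2 / ((e : ℝ) + 3))) := by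
    have h1 : cutShrink (e + 1) ≤ Real.exp (-(1 / ((e : ℝ) + 3))) := by
      have := Real.add_one_le_exp (-(1 / ((e : ℝ) + 3)))
      refine le_trans (le_of_eq ?_) this
      unfold cutShrink cutShift
      push_cast
      ring
    calc _ ≤ Real.exp (-(1 / ((e : ℝ) + 3))) ^ 2 := by gcongr
      _ = _ := by rw [← Real.exp_nat_mul]; congr 1; push_cast; ring
  have hα : cutGrow (e + 1) ^ 2 ≤ Real.exp (1 / (((e : ℝ) + 1) * (e + 3))) := by
    have h1 : cutGrow (e + 1) ^ 2 = 1 / (((e : ℝ) + 1) * (e + 3)) + 1 := by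
      have := cutGrow_sq (Nat.succ_pos e)
      have e2 : cutShift (e + 1) = 1 / ((e : ℝ) + 3) := by unfold cutShift; push_cast; ring
      rw [cutShrink] at this
      rw [e2] at this hs
      have hne : 1 - 2 * (1 / ((e : ℝ) + 3)) ≠ 0 := by linarith
      rw [← eq_div_iff hne] at this
      rw [this]
      have e3 : 1 - 2 * (1 / ((e : ℝ) + 3)) = (e + 1) / (e + 3) := by field_simp; ring
      rw [e3]
      field_simp
      ring
    rw [h1]
    exact Real.add_one_le_exp _
  calc (cutGrow (e + 1) ^ e * cutShrink (e + 1)) ^ 2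
      = (cutGrow (e + 1) ^ 2) ^ e * cutShrink (e + 1) ^ 2 := by ring
    _ ≤ Real.exp (1 / (((e : ℝ) + 1) * (e + 3))) ^ e * Real.exp (-(2 / ((e : ℝ) + 3))) := by gcongr
    _ = Real.exp (e * (1 / (((e : ℝ) + 1) * (e + 3))) - 2 / ((e : ℝ) + 3)) := by
        rw [← Real.exp_nat_mul, ← Real.exp_add]; congr 1
    _ ≤ Real.exp (-(1 / ((e : ℝ) + 3))) := by
        apply Real.exp_le_exp.2
        have : (e : ℝ) * (1 / (((e : ℝ) + 1) * (e + 3))) ≤ 1 / (e + 3) := by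
          rw [mul_one_div, div_le_div_iff₀ (by positivity) (by positivity)]
          nlinarith
        have e2 : 2 / ((e : ℝ) + 3) = 1 / (e + 3) + 1 / (e + 3) := by ring
        linarith
    _ = Real.exp (-(1 / (2 * (((e + 1 : ℕ) : ℝ) + 2)))) ^ 2 := by
        rw [← Real.exp_nat_mul]; congr 1; push_cast; field_simp; ring

/-! ### Volume -/

-- Lebesgue measure of both sides of an inclusion between a scaled unit ball and a linear image of
-- the unit ball; the volume of the unit ball is positive and finite, so it cancels.
open scoped Pointwise in
lemma pow_le_abs_det {M : Matrix (Fin d) (Fin d) ℝ} {ρ : ℝ} (hρ : 0 ≤ ρ)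
    (h : ∀ y : Fin d → ℝ, ∑ i, y i ^ 2 ≤ ρ ^ 2 →
      ∃ u : Fin d → ℝ, ∑ i, u i ^ 2 ≤ 1 ∧ ∀ j, y j = ∑ i, M i j * u i) :
    ρ ^ d ≤ |M.det| := by
  let S : Set (Fin d → ℝ) := {y | ∑ i, y i ^ 2 ≤ 1}
  have hsub : ρ • S ⊆ Matrix.toLin' M.transpose '' S := by
    rintro _ ⟨y, hy, rfl⟩
    obtain ⟨u, hu, hyu⟩ := h (ρ • y) (by
      simp only [Pi.smul_apply, smul_eq_mul, mul_pow, ← Finset.mul_sum]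
      have hy : ∑ i, y i ^ 2 ≤ 1 := hy
      nlinarith [sq_nonneg ρ])
    refine ⟨u, hu, ?_⟩
    ext j
    simp only [Matrix.toLin'_apply, Matrix.mulVec, dotProduct, Matrix.transpose_apply]
    exact (hyu j).symm
  have hle := MeasureTheory.measure_mono (μ := MeasureTheory.volume) hsub
  rw [MeasureTheory.Measure.addHaar_smul, MeasureTheory.Measure.addHaar_image_linearMap,
    LinearMap.det_toLin', Matrix.det_transpose, Module.finrank_fin_fun] at hle
  have hfin : MeasureTheory.volume S ≠ ⊤ := by
    refine ((MeasureTheory.measure_mono (t := Set.Icc (fun _ => -1) fun _ => 1) ?_).trans_lt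
      isCompact_Icc.measure_lt_top).ne
    intro y hy
    have h1 : ∀ i, |y i| ≤ 1 := by
      intro i
      rw [← sq_le_one_iff_abs_le_one]
      exact (Finset.single_le_sum (f := fun i => y i ^ 2) (fun i _ => sq_nonneg _)
        (Finset.mem_univ i)).trans hy
    exact ⟨fun i => (abs_le.1 (h1 i)).1, fun i => (abs_le.1 (h1 i)).2⟩
  have hpos : MeasureTheory.volume S ≠ 0 := by
    have ho : IsOpen {y : Fin d → ℝ | ∑ i, y i ^ 2 < 1} :=
      isOpen_lt (by fun_prop) continuous_const
    refine ((ho.measure_pos MeasureTheory.volume ⟨0, by simp⟩).trans_le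
      (MeasureTheory.measure_mono fun y hy => ?_)).ne'
    have hy : ∑ i, y i ^ 2 < 1 := hy
    exact hy.le
  have h2 := (ENNReal.mul_le_mul_iff_left hpos hfin).1 hle
  rw [abs_of_nonneg (by positivity)] at h2
  exact (ENNReal.ofReal_le_ofReal_iff (abs_nonneg _)).1 h2

/-- The centres x and c need not agree. Half the difference of the representations of y and -y
eliminates both, and pairing with the orthonormal b turns the vector identity into one between
coordinates. Thus volume in the affine hull is measured by a d × d determinant. -/
lemma pow_le_abs_det_of_ball {c x : Fin N → ℝ} {B b : Fin d → Fin N → ℝ}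
    {M : Matrix (Fin d) (Fin d) ℝ} {ρ : ℝ} (hρ : 0 ≤ ρ)
    (hb : ∀ i j, b i ⬝ᵥ b j = if i = j then 1 else 0)
    (hM : ∀ i s, B i s = ∑ j, M i j * b j s)
    (h : ∀ y : Fin d → ℝ, ∑ i, y i ^ 2 ≤ ρ ^ 2 →
      (fun s => x s + ∑ i, y i * b i s) ∈ ellipsoid c B) : ρ ^ d ≤ |M.det| := by
  apply pow_le_abs_det hρ
  intro y hy
  obtain ⟨u, hu, hxu⟩ := h y hy
  obtain ⟨u', hu', hxu'⟩ := h (-y) (by simpa using hy)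
  refine ⟨fun i => (u i - u' i) / 2, ?_, ?_⟩
  · have : ∀ i, ((u i - u' i) / 2) ^ 2 ≤ (u i ^ 2 + u' i ^ 2) / 2 := fun i => by
      nlinarith [sq_nonneg (u i + u' i)]
    refine (Finset.sum_le_sum fun i _ => this i).trans ?_
    rw [← Finset.sum_div, Finset.sum_add_distrib]
    linarith
  · have key : ∀ s, ∑ i, y i * b i s = ∑ j, (∑ i, M i j * ((u i - u' i) / 2)) * b j s := by
      intro s
      have h1 := hxu s
      have h2 := hxu' s
      simp only [Pi.neg_apply, neg_mul, Finset.sum_neg_distrib] at h2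
      have h3 : ∑ i, y i * b i s = ∑ i, (u i - u' i) / 2 * B i s := by
        have : ∑ i, (u i - u' i) / 2 * B i s = (∑ i, u i * B i s - ∑ i, u' i * B i s) / 2 := by
          rw [← Finset.sum_sub_distrib, Finset.sum_div]
          exact Finset.sum_congr rfl fun i _ => by ring
        rw [this]
        linarith
      rw [h3]
      simp only [hM, Finset.mul_sum, Finset.sum_mul]
      rw [Finset.sum_comm]
      exact Finset.sum_congr rfl fun i _ => Finset.sum_congr rfl fun j _ => by ring
    have proj : ∀ (z : Fin d → ℝ) (j : Fin d), ∑ s, (∑ i, z i * b i s) * b j s = z j := by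
      intro z j
      simp only [Finset.sum_mul]
      rw [Finset.sum_comm]
      have : ∀ i, ∑ s, z i * b i s * b j s = if i = j then z i else 0 := by
        intro i
        have := hb i j
        simp only [dotProduct] at this
        simp only [mul_assoc, ← Finset.mul_sum, this]
        split_ifs <;> simp
      simp [this]
    intro j
    rw [← proj y j, ← proj (fun j => ∑ i, M i j * ((u i - u' i) / 2)) j]
    exact Finset.sum_congr rfl fun s _ => by rw [key s]

end Keychain
end

noncomputable section

namespace Keychain

/-! ### The smoothed objective -/

variable {N d : ℕ}

/-- Linear loss plus `κ` times the negative entropy shifted by `θ`. -/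
def smoothObj (κ θ : ℝ) (G p : Fin N → ℝ) : ℝ :=
  ∑ s, (G s * p s + κ * ((p s + θ) * Real.log (p s + θ)))

/-- For θ > 0 this is finite on the whole simplex, whereas the gradient of the entropy blows up at
its boundary. -/
def smoothGrad (κ θ : ℝ) (G p : Fin N → ℝ) (s : Fin N) : ℝ :=
  G s + κ * (Real.log (p s + θ) + 1)

lemma mul_log_tangent {x y : ℝ} (hx : 0 < x) (hy : 0 ≤ y) :
    x * Real.log x + (Real.log x + 1) * (y - x) ≤ y * Real.log y := by
  rcases hy.eq_or_lt with rfl | hy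
  · simp; linarith
  · have h := Real.log_le_sub_one_of_pos (div_pos hx hy)
    rw [Real.log_div hx.ne' hy.ne'] at h
    have h2 := mul_le_mul_of_nonneg_left h hy.le
    rw [mul_sub, mul_sub, mul_div_cancel₀ _ hy.ne', mul_one] at h2
    linarith

lemma smoothObj_tangent {κ θ : ℝ} (hκ : 0 ≤ κ) (hθ : 0 < θ) (G : Fin N → ℝ) {c x : Fin N → ℝ}
    (hc : ∀ s, 0 ≤ c s) (hx : ∀ s, 0 ≤ x s) :
    smoothObj κ θ G c + (∑ s, smoothGrad κ θ G c s * x s - ∑ s, smoothGrad κ θ G c s * c s) ≤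
      smoothObj κ θ G x := by
  unfold smoothObj smoothGrad
  rw [← Finset.sum_sub_distrib, ← Finset.sum_add_distrib]
  apply Finset.sum_le_sum
  intro s _
  have h := mul_le_mul_of_nonneg_left
    (mul_log_tangent (x := c s + θ) (y := x s + θ) (by linarith [hc s]) (by linarith [hx s])) hκ
  linarith

lemma smoothObj_convex {κ θ : ℝ} (hκ : 0 ≤ κ) (hθ : 0 < θ) (G : Fin N → ℝ) {x y : Fin N → ℝ}
    (hx : ∀ s, 0 ≤ x s) (hy : ∀ s, 0 ≤ y s) {l : ℝ} (h0 : 0 ≤ l) (h1 : l ≤ 1) :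
    smoothObj κ θ G (fun s => (1 - l) * x s + l * y s) ≤
      (1 - l) * smoothObj κ θ G x + l * smoothObj κ θ G y := by
  unfold smoothObj
  rw [Finset.mul_sum, Finset.mul_sum, ← Finset.sum_add_distrib]
  apply Finset.sum_le_sum
  intro s _
  have h := Real.convexOn_mul_log.2
    (Set.mem_Ici.2 (show 0 ≤ x s + θ by linarith [hx s]))
    (Set.mem_Ici.2 (show 0 ≤ y s + θ by linarith [hy s]))
    (show 0 ≤ 1 - l by linarith) h0 (by ring)
  simp only [smul_eq_mul] at h
  have e : (1 - l) * (x s + θ) + l * (y s + θ) = (1 - l) * x s + l * y s + θ := by ring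
  rw [e] at h
  have h := mul_le_mul_of_nonneg_left h hκ
  beta_reduce
  linarith

lemma continuous_smoothObj (κ θ : ℝ) (G : Fin N → ℝ) : Continuous (smoothObj κ θ G) := by
  unfold smoothObj
  refine continuous_finsetSum _ fun s _ => ?_
  have h : Continuous fun p : Fin N → ℝ => (p s + θ) * Real.log (p s + θ) :=
    Real.continuous_mul_log.comp (by fun_prop : Continuous fun p : Fin N → ℝ => p s + θ)
  fun_prop

lemma le_one_of_mem_stdSimplex {p : Fin N → ℝ} (hp : p ∈ stdSimplex ℝ (Fin N)) (s : Fin N) :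
    p s ≤ 1 := by
  rw [← hp.2]; exact Finset.single_le_sum (fun i _ => hp.1 i) (Finset.mem_univ s)

lemma smoothObj_le {κ θ g : ℝ} (hκ : 0 ≤ κ) (hθ : 0 < θ) (hθ1 : θ ≤ 1) {G p : Fin N → ℝ}
    (hG : ∀ s, G s ≤ g) (hp : p ∈ stdSimplex ℝ (Fin N)) :
    smoothObj κ θ G p ≤ g + 2 * κ * N := by
  have h : ∀ s, G s * p s + κ * ((p s + θ) * Real.log (p s + θ)) ≤ g * p s + 2 * κ := by
    intro s
    have h0 := hp.1 s
    have h1 := le_one_of_mem_stdSimplex hp s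
    have h2 : (p s + θ) * Real.log (p s + θ) ≤ 2 := by
      have := Real.log_le_sub_one_of_pos (x := p s + θ) (by linarith)
      have h3 : Real.log (p s + θ) ≤ 1 := by linarith
      calc _ ≤ (p s + θ) * 1 := by gcongr
        _ ≤ 2 := by linarith
    have h3 := mul_le_mul_of_nonneg_left h2 hκ
    have h4 := mul_le_mul_of_nonneg_right (hG s) h0
    linarith
  refine (Finset.sum_le_sum fun s _ => h s).trans (le_of_eq ?_)
  rw [Finset.sum_add_distrib, ← Finset.mul_sum, hp.2]
  simp
  ring

lemma smoothObj_ge {κ θ : ℝ} (hκ : 0 ≤ κ) (hθ : 0 < θ) {G p : Fin N → ℝ}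
    (hG : ∀ s, 0 ≤ G s) (hp : p ∈ stdSimplex ℝ (Fin N)) : -(κ * N) ≤ smoothObj κ θ G p := by
  have h : ∀ s, -κ ≤ G s * p s + κ * ((p s + θ) * Real.log (p s + θ)) := by
    intro s
    have h0 := hp.1 s
    have h2 : -1 ≤ (p s + θ) * Real.log (p s + θ) := by
      have hx : 0 < p s + θ := by linarith
      have := mul_le_mul_of_nonneg_left (Real.one_sub_inv_le_log_of_pos hx) hx.le
      rw [mul_sub, mul_inv_cancel₀ hx.ne'] at this
      linarith
    have h3 := mul_le_mul_of_nonneg_left h2 hκ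
    have h4 := mul_nonneg (hG s) h0
    linarith
  have := Finset.sum_le_sum fun s (_ : s ∈ Finset.univ) => h s
  simp at this
  unfold smoothObj
  linarith

/-- Writing the shift as τ² makes the error linear in τ: τ² ln τ² = 2τ² ln τ ≥ 2(τ² - τ), by 1 - 1/τ
≤ ln τ. -/
lemma abs_mul_log_shift_le {x τ : ℝ} (hx : 0 ≤ x) (hx1 : x ≤ 1) (hτ : 0 < τ) (hτ1 : τ ≤ 1) :
    |(x + τ ^ 2) * Real.log (x + τ ^ 2) - x * Real.log x| ≤ 2 * τ := by
  have hθ : 0 < τ ^ 2 := by positivity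
  have hy : 0 < x + τ ^ 2 := by linarith
  have hττ : τ ^ 2 ≤ τ := by nlinarith
  rw [abs_le]
  constructor
  · have h1 : x * Real.log x ≤ x * Real.log (x + τ ^ 2) := by
      rcases hx.eq_or_lt with rfl | h
      · simp
      · gcongr; linarith
    have h2 : τ ^ 2 * Real.log (τ ^ 2) ≤ τ ^ 2 * Real.log (x + τ ^ 2) := by gcongr; linarith
    have h3 : -(2 * τ) ≤ τ ^ 2 * Real.log (τ ^ 2) := by
      have := mul_le_mul_of_nonneg_left (Real.one_sub_inv_le_log_of_pos hτ) hθ.le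
      have e : τ ^ 2 * (1 - τ⁻¹) = τ ^ 2 - τ := by field_simp
      rw [Real.log_pow]
      push_cast
      linarith
    linarith
  · have h1 : x * Real.log (x + τ ^ 2) - x * Real.log x ≤ τ ^ 2 := by
      rcases hx.eq_or_lt with rfl | h
      · simp; positivity
      · have := Real.log_le_sub_one_of_pos (div_pos hy h)
        rw [Real.log_div hy.ne' h.ne'] at this
        have := mul_le_mul_of_nonneg_left this h.le
        rw [mul_sub, mul_sub, mul_div_cancel₀ _ h.ne'] at this
        linarith
    have h2 : τ ^ 2 * Real.log (x + τ ^ 2) ≤ τ ^ 2 * 1 := by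
      gcongr
      have := Real.log_le_sub_one_of_pos hy
      linarith
    linarith

lemma abs_smoothObj_sub_le {κ τ : ℝ} (hκ : 0 ≤ κ) (hτ : 0 < τ) (hτ1 : τ ≤ 1) (G : Fin N → ℝ)
    {p : Fin N → ℝ} (hp : p ∈ stdSimplex ℝ (Fin N)) :
    |smoothObj κ (τ ^ 2) G p - (∑ s, G s * p s + κ * negEntropy p)| ≤ 2 * κ * N * τ := by
  have e : smoothObj κ (τ ^ 2) G p - (∑ s, G s * p s + κ * negEntropy p) =
      ∑ s, κ * ((p s + τ ^ 2) * Real.log (p s + τ ^ 2) - p s * Real.log (p s)) := by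
    simp only [smoothObj, negEntropy, mul_sub, Finset.sum_add_distrib, Finset.sum_sub_distrib,
      Finset.mul_sum]
    ring
  rw [e]
  refine (Finset.abs_sum_le_sum_abs _ _).trans ?_
  refine (Finset.sum_le_sum (g := fun _ => κ * (2 * τ)) fun s _ => ?_).trans (le_of_eq ?_)
  · rw [abs_mul, abs_of_nonneg hκ]
    gcongr
    exact abs_mul_log_shift_le (hp.1 s) (le_one_of_mem_stdSimplex hp s) hτ hτ1
  · simp; ring

/-! ### The cutting plane method -/

/-- The state after `k` cuts: center `c`, spanning vectors `B`, best value `v` and best point `p`.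
The set `S` consists of points of value at most `V`, and `b` spans the initial ellipsoid. -/
structure CutState (K S : Set (Fin N → ℝ)) (F : (Fin N → ℝ) → ℝ) (V : ℝ)
    (b : Fin d → Fin N → ℝ) (k : ℕ) (c : Fin N → ℝ) (B : Fin d → Fin N → ℝ) (v : ℝ)
    (p : Fin N → ℝ) : Prop where
  best : (p ∈ K ∧ v = F p) ∨ V < v
  encl : v ≤ V ∨ (S ⊆ ellipsoid c B ∧ ∃ M : Matrix (Fin d) (Fin d) ℝ,
    (∀ i s, B i s = ∑ j, M i j * b j s) ∧ |M.det| ≤ Real.exp (-(1 / (2 * (d + 2)))) ^ k)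

/-- How one query determines the cut `w` and updates the best point. -/
def IsCutQuery (K : Set (Fin N → ℝ)) (F : (Fin N → ℝ) → ℝ) (grad : (Fin N → ℝ) → Fin N → ℝ)
    (c w : Fin N → ℝ) (v v' : ℝ) (p p' : Fin N → ℝ) : Prop :=
  (c ∉ K ∧ (∀ x ∈ K, w ⬝ᵥ x < w ⬝ᵥ c) ∧ v' = v ∧ p' = p) ∨
  (c ∈ K ∧ w = grad c ∧ ((F c < v ∧ v' = F c ∧ p' = c) ∨ (v ≤ F c ∧ v' = v ∧ p' = p)))

/-- As long as the best value exceeds V, the centre is outside `K` or has value above V. In both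
cases the cut keeps all of S, so the enclosure survives and its determinant shrinks. -/
theorem CutState.step {K S : Set (Fin N → ℝ)} {F : (Fin N → ℝ) → ℝ}
    {grad : (Fin N → ℝ) → Fin N → ℝ} {V : ℝ} {b : Fin d → Fin N → ℝ} {k : ℕ}
    {c w p p' : Fin N → ℝ} {B : Fin d → Fin N → ℝ} {v v' : ℝ}
    (hSK : S ⊆ K) (hS : S.Nonempty) (hSV : ∀ x ∈ S, F x ≤ V)
    (hgrad : ∀ c ∈ K, ∀ x ∈ K, F c + (grad c ⬝ᵥ x - grad c ⬝ᵥ c) ≤ F x)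
    (h : CutState K S F V b k c B v p) (hq : IsCutQuery K F grad c w v v' p p') :
    CutState K S F V b (k + 1) (cutCenter c B w) (cutBasis B w) v' p' := by
  refine ⟨?_, ?_⟩
  · rcases hq with ⟨-, -, rfl, rfl⟩ | ⟨hc, -, ⟨-, rfl, rfl⟩ | ⟨-, rfl, rfl⟩⟩
    · exact h.best
    · exact .inl ⟨hc, rfl⟩
    · exact h.best
  · rcases le_or_gt v' V with hv | hv
    · exact .inl hv
    right
    have hvv : V < v := by
      rcases hq with ⟨-, -, rfl, rfl⟩ | ⟨hc, -, ⟨h1, rfl, rfl⟩ | ⟨-, rfl, rfl⟩⟩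
      · exact hv
      · exact hv.trans h1
      · exact hv
    obtain ⟨hsub, M, hM, hdet⟩ := h.encl.resolve_left (not_le.2 hvv)
    -- At a feasible centre F x ≤ V < F c, and the tangent inequality forces the gradient to
    -- decrease strictly towards x.
    have hcut : ∀ x ∈ S, w ⬝ᵥ x < w ⬝ᵥ c := by
      rcases hq with ⟨-, hw, -, -⟩ | ⟨hc, rfl, hq⟩
      · exact fun x hx => hw x (hSK hx)
      · intro x hx
        have h1 := hgrad c hc x (hSK hx)
        have h2 := hSV x hx
        rcases hq with ⟨h3, rfl, -⟩ | ⟨h3, rfl, -⟩ <;> linarith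
    -- Were the norm zero, w would be constant on the ellipsoid, contradicting the strict cut at a
    -- point of S. This also covers d = 0.
    have hpos : 0 < cutNorm B w := by
      obtain ⟨x, hx⟩ := hS
      obtain ⟨u, -, hu⟩ := hsub hx
      by_contra hneg
      have h0 : ∑ i, cutDir B w i ^ 2 ≤ 0 := Real.sqrt_eq_zero'.1
        (le_antisymm (not_lt.1 hneg) (Real.sqrt_nonneg _))
      have h1 : ∀ i, cutDir B w i = 0 := fun i => by
        have := (Finset.sum_eq_zero_iff_of_nonneg fun i _ => sq_nonneg (cutDir B w i)).1
          (le_antisymm h0 (Finset.sum_nonneg fun i _ => sq_nonneg _)) i (Finset.mem_univ i)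
        exact pow_eq_zero_iff two_ne_zero |>.1 this
      have e : w ⬝ᵥ x = w ⬝ᵥ c + ∑ i, u i * cutDir B w i := by
        simp only [dotProduct, hu, mul_add, Finset.sum_add_distrib, cutDir, Finset.mul_sum]
        rw [Finset.sum_comm]
        congr 1
        exact Finset.sum_congr rfl fun i _ => Finset.sum_congr rfl fun s _ => by ring
      have := hcut x hx
      rw [e] at this
      simp [h1] at this
    refine ⟨fun x hx => mem_ellipsoid_cut hpos (hsub hx) (hcut x hx).le, cutMatrix B w * M, ?_, ?_⟩
    · intro i s
      rw [cutBasis_eq]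
      simp only [hM, Matrix.mul_apply, Finset.mul_sum, Finset.sum_mul]
      rw [Finset.sum_comm]
      exact Finset.sum_congr rfl fun j _ => Finset.sum_congr rfl fun l _ => by ring
    · rw [Matrix.det_mul, abs_mul, pow_succ']
      exact mul_le_mul (det_cutMatrix_le hpos) hdet (abs_nonneg _) (Real.exp_pos _).le

/-- If the best value still exceeded V, the ellipsoid would contain a ball of radius ρ, so ρ^d ≤
exp(-k/(2(d+2))), which fails for this many cuts. -/
theorem CutState.optimal {K S : Set (Fin N → ℝ)} {F : (Fin N → ℝ) → ℝ} {V : ℝ}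
    {b : Fin d → Fin N → ℝ} {k : ℕ} {c p : Fin N → ℝ} {B : Fin d → Fin N → ℝ} {v : ℝ}
    (h : CutState K S F V b k c B v p)
    (hb : ∀ i j, b i ⬝ᵥ b j = if i = j then 1 else 0) {ρ : ℝ} (hρ : 0 < ρ) {x : Fin N → ℝ}
    (hball : ∀ y : Fin d → ℝ, ∑ i, y i ^ 2 ≤ ρ ^ 2 → (fun s => x s + ∑ i, y i * b i s) ∈ S)
    (hk : 2 * (d + 2) * (d * Real.log (1 / ρ)) < k) : p ∈ K ∧ F p ≤ V := by
  rcases le_or_gt v V with hv | hv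
  · rcases h.best with ⟨h1, h2⟩ | h1
    · exact ⟨h1, by linarith⟩
    · linarith
  exfalso
  obtain ⟨hsub, M, hM, hdet⟩ := h.encl.resolve_left (not_le.2 hv)
  have h1 := (pow_le_abs_det_of_ball hρ.le hb hM fun y hy => hsub (hball y hy)).trans hdet
  have h2 := Real.log_le_log (by positivity) h1
  rw [← Real.exp_nat_mul, Real.log_exp, Real.log_pow] at h2
  rw [one_div, Real.log_inv] at hk
  have h3 : (0 : ℝ) < 2 * (d + 2) := by positivity
  have h4 : (k : ℝ) * -(1 / (2 * (d + 2))) = -(k / (2 * (d + 2))) := by ring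
  rw [h4, le_neg] at h2
  rw [← lt_div_iff₀' h3, mul_neg] at hk
  linarith

/-- The start is the unit ball of the affine hull around the foot of the perpendicular from the
origin. The coordinates of x are then its inner products with b, and Bessel's inequality bounds
them, since ⟨x, x⟩ ≤ ∑ x s = 1 on the simplex. -/
lemma CutState.init {K S : Set (Fin N → ℝ)} {F : (Fin N → ℝ) → ℝ} {V v : ℝ} {a p : Fin N → ℝ}
    {b : Fin d → Fin N → ℝ} (hK : K ⊆ stdSimplex ℝ (Fin N)) (hSK : S ⊆ K) (hv : V < v)
    (hb : ∀ i j, b i ⬝ᵥ b j = if i = j then 1 else 0)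
    (hab : ∀ x ∈ K, ∃ y : Fin d → ℝ, x = a + ∑ i, y i • b i) :
    CutState K S F V b 0 (fun s => a s - ∑ i, (b i ⬝ᵥ a) * b i s) b v p := by
  refine ⟨.inr hv, .inr ⟨fun x hx => ?_, 1, ?_, by simp⟩⟩
  · have hxK := hSK hx
    obtain ⟨y, hy⟩ := hab x hxK
    have hdot : ∀ i, b i ⬝ᵥ x = b i ⬝ᵥ a + y i := by
      intro i
      rw [hy, dotProduct_add, dotProduct_sum]
      simp [dotProduct_smul, hb]
    have hrep : ∀ s, x s = a s + ∑ i, y i * b i s := by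
      intro s; rw [hy]; simp [Finset.sum_apply]
    refine ⟨fun i => b i ⬝ᵥ x, ?_, ?_⟩
    · have hx1 : x ⬝ᵥ x ≤ 1 := by
        have hx := hK hxK
        rw [← hx.2]
        apply Finset.sum_le_sum
        intro s _
        have := mul_le_mul_of_nonneg_left (le_one_of_mem_stdSimplex hx s) (hx.1 s)
        linarith
      set z : Fin N → ℝ := ∑ i, (b i ⬝ᵥ x) • b i with hz
      have hzx : z ⬝ᵥ x = ∑ i, (b i ⬝ᵥ x) ^ 2 := by
        rw [hz, sum_dotProduct]
        exact Finset.sum_congr rfl fun i _ => by rw [smul_dotProduct, smul_eq_mul]; ring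
      have hzz : z ⬝ᵥ z = ∑ i, (b i ⬝ᵥ x) ^ 2 := by
        conv_lhs => rw [hz]
        rw [sum_dotProduct]
        refine Finset.sum_congr rfl fun i _ => ?_
        rw [smul_dotProduct, dotProduct_sum]
        simp [dotProduct_smul, hb, sq]
      have hnn : 0 ≤ (x - z) ⬝ᵥ (x - z) := Finset.sum_nonneg fun s _ => mul_self_nonneg _
      rw [sub_dotProduct, dotProduct_sub, dotProduct_sub, dotProduct_comm x z] at hnn
      linarith
    · intro s
      rw [hrep s]
      simp only [hdot, add_mul, Finset.sum_add_distrib]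
      ring
  · intro i s
    simp [Matrix.one_apply]

/-- The shrunken copy of `K` at a minimizer consists of near-minimizers and contains a ball. -/
lemma exists_near_minimizers {K : Set (Fin N → ℝ)} (hK : K ⊆ stdSimplex ℝ (Fin N))
    (hc : Convex ℝ K) (hcl : IsClosed K) (hne : K.Nonempty) {κ θ R tol r : ℝ} (hκ : 0 ≤ κ)
    (hθ : 0 < θ) {G : Fin N → ℝ} (hR : ∀ x ∈ K, ∀ y ∈ K, smoothObj κ θ G x - smoothObj κ θ G y ≤ R)
    (hR0 : 0 ≤ R) (htol : 0 < tol) {a : Fin N → ℝ} {b : Fin d → Fin N → ℝ}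
    (hab : IsInnerBallData K a b r) :
    ∃ x ∈ K, (∀ q ∈ K, smoothObj κ θ G x ≤ smoothObj κ θ G q) ∧ ∃ S ⊆ K, S.Nonempty ∧
      (∀ y ∈ S, smoothObj κ θ G y ≤ smoothObj κ θ G x + tol) ∧ ∃ z : Fin N → ℝ,
        ∀ y : Fin d → ℝ, ∑ i, y i ^ 2 ≤ (tol / (R + tol) * r) ^ 2 →
          (fun s => z s + ∑ i, y i * b i s) ∈ S := by
  have hcp : IsCompact K := (isCompact_stdSimplex ℝ (Fin N)).of_isClosed_subset hcl hK
  obtain ⟨x, hx, hmin⟩ := hcp.exists_isMinOn hne (continuous_smoothObj κ θ G).continuousOn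
  -- The contraction ratio satisfies l · R ≤ tol, so by convexity the copy of `K` shrunk towards x
  -- loses at most tol, and its inner ball has radius l · r.
  set l := tol / (R + tol) with hl
  have hl0 : 0 < l := by positivity
  have hl1 : l ≤ 1 := by rw [hl, div_le_one (by positivity)]; linarith
  refine ⟨x, hx, fun q hq => hmin hq, (fun y s => (1 - l) * x s + l * y s) '' K, ?_, hne.image _,
    ?_, ?_⟩
  · rintro _ ⟨y, hy, rfl⟩
    exact hc hx hy (by linarith : 0 ≤ 1 - l) hl0.le (by ring)
  · rintro _ ⟨y, hy, rfl⟩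
    have h1 := smoothObj_convex hκ hθ G (hK hx).1 (hK hy).1 hl0.le hl1
    have h2 := mul_le_mul_of_nonneg_left (hR y hy x hx) hl0.le
    have h3 : l * R ≤ tol := by
      rw [hl, div_mul_eq_mul_div, div_le_iff₀ (by positivity)]; nlinarith
    linarith
  · obtain ⟨y₀, hy₀⟩ := hab.ball_subset
    refine ⟨fun s => (1 - l) * x s + l * (a s + ∑ i, y₀ i * b i s), fun y hy => ?_⟩
    refine ⟨_, hy₀ (fun i => y₀ i + y i / l) ?_, ?_⟩
    · simp only [add_sub_cancel_left, div_pow, ← Finset.sum_div]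
      rw [div_le_iff₀ (by positivity)]
      linarith
    · ext s
      simp only [Pi.add_apply, Finset.sum_apply, Pi.smul_apply, smul_eq_mul, add_mul,
        Finset.sum_add_distrib, mul_add]
      have : l * ∑ i, y i / l * b i s = ∑ i, y i * b i s := by
        rw [Finset.mul_sum]; exact Finset.sum_congr rfl fun i _ => by field_simp
      linarith

end Keychain
end

noncomputable section

namespace Keychain

/-! ### The program: cutting planes -/

attribute [simp] NatExp.eval RealExp.eval Test.Holds

/-- Working memory. Natural arrays: 5 and 6 loop counters, 7 running hits, 8 answer of the
separation oracle. Real arrays: 3 best point, 4 cumulative utilities, 5 centre, 6 spanning vectors,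
7 cut normal, 8 its ellipsoid coordinates, 9 cut axis, 10 accumulator, 12 objective at the centre,
13 norm of the cut. Cells of real array 11: 0 entropy weight, 1 range of the objective, 2 shift θ, 3
bound on the cuts, 4 cuts made, 5 best value, 6 to 8 shift, shrink and grow factors. -/
abbrev natAt (A i : ℕ) : NatExp := .cell A (.lit i)

abbrev realAt (A i : ℕ) : RealExp := .cell A (.lit i)

/-- The number of scenarios. -/
abbrev lenE : NatExp := natAt 0 1

/-- The dimension of the affine hull. -/
abbrev dimE : NatExp := natAt 0 4

/-- The outer loop counter. -/
abbrev iE : NatExp := natAt 5 0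

/-- The inner loop counter. -/
abbrev jE : NatExp := natAt 6 0

abbrev accE : RealExp := realAt 10 0

/-- `for i < e do A[i] := E`. -/
abbrev mapCmd (A : ℕ) (e : NatExp) (E : RealExp) : Cmd :=
  mapSum A e (.lit 0) (.ofNat (.lit 0)) E

/-- The cut with normal vector in array `7`: center in array `5`, spanning vectors in array `6`. -/
def cutCmd : Cmd :=
  .seq (mapSum 8 dimE lenE (.mul (.cell 6 (.add (.mul iE lenE) jE)) (.cell 7 jE)) accE) <|
  .seq (mapSum 13 (.lit 1) dimE (.mul (.cell 8 jE) (.cell 8 jE)) (.sqrt accE)) <|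
  .seq (mapSum 9 lenE dimE (.mul (.cell 8 jE) (.cell 6 (.add (.mul jE lenE) iE)))
    (.div accE (realAt 13 0))) <|
  .seq (mapCmd 5 lenE (.sub (.cell 5 iE) (.mul (realAt 11 6) (.cell 9 iE)))) <|
  .seq (gridMap 6 dimE lenE (.add (.mul (realAt 11 8) (.cell 6 (.add (.mul iE lenE) jE)))
    (.mul (.mul (.sub (realAt 11 7) (realAt 11 8)) (.div (.cell 8 iE) (realAt 13 0)))
      (.cell 9 jE)))) <|
  .setReal 11 (.lit 4) (.add (realAt 11 4) (.ofNat (.lit 1)))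

/-- Evaluation of the objective at the center, update of the best point, and the gradient. -/
def evalCmd : Cmd :=
  .seq (mapSum 12 (.lit 1) lenE (.add (.mul (.cell 4 jE) (.cell 5 jE)) (.mul (realAt 11 0)
    (.mul (.add (.cell 5 jE) (realAt 11 2)) (.log (.add (.cell 5 jE) (realAt 11 2)))))) accE) <|
  .seq (.ite (.realLt (realAt 12 0) (realAt 11 5))
    (.seq (.setReal 11 (.lit 5) (realAt 12 0)) (mapCmd 3 lenE (.cell 5 iE))) .skip) <|
  mapCmd 7 lenE (.add (.cell 4 iE) (.mul (realAt 11 0)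
    (.add (.log (.add (.cell 5 iE) (realAt 11 2))) (.ofNat (.lit 1)))))

def queryCmd : Cmd :=
  .seq (.separate 5 8 7) (.ite (.natEq (natAt 8 0) (.lit 0)) .skip evalCmd)

/-- The number of cuts is counted in a real cell, because its bound is a real and the machine cannot
convert it to a natural number. The comparison performs the rounding up. -/
def cutLoop : Cmd := .loop (.realLt (realAt 11 4) (realAt 11 3)) (.seq queryCmd cutCmd)

variable {N d : ℕ} {sep : (Fin N → ℝ) → Option (Fin N → ℝ)}

/-- The parts of memory that are constant during the cutting plane loop. -/
structure Ctx (d : ℕ) (κ θ J : ℝ) (G : Fin N → ℝ) (σ₀ σ : Mem) : Prop where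
  nat : ∀ k ≤ 4, σ.nat k = σ₀.nat k
  real : ∀ k, k ≤ 2 ∨ k = 4 → σ.real k = σ₀.real k
  len : σ.nat 0 1 = N
  dim : σ.nat 0 4 = d
  loss : ∀ s : Fin N, σ.real 4 s = G s
  weight : σ.real 11 0 = κ
  smooth : σ.real 11 2 = θ
  bound : σ.real 11 3 = J
  shift : σ.real 11 6 = cutShift d
  shrink : σ.real 11 7 = cutShrink d
  grow : σ.real 11 8 = cutGrow d

namespace Ctx

variable {κ θ J : ℝ} {G : Fin N → ℝ} {σ₀ σ σ' : Mem}

lemma congr (h : Ctx d κ θ J G σ₀ σ) (hn : ∀ k ≤ 4, σ'.nat k = σ.nat k)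
    (hr : ∀ k, k ≤ 2 ∨ k = 4 → σ'.real k = σ.real k)
    (h11 : ∀ i, i ≠ 4 → i ≠ 5 → σ'.real 11 i = σ.real 11 i) : Ctx d κ θ J G σ₀ σ' where
  nat k hk := (hn k hk).trans (h.nat k hk)
  real k hk := (hr k hk).trans (h.real k hk)
  len := by rw [hn 0 (by norm_num), h.len]
  dim := by rw [hn 0 (by norm_num), h.dim]
  loss s := by rw [hr 4 (by norm_num), h.loss]
  weight := by rw [h11 0 (by norm_num) (by norm_num), h.weight]
  smooth := by rw [h11 2 (by norm_num) (by norm_num), h.smooth]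
  bound := by rw [h11 3 (by norm_num) (by norm_num), h.bound]
  shift := by rw [h11 6 (by norm_num) (by norm_num), h.shift]
  shrink := by rw [h11 7 (by norm_num) (by norm_num), h.shrink]
  grow := by rw [h11 8 (by norm_num) (by norm_num), h.grow]

lemma same (h : Ctx d κ θ J G σ₀ σ) {A : ℕ} (hs : Same A σ σ') (h2 : 2 < A) (h4 : A ≠ 4)
    (h11 : A ≠ 11) : Ctx d κ θ J G σ₀ σ' :=
  h.congr (fun k hk => hs.nat k (by omega) (by omega))
    (fun k hk => hs.real k (by omega) (by omega))
    fun i _ _ => by rw [hs.real 11 h11.symm (by norm_num)]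

end Ctx

lemma runs_cutCmd {κ θ J : ℝ} {G : Fin N → ℝ} {σ₀ σ : Mem} (hx : Ctx d κ θ J G σ₀ σ)
    {c w : Fin N → ℝ} {B : Fin d → Fin N → ℝ} (hc : ∀ s : Fin N, σ.real 5 s = c s)
    (hB : ∀ (i : Fin d) (s : Fin N), σ.real 6 (i * N + s) = B i s)
    (hw : ∀ s : Fin N, σ.real 7 s = w s) :
    Runs sep cutCmd σ (37 * ((d + 1) * (N + 1))) fun σ' => Ctx d κ θ J G σ₀ σ' ∧
      (∀ s : Fin N, σ'.real 5 s = cutCenter c B w s) ∧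
      (∀ (i : Fin d) (s : Fin N), σ'.real 6 (i * N + s) = cutBasis B w i s) ∧
      σ'.real 3 = σ.real 3 ∧ σ'.real 11 5 = σ.real 11 5 ∧
      σ'.real 11 4 = σ.real 11 4 + 1 := by
  refine Runs.mono (Runs.seq (Runs.mapSum (by norm_num) (fun i j => B i j * w j) (cutDir B w)
    ?_ ?_ ?_ ?_) ?_) (B := 6 * (d + 1) * (N + 1) + (6 * (1 + 1) * (d + 1) +
      (6 * (N + 1) * (d + 1) + (6 * (N + 1) * (0 + 1) + (6 * (d + 1) * (N + 1) + 1)))))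
    (by nlinarith [Nat.zero_le (d * N)]) (fun _ h => h)
  · intro σ' h; simp [h.nat, hx.dim]
  · intro σ' h; simp [h.nat, hx.len]
  · intro i j σ' h hj
    simp [h.nat, h.real, hx.len, h.ctr, hj, hB, hw]
  · intro i σ' h ha
    simp [ha, cutDir]
  rintro σ₁ ⟨s₁, q₁, -⟩
  have x₁ := hx.same s₁ (by norm_num) (by norm_num) (by norm_num)
  refine Runs.seq (Runs.mapSum (by norm_num) (fun (_ : Fin 1) j => cutDir B w j * cutDir B w j)
    (fun _ => cutNorm B w) ?_ ?_ ?_ ?_) ?_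
  · intro σ' h; simp
  · intro σ' h; simp [h.nat, x₁.dim]
  · intro i j σ' h hj
    simp [h.real, hj, q₁]
  · intro i σ' h ha
    simp [ha, cutNorm, sq]
  rintro σ₂ ⟨s₂, q₂, -⟩
  have x₂ := x₁.same s₂ (by norm_num) (by norm_num) (by norm_num)
  have n₂ : σ₂.real 13 0 = cutNorm B w := q₂ 0
  refine Runs.seq (Runs.mapSum (by norm_num) (fun i j => cutDir B w j * B j i)
    (cutAxis B w) ?_ ?_ ?_ ?_) ?_
  · intro σ' h; simp [h.nat, x₂.len]
  · intro σ' h; simp [h.nat, x₂.dim]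
  · intro i j σ' h hj
    simp [h.nat, h.real, x₂.len, h.ctr, hj, s₂.real, q₁, s₁.real, hB]
  · intro i σ' h ha
    simp [ha, h.real, n₂, cutAxis]
  rintro σ₃ ⟨s₃, q₃, -⟩
  have x₃ := x₂.same s₃ (by norm_num) (by norm_num) (by norm_num)
  refine Runs.seq (Runs.mapSum (by norm_num) (fun _ (_ : Fin 0) => 0)
    (cutCenter c B w) ?_ ?_ ?_ ?_) ?_
  · intro σ' h; simp [h.nat, x₃.len]
  · intro σ' h; simp
  · intro i j; exact j.elim0
  · intro i σ' h _
    simp [h.real, h.ctr, h.rest, q₃, s₃.real, s₂.real, s₁.real, hc, cutCenter, x₃.shift]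
  rintro σ₄ ⟨s₄, q₄, -⟩
  have x₄ := x₃.same s₄ (by norm_num) (by norm_num) (by norm_num)
  refine Runs.seq (Runs.gridMap (cutBasis B w) ?_ ?_ ?_) ?_
  · intro σ' h; simp [h.nat, x₄.dim]
  · intro σ' h; simp [h.nat, x₄.len]
  · intro i j σ' h hi hj hr
    simp [h.nat, x₄.len, hi, hj, hr, h.real, s₄.real, q₃, s₃.real, s₂.real, q₁, s₁.real, hB, n₂,
      cutBasis, x₄.grow, x₄.shrink]
  rintro σ₅ ⟨s₅, q₅⟩
  have x₅ := x₄.same s₅ (by norm_num) (by norm_num) (by norm_num)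
  apply Runs.setReal
  refine ⟨x₅.congr (by simp) ?_ ?_, ?_, ?_, ?_, ?_, ?_⟩
  · intro k hk
    rw [Mem.setReal_real_ne _ _ _ (by omega)]
  · intro i h4 _; simp [h4]
  · intro s; simp [s₅.real, q₄]
  · intro i s; simp [q₅]
  · rw [Mem.setReal_real_ne _ _ _ (by norm_num)]
    simp [s₅.real, s₄.real, s₃.real, s₂.real, s₁.real]
  · simp [s₅.real, s₄.real, s₃.real, s₂.real, s₁.real]
  · simp [s₅.real, s₄.real, s₃.real, s₂.real, s₁.real]

lemma runs_evalCmd {κ θ J : ℝ} {G : Fin N → ℝ} {σ₀ σ : Mem} (hx : Ctx d κ θ J G σ₀ σ)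
    {c p : Fin N → ℝ} {v : ℝ} (hc : ∀ s : Fin N, σ.real 5 s = c s)
    (hp : ∀ s : Fin N, σ.real 3 s = p s) (hv : σ.real 11 5 = v) :
    Runs sep evalCmd σ (28 * (N + 1)) fun σ' => Ctx d κ θ J G σ₀ σ' ∧
      σ'.real 5 = σ.real 5 ∧ σ'.real 6 = σ.real 6 ∧ σ'.real 11 4 = σ.real 11 4 ∧
      (∀ s : Fin N, σ'.real 7 s = smoothGrad κ θ G c s) ∧ ∃ (v' : ℝ) (p' : Fin N → ℝ),
        σ'.real 11 5 = v' ∧ (∀ s : Fin N, σ'.real 3 s = p' s) ∧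
        ((smoothObj κ θ G c < v ∧ v' = smoothObj κ θ G c ∧ p' = c) ∨
          (v ≤ smoothObj κ θ G c ∧ v' = v ∧ p' = p)) := by
  refine Runs.mono (Runs.seq (Runs.mapSum (by norm_num)
    (fun (_ : Fin 1) s => G s * c s + κ * ((c s + θ) * Real.log (c s + θ)))
    (fun _ => smoothObj κ θ G c) ?_ ?_ ?_ ?_) ?_) (B := 6 * (1 + 1) * (N + 1) +
      (((1 + 6 * (N + 1) * (0 + 1)) + 1 + 1) + 6 * (N + 1) * (0 + 1)))
    (by omega) (fun _ h => h)
  · intro σ' h; simp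
  · intro σ' h; simp [h.nat, hx.len]
  · intro i j σ' h hj
    simp [h.real, hj, hx.loss, hc, hx.weight, hx.smooth]
  · intro i σ' h ha
    simp [ha, smoothObj]
  rintro σ₁ ⟨s₁, q₁, -⟩
  have x₁ := hx.same s₁ (by norm_num) (by norm_num) (by norm_num)
  have n₁ : σ₁.real 12 0 = smoothObj κ θ G c := q₁ 0
  refine Runs.seq (R := fun σ' => Ctx d κ θ J G σ₀ σ' ∧ σ'.real 5 = σ.real 5 ∧
    σ'.real 6 = σ.real 6 ∧ σ'.real 11 4 = σ.real 11 4 ∧ ∃ (v' : ℝ) (p' : Fin N → ℝ),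
        σ'.real 11 5 = v' ∧ (∀ s : Fin N, σ'.real 3 s = p' s) ∧
        ((smoothObj κ θ G c < v ∧ v' = smoothObj κ θ G c ∧ p' = c) ∨
          (v ≤ smoothObj κ θ G c ∧ v' = v ∧ p' = p))) (Runs.ite ?_ ?_) ?_
  · intro hlt
    simp only [Test.Holds, RealExp.eval, NatExp.eval] at hlt
    rw [n₁, s₁.real 11 (by norm_num) (by norm_num), hv] at hlt
    refine Runs.seq (R := fun σ' => σ' = σ₁.setReal 11 5 (smoothObj κ θ G c))
      (Runs.setReal (by simp [n₁])) ?_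
    rintro _ rfl
    have x₂ : Ctx d κ θ J G σ₀ (σ₁.setReal 11 5 (smoothObj κ θ G c)) := x₁.congr (by simp)
      (fun k hk => by rw [Mem.setReal_real_ne _ _ _ (by omega)]) (fun i _ h5 => by simp [h5])
    refine Runs.mono (Runs.mapSum (by norm_num) (fun _ (_ : Fin 0) => 0) c ?_ ?_ ?_ ?_) le_rfl ?_
    · intro σ' h; simp [h.nat, x₁.len]
    · intro σ' h; simp
    · intro i j; exact j.elim0
    · intro i σ' h _
      simp [h.real, h.ctr, s₁.real, hc]
    · rintro σ₃ ⟨s₃, q₃, -⟩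
      refine ⟨x₂.same s₃ (by norm_num) (by norm_num) (by norm_num), ?_, ?_, ?_, _, c, rfl, q₃,
        .inl ⟨hlt, ?_, rfl⟩⟩
      · rw [s₃.real 5 (by norm_num) (by norm_num), Mem.setReal_real_ne _ _ _ (by norm_num),
          s₁.real 5 (by norm_num) (by norm_num)]
      · rw [s₃.real 6 (by norm_num) (by norm_num), Mem.setReal_real_ne _ _ _ (by norm_num),
          s₁.real 6 (by norm_num) (by norm_num)]
      · simp [s₃.real, s₁.real]
      · simp [s₃.real]
  · intro hle
    simp only [Test.Holds, RealExp.eval, NatExp.eval] at hle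
    rw [n₁, s₁.real 11 (by norm_num) (by norm_num), hv, not_lt] at hle
    apply Runs.skip
    refine ⟨x₁, ?_, ?_, ?_, v, p, ?_, ?_, .inr ⟨hle, rfl, rfl⟩⟩ <;> simp [s₁.real, hv, hp]
  rintro σ₂ ⟨x₂, e5, e6, e4, v', p', hv', hp', hcase⟩
  refine Runs.mono (Runs.mapSum (by norm_num) (fun _ (_ : Fin 0) => 0) (smoothGrad κ θ G c)
    ?_ ?_ ?_ ?_) le_rfl ?_
  · intro σ' h; simp [h.nat, x₂.len]
  · intro σ' h; simp
  · intro i j; exact j.elim0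
  · intro i σ' h _
    simp [h.real, h.ctr, e5, hc, x₂.loss, x₂.weight, x₂.smooth, smoothGrad]
  · rintro σ₃ ⟨s₃, q₃, -⟩
    refine ⟨x₂.same s₃ (by norm_num) (by norm_num) (by norm_num), ?_, ?_, ?_, q₃, v', p', ?_, ?_,
      hcase⟩ <;> simp [s₃.real, e5, e6, e4, hv', hp']

lemma runs_queryCmd {K : Set (Fin N → ℝ)} (hsep : IsSeparationOracle K sep) {κ θ J : ℝ}
    {G : Fin N → ℝ} {σ₀ σ : Mem} (hx : Ctx d κ θ J G σ₀ σ)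
    {c p : Fin N → ℝ} {v : ℝ} (hc : ∀ s : Fin N, σ.real 5 s = c s)
    (hp : ∀ s : Fin N, σ.real 3 s = p s) (hv : σ.real 11 5 = v) :
    Runs sep queryCmd σ (31 * (N + 1)) fun σ' => Ctx d κ θ J G σ₀ σ' ∧
      σ'.real 5 = σ.real 5 ∧ σ'.real 6 = σ.real 6 ∧ σ'.real 11 4 = σ.real 11 4 ∧
      ∃ (w : Fin N → ℝ) (v' : ℝ) (p' : Fin N → ℝ), (∀ s : Fin N, σ'.real 7 s = w s) ∧
        σ'.real 11 5 = v' ∧ (∀ s : Fin N, σ'.real 3 s = p' s) ∧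
        IsCutQuery K (smoothObj κ θ G) (smoothGrad κ θ G) c w v v' p p' := by
  have hread : σ.readVec N 5 = c := funext hc
  obtain ⟨hin, hout⟩ := hsep c
  refine Runs.mono (Runs.seq (R := fun σ' => σ' = oracleStep sep 5 8 7 σ) (Runs.separate rfl) ?_)
    (B := (N + 1) + (1 + 28 * (N + 1) + 1)) (by omega) (fun _ h => h)
  rintro _ rfl
  by_cases hK : c ∈ K
  · have e : oracleStep sep 5 8 7 σ = σ.setNat 8 0 1 := by
      unfold oracleStep; rw [hread, hin hK]
    rw [e]
    have x₁ : Ctx d κ θ J G σ₀ (σ.setNat 8 0 1) :=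
      hx.congr (fun k hk => by rw [Mem.setNat_nat_ne _ _ _ (by omega)]) (fun _ _ => rfl)
        fun _ _ _ => rfl
    refine Runs.ite (fun h => absurd h (by simp)) fun _ => ?_
    refine (runs_evalCmd x₁ hc hp hv).mono le_rfl ?_
    rintro σ₂ ⟨x₂, e5, e6, e4, hw, v', p', hv', hp', hcase⟩
    exact ⟨x₂, e5, e6, e4, _, v', p', hw, hv', hp', .inr ⟨hK, rfl, hcase⟩⟩
  · obtain ⟨w, hw, hlt⟩ := hout hK
    have e : oracleStep sep 5 8 7 σ = (σ.setNat 8 0 0).writeVec 7 w := by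
      unfold oracleStep; rw [hread, hw]
    rw [e]
    have hr : ∀ k, k ≠ 7 → ((σ.setNat 8 0 0).writeVec 7 w).real k = σ.real k := fun k hk => by
      rw [Mem.writeVec_real_ne _ _ hk]; rfl
    have x₁ : Ctx d κ θ J G σ₀ ((σ.setNat 8 0 0).writeVec 7 w) :=
      hx.congr (fun k hk => by rw [Mem.writeVec_nat, Mem.setNat_nat_ne _ _ _ (by omega)])
        (fun k hk => hr k (by omega)) fun i _ _ => by rw [hr 11 (by norm_num)]
    refine Runs.ite (fun _ => Runs.skip ?_) fun h => absurd (by simp) h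
    refine ⟨x₁, hr 5 (by norm_num), hr 6 (by norm_num), by rw [hr 11 (by norm_num)], w, v, p, ?_,
      ?_, ?_, .inl ⟨hK, hlt, rfl, rfl⟩⟩
    · intro s; simp
    · rw [hr 11 (by norm_num), hv]
    · intro s; rw [hr 3 (by norm_num), hp]

/-- V is unknown to the program, so the loop always makes ⌈J⌉ cuts. Once a value at most V is found,
`CutState` demands nothing of the ellipsoid, and later, possibly degenerate cuts do no harm. -/
theorem runs_cutLoop {K S : Set (Fin N → ℝ)} (hsep : IsSeparationOracle K sep) {κ θ J V : ℝ}
    {G : Fin N → ℝ} (hSK : S ⊆ K) (hS : S.Nonempty) (hSV : ∀ x ∈ S, smoothObj κ θ G x ≤ V)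
    (hgrad : ∀ c ∈ K, ∀ x ∈ K, smoothObj κ θ G c +
      (smoothGrad κ θ G c ⬝ᵥ x - smoothGrad κ θ G c ⬝ᵥ c) ≤ smoothObj κ θ G x)
    {b B : Fin d → Fin N → ℝ} {c p : Fin N → ℝ} {v : ℝ} {σ₀ σ : Mem}
    (hx : Ctx d κ θ J G σ₀ σ) (hc : ∀ s : Fin N, σ.real 5 s = c s)
    (hB : ∀ (i : Fin d) (s : Fin N), σ.real 6 (i * N + s) = B i s)
    (hp : ∀ s : Fin N, σ.real 3 s = p s) (hv : σ.real 11 5 = v) (h4 : σ.real 11 4 = 0)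
    (hcut : CutState K S (smoothObj κ θ G) V b 0 c B v p) :
    Runs sep cutLoop σ (⌈J⌉₊ * (68 * ((d + 1) * (N + 1)) + 1) + 1) fun σ' =>
      Ctx d κ θ J G σ₀ σ' ∧ ∃ c B v, CutState K S (smoothObj κ θ G) V b ⌈J⌉₊ c B v
        (fun s => σ'.real 3 s) := by
  refine Runs.mono (Runs.loop (Inv := fun k σ => Ctx d κ θ J G σ₀ σ ∧ σ.real 11 4 = k ∧
    ∃ c B v p, (∀ s : Fin N, σ.real 5 s = c s) ∧
      (∀ (i : Fin d) (s : Fin N), σ.real 6 (i * N + s) = B i s) ∧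
      (∀ s : Fin N, σ.real 3 s = p s) ∧ σ.real 11 5 = v ∧
      CutState K S (smoothObj κ θ G) V b k c B v p)
    (L := ⌈J⌉₊) (B := 68 * ((d + 1) * (N + 1))) ?_ ?_
    ⟨hx, by simpa using h4, c, B, v, p, hc, hB, hp, hv, hcut⟩) le_rfl ?_
  · rintro k hk σ₁ ⟨x₁, h4, c, B, v, p, hc, hB, hp, hv, hcut⟩
    refine ⟨?_, ?_⟩
    · simp only [Test.Holds, RealExp.eval, NatExp.eval]
      rw [h4, x₁.bound]
      exact Nat.lt_ceil.1 hk
    · refine Runs.mono (Runs.seq (runs_queryCmd hsep x₁ hc hp hv) ?_)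
        (B := 31 * (N + 1) + 37 * ((d + 1) * (N + 1)))
        (by nlinarith [Nat.zero_le (d * N)]) (fun _ h => h)
      rintro σ₂ ⟨x₂, e5, e6, e4, w, v', p', hw, hv', hp', hq⟩
      refine (runs_cutCmd x₂ (c := c) (B := B) (w := w) (by simpa [e5] using hc)
        (by simpa [e6] using hB) hw).mono le_rfl ?_
      rintro σ₃ ⟨x₃, hc₃, hB₃, e3, e11, e114⟩
      exact ⟨x₃, by rw [e114, e4, h4]; push_cast; rfl, _, _, v', p', hc₃, hB₃,
        by simpa [e3] using hp', e11.trans hv', hcut.step hSK hS hSV hgrad hq⟩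
  · rintro σ₁ ⟨x₁, h4, -⟩
    simp only [Test.Holds, RealExp.eval, NatExp.eval]
    rw [h4, x₁.bound, not_lt]
    exact Nat.le_ceil J
  · rintro σ₁ ⟨x₁, -, c, B, v, p, -, -, hp, -, hcut⟩
    have : p = fun s : Fin N => σ₁.real 3 s := funext fun s => (hp s).symm
    subst this
    exact ⟨x₁, c, B, v, hcut⟩

end Keychain
end

noncomputable section

namespace Keychain

/-! ### The program: one round -/

abbrev keysE : NatExp := natAt 0 0

abbrev roundsE : NatExp := natAt 0 2

abbrev horizonE : NatExp := natAt 0 3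

abbrev keyE : NatExp := .cell 2 iE

abbrev entryE : NatExp := .add (.mul iE roundsE) jE

abbrev bitE : NatExp := .cell 3 (.add (.mul entryE keysE) keyE)

/-- `1` if the action in the current entry is the correct key, and else `0`. -/
abbrev matchE : NatExp :=
  .sub (.sub (.lit 1) (.sub (.cell 4 entryE) (.add keyE (.lit 1))))
    (.sub (.add keyE (.lit 1)) (.cell 4 entryE))

/-- Adds the utilities of the policy in natural array `4` to real array `4`. -/
def updateCmd : Cmd :=
  forLoop 5 lenE (.seq (.setNat 7 (.lit 0) (.lit 0)) (forLoop 6 roundsE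
    (.seq (.setNat 7 (.lit 0) (.add (natAt 7 0) (.mul matchE bitE)))
      (.setReal 4 iE (.add (.cell 4 iE) (.ofNat (.mul (natAt 7 0) bitE)))))))

abbrev oneE : RealExp := .ofNat (.lit 1)

abbrev dimTwoE : RealExp := .add (.ofNat dimE) (.ofNat (.lit 2))

abbrev smoothE : RealExp :=
  .div (realAt 0 0) (.add (.mul (.mul (.ofNat (.lit 512)) (realAt 11 0)) (.ofNat lenE)) (realAt 0 0))

/-- The weight 1/η is computed by the same nested divisions as in `learningRate`, so the convention
x/0 = 0 acts identically. The best value starts at range plus ε, above every value attained on `K`.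
-/
def scalarCmd : Cmd :=
  .seq (.setReal 11 (.lit 0) (.div oneE (.div (.sqrt (.log (.ofNat lenE)))
    (.mul (.ofNat roundsE) (.sqrt (.ofNat horizonE)))))) <|
  .seq (.setReal 11 (.lit 1) (.add (.mul (.ofNat roundsE) (.ofNat horizonE))
    (.mul (.mul (.ofNat (.lit 4)) (realAt 11 0)) (.ofNat lenE)))) <|
  .seq (.setReal 11 (.lit 2) (.mul smoothE smoothE)) <|
  .seq (.setReal 11 (.lit 3) (.mul (.mul (.ofNat (.lit 2)) (.mul dimTwoE dimTwoE))
    (.add (.add (.log (.add oneE (.div (.mul (.ofNat (.lit 128)) (realAt 11 1)) (realAt 0 0))))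
      (.log (.add oneE (.div oneE (realAt 0 1))))) oneE))) <|
  .seq (.setReal 11 (.lit 4) (.ofNat (.lit 0))) <|
  .seq (.setReal 11 (.lit 5) (.add (realAt 11 1) (realAt 0 0))) <|
  .seq (.setReal 11 (.lit 6) (.div oneE dimTwoE)) <|
  .seq (.setReal 11 (.lit 7) (.sub oneE (realAt 11 6))) <|
  .setReal 11 (.lit 8) (.div (realAt 11 7)
    (.sqrt (.sub oneE (.mul (.ofNat (.lit 2)) (realAt 11 6)))))

/-- The initial ellipsoid: the intersection of the unit ball and the affine hull. -/
def startCmd : Cmd :=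
  .seq (mapSum 8 dimE lenE (.mul (.cell 2 (.add (.mul iE lenE) jE)) (.cell 1 jE)) accE) <|
  .seq (mapSum 5 lenE dimE (.mul (.cell 8 jE) (.cell 2 (.add (.mul jE lenE) iE)))
    (.sub (.cell 1 iE) accE)) <|
  gridMap 6 dimE lenE (.cell 2 (.add (.mul iE lenE) jE))

def roundCmd : Cmd := .seq updateCmd (.seq scalarCmd (.seq startCmd cutLoop))

variable {n N d : ℕ} {sep : (Fin N → ℝ) → Option (Fin N → ℝ)}

lemma Runs.setReal_seq {A : ℕ} {i : NatExp} {e : RealExp} {P : Cmd} {σ : Mem} {B : ℕ}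
    {Q : Mem → Prop} (h : Runs sep P (σ.setReal A (i.eval σ) (e.eval σ)) B Q) :
    Runs sep (.seq (.setReal A i e) P) σ (1 + B) Q :=
  Runs.seq (R := fun σ' => σ' = σ.setReal A (i.eval σ) (e.eval σ)) (Runs.setReal rfl)
    (by rintro _ rfl; exact h)

lemma Runs.setNat_seq {A : ℕ} {i e : NatExp} {P : Cmd} {σ : Mem} {B : ℕ}
    {Q : Mem → Prop} (h : Runs sep P (σ.setNat A (i.eval σ) (e.eval σ)) B Q) :
    Runs sep (.seq (.setNat A i e) P) σ (1 + B) Q :=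
  Runs.seq (R := fun σ' => σ' = σ.setNat A (i.eval σ) (e.eval σ)) (Runs.setNat rfl)
    (by rintro _ rfl; exact h)

namespace Env

variable (I : Env n N)

lemma inputMem_bit (ε r : ℝ) (a : Fin N → ℝ) (b : Fin d → Fin N → ℝ) (s : Fin N) {t : ℕ}
    (ht : t < I.maxRounds) :
    (I.inputMem ε r a b).nat 3 ((s * I.maxRounds + t) * n + I.key s) = I.keyBit s t := by
  have hn : 0 < n := (I.key s).pos
  have e1 : ((s * I.maxRounds + t) * n + I.key s : ℕ) / n = s * I.maxRounds + t := by
    rw [Nat.mul_comm, Nat.mul_add_div hn, Nat.div_eq_of_lt (I.key s).2, add_zero]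
  have e2 : ((s * I.maxRounds + t) * n + I.key s : ℕ) % n = I.key s := by
    rw [Nat.mul_add_mod', Nat.mod_eq_of_lt (I.key s).2]
  have e3 : (s * I.maxRounds + t : ℕ) / I.maxRounds = s := by
    rw [Nat.mul_comm, Nat.mul_add_div (by omega), Nat.div_eq_of_lt ht, add_zero]
  have e4 : (s * I.maxRounds + t : ℕ) % I.maxRounds = t := by
    rw [Nat.mul_add_mod', Nat.mod_eq_of_lt ht]
  simp only [inputMem, e1, e2, e3, e4, keyBit]
  simp [Fin.val_inj]

/-- The input arrays are intact. -/
structure HasInput (ε r : ℝ) (a : Fin N → ℝ) (b : Fin d → Fin N → ℝ) (σ : Mem) : Prop where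
  nat : ∀ k ≤ 3, σ.nat k = (I.inputMem ε r a b).nat k
  real : ∀ k ≤ 2, σ.real k = (I.inputMem ε r a b).real k

namespace HasInput

variable {I} {ε r : ℝ} {a : Fin N → ℝ} {b : Fin d → Fin N → ℝ} {σ : Mem}

lemma keys (h : I.HasInput ε r a b σ) : σ.nat 0 0 = n := by
  rw [h.nat 0 (by norm_num)]; simp [inputMem]

lemma len (h : I.HasInput ε r a b σ) : σ.nat 0 1 = N := by
  rw [h.nat 0 (by norm_num)]; simp [inputMem]

lemma rounds (h : I.HasInput ε r a b σ) : σ.nat 0 2 = I.maxRounds := by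
  rw [h.nat 0 (by norm_num)]; simp [inputMem]

lemma horizon (h : I.HasInput ε r a b σ) : σ.nat 0 3 = I.horizon ε := by
  rw [h.nat 0 (by norm_num)]; simp [inputMem]

lemma dim (h : I.HasInput ε r a b σ) : σ.nat 0 4 = d := by
  rw [h.nat 0 (by norm_num)]; simp [inputMem]

lemma key (h : I.HasInput ε r a b σ) (s : Fin N) : σ.nat 2 s = I.key s := by
  rw [h.nat 2 (by norm_num)]; simp [inputMem]

lemma bit (h : I.HasInput ε r a b σ) (s : Fin N) {t : ℕ} (ht : t < I.maxRounds) :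
    σ.nat 3 ((s * I.maxRounds + t) * n + I.key s) = I.keyBit s t := by
  rw [h.nat 3 (by norm_num), I.inputMem_bit ε r a b s ht]

lemma accuracy (h : I.HasInput ε r a b σ) : σ.real 0 0 = ε := by
  rw [h.real 0 (by norm_num)]; simp [inputMem]

lemma radius (h : I.HasInput ε r a b σ) : σ.real 0 1 = r := by
  rw [h.real 0 (by norm_num)]; simp [inputMem]

lemma point (h : I.HasInput ε r a b σ) (s : Fin N) : σ.real 1 s = a s := by
  rw [h.real 1 (by norm_num)]; simp [inputMem]

lemma basis (h : I.HasInput ε r a b σ) (i : Fin d) (s : Fin N) :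
    σ.real 2 (i * N + s) = b i s := by
  rw [h.real 2 (by norm_num)]
  have e1 : (i * N + s : ℕ) / N = i := by
    rw [Nat.mul_comm, Nat.mul_add_div s.pos, Nat.div_eq_of_lt s.2, add_zero]
  have e2 : (i * N + s : ℕ) % N = s := by rw [Nat.mul_add_mod', Nat.mod_eq_of_lt s.2]
  simp [inputMem, e1, e2]

lemma congr (h : I.HasInput ε r a b σ) {σ' : Mem} (hn : ∀ k ≤ 3, σ'.nat k = σ.nat k)
    (hr : ∀ k ≤ 2, σ'.real k = σ.real k) : I.HasInput ε r a b σ' :=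
  ⟨fun k hk => (hn k hk).trans (h.nat k hk), fun k hk => (hr k hk).trans (h.real k hk)⟩

end HasInput

/-- Utility of the actions coded by `act`. -/
def codeUtility (act : Fin N → ℕ → ℕ) (s : Fin N) (T : ℕ) : ℕ :=
  ∑ t ∈ Finset.range T, (∑ j ∈ Finset.range (t + 1),
    if act s j = I.key s + 1 then I.keyBit s j else 0) * I.keyBit s t

lemma codeUtility_actionCode (π : I.Policy) (s : Fin N) :
    (I.codeUtility (I.actionCode π) s I.maxRounds : ℝ) = I.scenarioUtility π s := by
  rw [scenarioUtility_eq_prefix]; rfl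

lemma codeUtility_zero (s : Fin N) (T : ℕ) : I.codeUtility (fun _ _ => 0) s T = 0 := by
  simp [codeUtility]

lemma runs_updateCmd {ε r : ℝ} {a : Fin N → ℝ} {b : Fin d → Fin N → ℝ} {σ : Mem}
    (hI : I.HasInput ε r a b σ) {act : Fin N → ℕ → ℕ}
    (hact : ∀ s : Fin N, ∀ t < I.maxRounds, σ.nat 4 (s * I.maxRounds + t) = act s t)
    {g : Fin N → ℝ} (hg : ∀ s : Fin N, σ.real 4 s = g s) :
    Runs sep updateCmd σ (N * (4 * I.maxRounds + 5) + 2) fun σ' => I.HasInput ε r a b σ' ∧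
      ∀ s : Fin N, σ'.real 4 s = g s + I.codeUtility act s I.maxRounds := by
  let Base : Mem → Prop := fun σ' => I.HasInput ε r a b σ' ∧ σ'.nat 4 = σ.nat 4
  have base_nat : ∀ {σ' : Mem} {A : ℕ} (i v : ℕ), 4 < A → Base σ' → Base (σ'.setNat A i v) := by
    rintro σ' A i v hA ⟨h1, h2⟩
    exact ⟨h1.congr (fun k hk => Mem.setNat_nat_ne _ _ _ (by omega)) fun _ _ => rfl,
      by rw [Mem.setNat_nat_ne _ _ _ (by omega), h2]⟩
  have base_real : ∀ {σ' : Mem} (i : ℕ) (v : ℝ), Base σ' → Base (σ'.setReal 4 i v) := by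
    rintro σ' i v ⟨h1, h2⟩
    exact ⟨h1.congr (fun _ _ => rfl) fun k hk => Mem.setReal_real_ne _ _ _ (by omega), h2⟩
  let Inv : ℕ → Mem → Prop := fun i σ' => Base σ' ∧
    (∀ s : Fin N, (s : ℕ) < i → σ'.real 4 s = g s + I.codeUtility act s I.maxRounds) ∧
    ∀ s : Fin N, i ≤ (s : ℕ) → σ'.real 4 s = g s
  refine (Runs.forLoop (sep := sep) (L := N) (B := 1 + (I.maxRounds * (2 + 2) + 2)) (Inv := Inv)
    ?_ ?_ ?_ ⟨⟨hI, rfl⟩, by simp, fun s _ => hg s⟩).mono ?_ ?_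
  · rintro k σ' v ⟨h1, h2, h3⟩
    exact ⟨base_nat _ _ (by norm_num) h1, h2, h3⟩
  · rintro k σ' ⟨h1, -, -⟩
    simpa using h1.1.len
  · rintro i hi σ₁ ⟨h1, h2, h3⟩ hc
    apply Runs.setNat_seq
    let Inn : ℕ → Mem → Prop := fun j σ' => Base σ' ∧ σ'.nat 5 0 = i ∧
      σ'.nat 7 0 = (∑ l ∈ Finset.range j,
        if act ⟨i, hi⟩ l = I.key ⟨i, hi⟩ + 1 then I.keyBit ⟨i, hi⟩ l else 0) ∧
      σ'.real 4 i = g ⟨i, hi⟩ + I.codeUtility act ⟨i, hi⟩ j ∧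
      (∀ s : Fin N, (s : ℕ) < i → σ'.real 4 s = g s + I.codeUtility act s I.maxRounds) ∧
      ∀ s : Fin N, i + 1 ≤ (s : ℕ) → σ'.real 4 s = g s
    refine (Runs.forLoop (sep := sep) (L := I.maxRounds) (B := 2) (Inv := Inn) ?_ ?_ ?_ ?_).mono
      le_rfl ?_
    · rintro k σ' v ⟨h1, h4, h5, h6⟩
      exact ⟨base_nat _ _ (by norm_num) h1, by simpa using h4, by simpa using h5, h6⟩
    · rintro k σ' ⟨h1, -⟩
      simpa using h1.1.rounds
    · rintro j hj σ₂ ⟨h1, h4, h5, h6, h7, h8⟩ hc6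
      have ekey := h1.1.key ⟨i, hi⟩
      have ebit := h1.1.bit ⟨i, hi⟩ hj
      have eact : σ₂.nat 4 (i * I.maxRounds + j) = act ⟨i, hi⟩ j := by
        rw [h1.2]; exact hact ⟨i, hi⟩ j hj
      simp only at ekey ebit
      have ematch : matchE.eval σ₂ * bitE.eval σ₂ =
          if act ⟨i, hi⟩ j = I.key ⟨i, hi⟩ + 1 then I.keyBit ⟨i, hi⟩ j else 0 := by
        simp only [NatExp.eval, h4, hc6, h1.1.rounds, h1.1.keys, ekey, ebit, eact]
        split_ifs with h
        · simp [h]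
        -- When the codes differ, one of the two truncated differences is at least 1 and wipes out
        -- the leading 1.
        · have : 1 - (act ⟨i, hi⟩ j - ((I.key ⟨i, hi⟩ : ℕ) + 1)) -
            ((I.key ⟨i, hi⟩ : ℕ) + 1 - act ⟨i, hi⟩ j) = 0 := by omega
          rw [this, zero_mul]
      refine (Runs.setNat_seq (Runs.setReal ?_)).mono le_rfl fun _ h => h
      have esum : (NatExp.add (natAt 7 0) (.mul matchE bitE)).eval σ₂ =
          ∑ l ∈ Finset.range (j + 1),
            if act ⟨i, hi⟩ l = I.key ⟨i, hi⟩ + 1 then I.keyBit ⟨i, hi⟩ l else 0 := by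
        rw [Finset.sum_range_succ, ← h5, ← ematch]; rfl
      rw [esum]
      have ecode : I.codeUtility act ⟨i, hi⟩ (j + 1) = I.codeUtility act ⟨i, hi⟩ j +
          (∑ l ∈ Finset.range (j + 1),
            if act ⟨i, hi⟩ l = I.key ⟨i, hi⟩ + 1 then I.keyBit ⟨i, hi⟩ l else 0) *
            I.keyBit ⟨i, hi⟩ j := by
        rw [codeUtility, Finset.sum_range_succ]; rfl
      refine ⟨by simpa using hc6, base_real _ _ (base_nat _ _ (by norm_num) h1), by simpa using h4,
        by simp, ?_, ?_, ?_⟩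
      · simp [h4, hc6, h1.1.rounds, h1.1.keys, ekey, ebit, h6, ecode, add_assoc]
      · intro s hs
        simp [h4, hs.ne, h7 s hs]
      · intro s hs
        have : (s : ℕ) ≠ i := by omega
        simp [h4, this, h8 s hs]
    · exact ⟨base_nat _ _ (by norm_num) h1, by simpa using hc, by simp,
        by simpa [codeUtility] using h3 ⟨i, hi⟩ le_rfl, h2, fun s hs => h3 s (by omega)⟩
    · rintro σ₂ ⟨h1, h4, h5, h6, h7, h8⟩
      refine ⟨h4, h1, fun s hs => ?_, h8⟩
      rcases Nat.lt_succ_iff_lt_or_eq.1 hs with h | h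
      · exact h7 s h
      · obtain rfl : s = ⟨i, hi⟩ := Fin.ext h
        exact h6
  · apply le_of_eq; ring
  · rintro σ' ⟨h1, h2, -⟩
    exact ⟨h1.1, fun s => h2 s s.2⟩

/-- The weight `1 / η` of the entropy. -/
def entropyWeight (ε : ℝ) : ℝ := 1 / I.learningRate ε

/-- A bound on the range of the objective. -/
def objRange (ε : ℝ) : ℝ := I.maxRounds * I.horizon ε + 4 * I.entropyWeight ε * N

def smoothRoot (ε : ℝ) : ℝ := ε / (512 * I.entropyWeight ε * N + ε)

/-- The number of cuts before rounding up. -/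
def cutBound (d : ℕ) (ε r : ℝ) : ℝ :=
  2 * ((d + 2) * (d + 2)) * (Real.log (1 + 128 * I.objRange ε / ε) + Real.log (1 + 1 / r) + 1)

lemma runs_scalarCmd {ε r : ℝ} {a : Fin N → ℝ} {b : Fin d → Fin N → ℝ} {σ : Mem}
    (hI : I.HasInput ε r a b σ) {G : Fin N → ℝ} (hG : ∀ s : Fin N, σ.real 4 s = G s) :
    Runs sep scalarCmd σ 9 fun σ' =>
      Ctx d (I.entropyWeight ε) (I.smoothRoot ε ^ 2) (I.cutBound d ε r) G σ σ' ∧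
      σ'.real 11 4 = 0 ∧ σ'.real 11 5 = I.objRange ε + ε := by
  refine Runs.mono (Runs.setReal_seq <| Runs.setReal_seq <| Runs.setReal_seq <| Runs.setReal_seq <|
    Runs.setReal_seq <| Runs.setReal_seq <| Runs.setReal_seq <| Runs.setReal_seq <|
    Runs.setReal ?_) le_rfl fun _ h => h
  have e1 := hI.len
  have e2 := hI.rounds
  have e3 := hI.horizon
  have e4 := hI.dim
  have e5 := hI.accuracy
  have e6 := hI.radius
  refine ⟨⟨fun _ _ => rfl, ?_, e1, e4, ?_, ?_, ?_, ?_, ?_, ?_, ?_⟩, ?_, ?_⟩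
  · intro k hk
    have : k ≠ 11 := by omega
    simp [Mem.setReal_real_ne _ _ _ this]
  · intro s; simp [hG]
  · simp [e1, e2, e3, entropyWeight, learningRate]
  · simp [e1, e2, e3, e5, entropyWeight, learningRate, smoothRoot, sq]
  · simp [e1, e2, e3, e4, e5, e6, entropyWeight, learningRate, objRange, cutBound]
  · simp [e4, cutShift]
  · simp [e4, cutShift, cutShrink]
  · simp [e4, cutShift, cutShrink, cutGrow]
  · simp
  · simp [e1, e2, e3, e5, entropyWeight, learningRate, objRange]

lemma runs_startCmd {ε r κ θ J : ℝ} {a : Fin N → ℝ} {b : Fin d → Fin N → ℝ} {σ₀ σ : Mem}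
    (hI : I.HasInput ε r a b σ₀) {G : Fin N → ℝ} (hx : Ctx d κ θ J G σ₀ σ) :
    Runs sep startCmd σ (18 * ((d + 1) * (N + 1))) fun σ' => Ctx d κ θ J G σ₀ σ' ∧
      σ'.real 11 = σ.real 11 ∧
      (∀ s : Fin N, σ'.real 5 s = a s - ∑ i, (b i ⬝ᵥ a) * b i s) ∧
      ∀ (i : Fin d) (s : Fin N), σ'.real 6 (i * N + s) = b i s := by
  have hb : ∀ (i : Fin d) (s : Fin N), σ.real 2 (i * N + s) = b i s := fun i s => by
    rw [hx.real 2 (by norm_num), hI.basis]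
  have ha : ∀ s : Fin N, σ.real 1 s = a s := fun s => by
    rw [hx.real 1 (by norm_num), hI.point]
  refine Runs.mono (Runs.seq (Runs.mapSum (by norm_num) (fun i j => b i j * a j)
    (fun i => b i ⬝ᵥ a) ?_ ?_ ?_ ?_) ?_) (B := 6 * (d + 1) * (N + 1) + (6 * (N + 1) * (d + 1) +
      6 * (d + 1) * (N + 1))) (le_of_eq (by ring)) (fun _ h => h)
  · intro σ' h; simp [h.nat, hx.dim]
  · intro σ' h; simp [h.nat, hx.len]
  · intro i j σ' h hj
    simp [h.nat, h.real, hx.len, h.ctr, hj, hb, ha]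
  · intro i σ' h ha
    simp [ha, dotProduct]
  rintro σ₁ ⟨s₁, q₁, -⟩
  have x₁ := hx.same s₁ (by norm_num) (by norm_num) (by norm_num)
  refine Runs.seq (Runs.mapSum (by norm_num) (fun s i => (b i ⬝ᵥ a) * b i s)
    (fun s => a s - ∑ i, (b i ⬝ᵥ a) * b i s) ?_ ?_ ?_ ?_) ?_
  · intro σ' h; simp [h.nat, x₁.len]
  · intro σ' h; simp [h.nat, x₁.dim]
  · intro i j σ' h hj
    simp [h.nat, h.real, x₁.len, h.ctr, hj, q₁, s₁.real, hb]
  · intro i σ' h hacc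
    simp [hacc, h.real, h.ctr, s₁.real, ha]
  rintro σ₂ ⟨s₂, q₂, -⟩
  have x₂ := x₁.same s₂ (by norm_num) (by norm_num) (by norm_num)
  refine Runs.mono (Runs.gridMap b ?_ ?_ ?_) le_rfl ?_
  · intro σ' h; simp [h.nat, x₂.dim]
  · intro σ' h; simp [h.nat, x₂.len]
  · intro i j σ' h hi hj _
    simp [h.nat, x₂.len, hi, hj, h.real, s₂.real, s₁.real, hb]
  · rintro σ₃ ⟨s₃, q₃⟩
    refine ⟨x₂.same s₃ (by norm_num) (by norm_num) (by norm_num), ?_, ?_, q₃⟩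
    · simp [s₃.real, s₂.real, s₁.real]
    · intro s; simp [s₃.real, q₂]

lemma entropyWeight_nonneg (ε : ℝ) : 0 ≤ I.entropyWeight ε := by
  unfold entropyWeight learningRate; positivity

/-- A bound on the number of steps of a round. -/
def roundSteps (d : ℕ) (ε r : ℝ) : ℕ :=
  (N * (4 * I.maxRounds + 5) + 2) + (9 + (18 * ((d + 1) * (N + 1)) +
    (⌈I.cutBound d ε r⌉₊ * (68 * ((d + 1) * (N + 1)) + 1) + 1)))

/-- Error budget: the smoothed objective is minimized up to ε/128, and smoothing changes each of the
two compared values by at most ε/256, for a total of ε/64. -/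
theorem runs_roundCmd {K : Set (Fin N → ℝ)} (hK : K ⊆ stdSimplex ℝ (Fin N)) (hc : Convex ℝ K)
    (hcl : IsClosed K) (hne : K.Nonempty) (hsep : IsSeparationOracle K sep) {ε r : ℝ} (hε : 0 < ε)
    {a : Fin N → ℝ} {b : Fin d → Fin N → ℝ} (hab : IsInnerBallData K a b r) {σ : Mem}
    (hI : I.HasInput ε r a b σ) {act : Fin N → ℕ → ℕ}
    (hact : ∀ s : Fin N, ∀ t < I.maxRounds, σ.nat 4 (s * I.maxRounds + t) = act s t)
    {g G : Fin N → ℝ} (hg : ∀ s : Fin N, σ.real 4 s = g s)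
    (hG : ∀ s, G s = g s + I.codeUtility act s I.maxRounds)
    (hG0 : ∀ s, 0 ≤ G s) (hG1 : ∀ s, G s ≤ I.maxRounds * I.horizon ε) :
    Runs sep roundCmd σ (I.roundSteps d ε r) fun σ' => I.HasInput ε r a b σ' ∧
      (∀ s : Fin N, σ'.real 4 s = G s) ∧ σ'.readVec N 3 ∈ K ∧ ∀ q ∈ K,
        ∑ s, G s * σ'.readVec N 3 s + I.entropyWeight ε * negEntropy (σ'.readVec N 3) ≤
          ∑ s, G s * q s + I.entropyWeight ε * negEntropy q + ε / 64 := by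
  have hκ := I.entropyWeight_nonneg ε
  have hτ : 0 < I.smoothRoot ε := by unfold smoothRoot; positivity
  have hτ1 : I.smoothRoot ε ≤ 1 := by
    unfold smoothRoot
    rw [div_le_one (by positivity)]
    have : 0 ≤ 512 * I.entropyWeight ε * N := by positivity
    linarith
  have hτε : 2 * I.entropyWeight ε * N * I.smoothRoot ε ≤ ε / 256 := by
    unfold smoothRoot
    rw [mul_div_assoc', div_le_div_iff₀ (by positivity) (by norm_num)]
    nlinarith
  have hθ : 0 < I.smoothRoot ε ^ 2 := by positivity
  have hθ1 : I.smoothRoot ε ^ 2 ≤ 1 := pow_le_one₀ hτ.le hτ1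
  have hκN : 0 ≤ I.entropyWeight ε * N := by positivity
  have hR0 : 0 ≤ I.objRange ε := by unfold objRange; positivity
  have hup : ∀ x ∈ K, smoothObj (I.entropyWeight ε) (I.smoothRoot ε ^ 2) G x ≤ I.objRange ε := by
    intro x hx
    refine (smoothObj_le hκ hθ hθ1 hG1 (hK hx)).trans ?_
    unfold objRange; linarith
  have hR : ∀ x ∈ K, ∀ y ∈ K, smoothObj (I.entropyWeight ε) (I.smoothRoot ε ^ 2) G x -
      smoothObj (I.entropyWeight ε) (I.smoothRoot ε ^ 2) G y ≤ I.objRange ε := by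
    intro x hx y hy
    have h1 := smoothObj_le hκ hθ hθ1 hG1 (hK hx)
    have h2 := smoothObj_ge hκ hθ hG0 (hK hy)
    unfold objRange; linarith
  have htol : 0 < ε / 128 := by positivity
  obtain ⟨x, hx, hmin, S, hSK, hS, hSV, z, hz⟩ :=
    exists_near_minimizers hK hc hcl hne hκ hθ hR hR0 htol hab
  have hgrad : ∀ c ∈ K, ∀ x ∈ K, smoothObj (I.entropyWeight ε) (I.smoothRoot ε ^ 2) G c +
      (smoothGrad (I.entropyWeight ε) (I.smoothRoot ε ^ 2) G c ⬝ᵥ x -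
        smoothGrad (I.entropyWeight ε) (I.smoothRoot ε ^ 2) G c ⬝ᵥ c) ≤
      smoothObj (I.entropyWeight ε) (I.smoothRoot ε ^ 2) G x := fun c hc x hx =>
    smoothObj_tangent hκ hθ G (hK hc).1 (hK hx).1
  unfold roundCmd roundSteps
  refine Runs.seq (I.runs_updateCmd hI hact hg) ?_
  rintro σ₁ ⟨hI₁, hg₁⟩
  have hG₁ : ∀ s : Fin N, σ₁.real 4 s = G s := fun s => (hg₁ s).trans (hG s).symm
  refine Runs.seq (I.runs_scalarCmd hI₁ hG₁) ?_
  rintro σ₂ ⟨x₂, h4, h5⟩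
  refine Runs.seq (I.runs_startCmd hI₁ x₂) ?_
  rintro σ₃ ⟨x₃, h11, hc₃, hB₃⟩
  have hinit := CutState.init (V := smoothObj (I.entropyWeight ε) (I.smoothRoot ε ^ 2) G x + ε / 128)
    (v := I.objRange ε + ε) (p := fun s => σ₃.real 3 s)
    (F := smoothObj (I.entropyWeight ε) (I.smoothRoot ε ^ 2) G) hK hSK
    (by linarith [hup x hx]) hab.orthonormal hab.subset_affine
  refine (runs_cutLoop hsep hSK hS hSV hgrad x₃ hc₃ hB₃ (fun s => rfl) (by rw [h11, h5])
    (by rw [h11, h4]) hinit).mono le_rfl ?_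
  rintro σ₄ ⟨x₄, c, B, v, hcut⟩
  refine ⟨hI₁.congr (fun k hk => x₄.nat k (by omega)) (fun k hk => x₄.real k (.inl hk)), x₄.loss, ?_⟩
  have hr := hab.radius_pos
  -- The inverse radius of the ball of near-minimizers is (1 + 128R/ε)/r. In `cutBound` the extra 1
  -- and the factor d + 2 in place of d make the inequality strict, even for d = 0.
  have hcount : 2 * ((d : ℝ) + 2) * (d * Real.log (1 / (ε / 128 / (I.objRange ε + ε / 128) * r))) <
      ⌈I.cutBound d ε r⌉₊ := by
    refine lt_of_lt_of_le ?_ (Nat.le_ceil _)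
    have h1 : 0 ≤ Real.log (1 + 128 * I.objRange ε / ε) :=
      Real.log_nonneg (by have : 0 ≤ 128 * I.objRange ε / ε := by positivity
                          linarith)
    have h2 : 0 ≤ Real.log (1 + 1 / r) :=
      Real.log_nonneg (by have : 0 ≤ 1 / r := by positivity
                          linarith)
    have h3 : Real.log (1 / (ε / 128 / (I.objRange ε + ε / 128) * r)) ≤
        Real.log (1 + 128 * I.objRange ε / ε) + Real.log (1 + 1 / r) := by
      rw [← Real.log_mul (by positivity) (by positivity)]
      apply Real.log_le_log (by positivity)
      have e : 1 / (ε / 128 / (I.objRange ε + ε / 128) * r) =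
          (1 + 128 * I.objRange ε / ε) * (1 / r) := by field_simp; ring
      rw [e]
      gcongr
      linarith
    have hd0 : (0 : ℝ) ≤ d := by positivity
    unfold cutBound
    calc 2 * ((d : ℝ) + 2) * (d * Real.log (1 / (ε / 128 / (I.objRange ε + ε / 128) * r)))
        ≤ 2 * ((d : ℝ) + 2) * (d * (Real.log (1 + 128 * I.objRange ε / ε) +
          Real.log (1 + 1 / r))) := by gcongr
      _ ≤ 2 * ((d : ℝ) + 2) * ((d + 2) * (Real.log (1 + 128 * I.objRange ε / ε) +
          Real.log (1 + 1 / r))) := by gcongr; linarith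
      _ < 2 * ((d : ℝ) + 2) * ((d + 2) * (Real.log (1 + 128 * I.objRange ε / ε) +
          Real.log (1 + 1 / r) + 1)) :=
        mul_lt_mul_of_pos_left (mul_lt_mul_of_pos_left (lt_add_one _) (by positivity)) (by positivity)
      _ = _ := by ring
  obtain ⟨hpK, hpV⟩ := hcut.optimal hab.orthonormal (by positivity) hz hcount
  refine ⟨hpK, fun q hq => ?_⟩
  have a1 := abs_le.1 (abs_smoothObj_sub_le hκ hτ hτ1 G (hK hpK))
  have a2 := abs_le.1 (abs_smoothObj_sub_le hκ hτ hτ1 G (hK hq))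
  have a3 := hmin q hq
  change ∑ s, G s * σ₄.real 3 s + I.entropyWeight ε * negEntropy (fun s : Fin N => σ₄.real 3 s) ≤ _
  linarith [a1.1, a2.2]

end Env
end Keychain
end

/-! ### Polynomial step count, and the machine run over all rounds -/

noncomputable section

namespace Keychain

variable {n N d : ℕ} {sep : (Fin N → ℝ) → Option (Fin N → ℝ)}

lemma IsInnerBallData.dim_le {K : Set (Fin N → ℝ)} {a : Fin N → ℝ} {b : Fin d → Fin N → ℝ} {r : ℝ}
    (h : IsInnerBallData K a b r) : d ≤ N := by
  have h1 : Matrix.of b * (Matrix.of b).transpose = 1 := by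
    ext i j
    rw [Matrix.mul_apply, Matrix.one_apply, ← h.orthonormal i j]
    rfl
  have h2 := (Matrix.rank_mul_le_left (Matrix.of b) (Matrix.of b).transpose).trans
    (Matrix.rank_le_card_width _)
  rw [h1, Matrix.rank_one] at h2
  simpa using h2

/-- The final bound uses a single constant as both factor and exponent. -/
lemma le_mul_pow_self {x b : ℝ} {C k : ℕ} (hx : x ≤ C * b ^ k) (hk : k ≤ C) (hb : 1 ≤ b) :
    x ≤ C * b ^ C :=
  hx.trans (mul_le_mul_of_nonneg_left (pow_le_pow_right₀ hb hk) (Nat.cast_nonneg C))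

namespace Env

variable (I : Env n N)

/-! ### The number of steps is polynomial -/

/-- For N ≥ 2, √(ln N) ≥ 1/2 because ln 2 > 1/4; for N = 1 the weight is 0 by the division
convention. -/
lemma entropyWeight_le (hN : 0 < N) (ε : ℝ) :
    I.entropyWeight ε ≤ 2 * (I.maxRounds * I.horizon ε) := by
  have hT : (1 : ℝ) ≤ I.horizon ε := by exact_mod_cast I.horizon_pos ε
  unfold entropyWeight learningRate
  rcases Nat.lt_or_ge 1 N with h | h
  · have h2 : Real.log 2 ≤ Real.log N := Real.log_le_log (by norm_num) (by exact_mod_cast h)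
    have h3 : 1 / 2 ≤ √(Real.log N) := by
      apply Real.le_sqrt_of_sq_le
      linarith [Real.log_two_gt_d9]
    have h4 : √(I.horizon ε : ℝ) ≤ I.horizon ε := by
      rw [Real.sqrt_le_left (by positivity)]
      nlinarith
    rw [one_div_div, div_le_iff₀ (by linarith)]
    calc (I.maxRounds : ℝ) * √(I.horizon ε) ≤ I.maxRounds * I.horizon ε := by gcongr
      _ = 2 * (I.maxRounds * I.horizon ε) * (1 / 2) := by ring
      _ ≤ _ := by gcongr
  · obtain rfl : N = 1 := by omega
    simp
    positivity

/-- The range is polynomial in m, N and 1/ε; the horizon contributes (1/ε)². Only its logarithm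
enters the number of cuts, so powers of 1 + 1/ε become multiples of ln(1 + 1/ε). -/
lemma log_objRange_le (hN : 0 < N) {ε β : ℝ} (hε : 0 < ε) (hβ : 1 ≤ β) (hNβ : (N : ℝ) ≤ β)
    (hmβ : (I.maxRounds : ℝ) ≤ β) (hLβ : Real.log (1 + 1 / ε) ≤ β) :
    Real.log (1 + 128 * I.objRange ε / ε) ≤ 5764 * β ^ 5 := by
  have hN1 : (1 : ℝ) ≤ N := by exact_mod_cast hN
  set m : ℝ := (I.maxRounds : ℝ) with hm
  have hm0 : 0 ≤ m := by positivity
  set T : ℝ := (I.horizon ε : ℝ) with hT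
  have hT0 : 0 ≤ T := by positivity
  set e := 1 + 1 / ε with he
  have hε' : 0 < 1 / ε := by positivity
  have he1 : 1 ≤ e := by rw [he]; linarith
  have hTe : T ≤ (4 * m ^ 2 * N + 1) * e ^ 2 := by
    have h1 := I.horizon_le ε
    have h2 : Real.log N ≤ N := (Real.log_le_sub_one_of_pos (by linarith)).trans (by linarith)
    have h3 : (1 / ε) ^ 2 ≤ e ^ 2 := by gcongr; rw [he]; linarith
    have h4 : 1 ≤ e ^ 2 := one_le_pow₀ he1
    calc T ≤ 4 * m ^ 2 * Real.log N * (1 / ε) ^ 2 + 1 := by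
          refine h1.trans (le_of_eq ?_); rw [← hm]; ring
      _ ≤ 4 * m ^ 2 * N * e ^ 2 + e ^ 2 := by gcongr
      _ = _ := by ring
  have hR : I.objRange ε ≤ 9 * m * N * T := by
    have h1 := I.entropyWeight_le hN ε
    have h2 : m * T ≤ m * T * N := le_mul_of_one_le_right (by positivity) hN1
    have h3 : 4 * I.entropyWeight ε * N ≤ 4 * (2 * (m * T)) * N := by gcongr
    unfold objRange
    rw [← hm, ← hT]
    linarith
  have hR0 : 0 ≤ I.objRange ε := by
    have := I.entropyWeight_nonneg ε
    unfold objRange; positivity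
  have hbound : 1 + 128 * I.objRange ε / ε ≤ 5761 * β ^ 5 * e ^ 3 := by
    have h1 : 128 * I.objRange ε / ε ≤ 1152 * m * N * (4 * m ^ 2 * N + 1) * e ^ 3 := by
      calc 128 * I.objRange ε / ε = 128 * I.objRange ε * (1 / ε) := by ring
        _ ≤ 128 * (9 * m * N * ((4 * m ^ 2 * N + 1) * e ^ 2)) * e := by
          have : I.objRange ε ≤ 9 * m * N * ((4 * m ^ 2 * N + 1) * e ^ 2) :=
            hR.trans (by gcongr)
          have h5 : 1 / ε ≤ e := by rw [he]; linarith
          gcongr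
        _ = _ := by ring
    have h2 : 1152 * m * N * (4 * m ^ 2 * N + 1) ≤ 1152 * β * β * (4 * β ^ 2 * β + β ^ 2 * β) := by
      have : 1 ≤ β ^ 2 * β := by
        have := one_le_pow₀ hβ (n := 3)
        linarith [pow_succ β 2]
      gcongr
    have h3 : 1 ≤ β ^ 5 := one_le_pow₀ hβ
    have h4 : 1 ≤ e ^ 3 := one_le_pow₀ he1
    have h5 : 1 ≤ β ^ 5 * e ^ 3 := one_le_mul_of_one_le_of_one_le h3 h4
    calc 1 + 128 * I.objRange ε / ε ≤ β ^ 5 * e ^ 3 +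
          1152 * β * β * (4 * β ^ 2 * β + β ^ 2 * β) * e ^ 3 := by
          refine add_le_add h5 (h1.trans ?_); gcongr
      _ = _ := by ring
  have hlog := Real.log_le_log (by positivity) hbound
  rw [Real.log_mul (by positivity) (by positivity), Real.log_pow] at hlog
  have h6 : Real.log (5761 * β ^ 5) ≤ 5761 * β ^ 5 :=
    (Real.log_le_sub_one_of_pos (by positivity)).trans (by linarith)
  have h7 : β ≤ β ^ 5 := le_self_pow₀ hβ (by norm_num)
  push_cast at hlog
  linarith

/-- The number of cuts is of order d² times the logarithms, hence β^7, and a cut costs O(dN), hence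
β^2. -/
lemma roundSteps_le_pow (hN : 0 < N) (hd : d ≤ N) {ε r β : ℝ} (hε : 0 < ε) (hr : 0 < r)
    (hβ1 : 1 ≤ β) (hNβ : (N : ℝ) ≤ β) (hmβ : (I.maxRounds : ℝ) ≤ β)
    (hLβ : Real.log (1 + 1 / ε) ≤ β) (hrβ : Real.log (1 + 1 / r) ≤ β) :
    (I.roundSteps d ε r : ℝ) ≤ 30000000 * β ^ 9 := by
  have hdN : (d : ℝ) ≤ N := by exact_mod_cast hd
  have hL2 : 0 ≤ Real.log (1 + 1 / r) :=
    Real.log_nonneg (by linarith [show 0 < 1 / r by positivity])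
  have hκ := I.entropyWeight_nonneg ε
  have hL3 : 0 ≤ Real.log (1 + 128 * I.objRange ε / ε) := by
    apply Real.log_nonneg
    have : 0 ≤ 128 * I.objRange ε / ε := by unfold objRange; positivity
    linarith
  have hlog := I.log_objRange_le hN hε hβ1 hNβ hmβ hLβ
  have hcut : I.cutBound d ε r ≤ 103788 * β ^ 7 := by
    unfold cutBound
    have h1 : Real.log (1 + 128 * I.objRange ε / ε) + Real.log (1 + 1 / r) + 1 ≤ 5766 * β ^ 5 := by
      have : β ≤ β ^ 5 := le_self_pow₀ hβ1 (by norm_num)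
      linarith
    have h2 : (d : ℝ) + 2 ≤ 3 * β := by linarith
    calc _ ≤ 2 * (3 * β * (3 * β)) * (5766 * β ^ 5) := by gcongr
      _ = _ := by ring
  have hceil : (⌈I.cutBound d ε r⌉₊ : ℝ) ≤ 103789 * β ^ 7 := by
    have h7 : 1 ≤ β ^ 7 := one_le_pow₀ hβ1
    have h1 := (Nat.ceil_mono hcut)
    have h2 := (Nat.ceil_lt_add_one (show 0 ≤ 103788 * β ^ 7 by positivity)).le
    have h3 : (⌈I.cutBound d ε r⌉₊ : ℝ) ≤ ⌈103788 * β ^ 7⌉₊ := by exact_mod_cast h1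
    linarith
  have hW : ((d : ℝ) + 1) * (N + 1) ≤ 4 * β ^ 2 := by
    calc ((d : ℝ) + 1) * (N + 1) ≤ (β + β) * (β + β) := by gcongr; linarith
      _ = _ := by ring
  have hp2 : 1 ≤ β ^ 2 := one_le_pow₀ hβ1
  have hp9 : β ^ 2 ≤ β ^ 9 := pow_le_pow_right₀ hβ1 (by norm_num)
  unfold roundSteps
  push_cast
  have t1 : (N : ℝ) * (4 * I.maxRounds + 5) ≤ 9 * β ^ 2 := by
    calc (N : ℝ) * (4 * I.maxRounds + 5) ≤ β * (4 * β + 5 * β) := by gcongr; linarith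
      _ = _ := by ring
  clear hcut hlog hκ hL2 hL3
  have t2 : (⌈I.cutBound d ε r⌉₊ : ℝ) * (68 * (((d : ℝ) + 1) * (N + 1)) + 1) ≤
      103789 * β ^ 7 * (68 * (4 * β ^ 2) + β ^ 2) := by gcongr
  have t3 : 103789 * β ^ 7 * (68 * (4 * β ^ 2) + β ^ 2) = 28334397 * β ^ 9 := by ring
  linarith

lemma roundSteps_le {C : ℕ} (hC : 30000000 ≤ C) (hn : 0 < n) (hN : 0 < N) (hd : d ≤ N) {ε r : ℝ}
    (hε : 0 < ε) (hr : 0 < r) :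
    (I.roundSteps d ε r : ℝ) ≤
      C * ((n : ℝ) + N + I.maxRounds + Real.log (1 + 1 / ε) + Real.log (1 + 1 / r)) ^ C := by
  have hn1 : (1 : ℝ) ≤ n := by exact_mod_cast hn
  have hN1 : (1 : ℝ) ≤ N := by exact_mod_cast hN
  have hm0 : (0 : ℝ) ≤ I.maxRounds := by positivity
  have hL1 : 0 ≤ Real.log (1 + 1 / ε) :=
    Real.log_nonneg (by linarith [show 0 < 1 / ε by positivity])
  have hL2 : 0 ≤ Real.log (1 + 1 / r) :=
    Real.log_nonneg (by linarith [show 0 < 1 / r by positivity])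
  refine le_mul_pow_self (k := 9) ((I.roundSteps_le_pow hN hd hε hr
    (β := (n : ℝ) + N + I.maxRounds + Real.log (1 + 1 / ε) + Real.log (1 + 1 / r)) (by linarith)
    (by linarith) (by linarith) (by linarith) (by linarith)).trans ?_) (by omega) (by linarith)
  gcongr
  exact_mod_cast hC

/-! ### The run of the machine -/

/-- The cumulative utilities of a history. -/
def totalLoss {t : ℕ} (h : Fin t → I.Policy) (s : Fin N) : ℝ := ∑ τ, I.scenarioUtility (h τ) s

/-- The history enters only through its cumulative utilities, so a vector of N numbers carried
between rounds suffices. -/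
lemma ftrlObjective_eq (ε : ℝ) {t : ℕ} (h : Fin t → I.Policy) (p : Fin N → ℝ) :
    I.ftrlObjective ε h p =
      ∑ s, I.totalLoss h s * p s + I.entropyWeight ε * negEntropy p := by
  unfold ftrlObjective utility totalLoss
  rw [Finset.sum_comm]
  congr 1
  refine Finset.sum_congr rfl fun s _ => ?_
  rw [Finset.sum_mul]
  exact Finset.sum_congr rfl fun τ _ => mul_comm _ _

lemma totalLoss_snoc {t : ℕ} (h : Fin t → I.Policy) (π : I.Policy) (s : Fin N) :
    I.totalLoss (Fin.snoc h π : Fin (t + 1) → I.Policy) s =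
      I.totalLoss h s + I.scenarioUtility π s := by
  unfold totalLoss
  rw [Fin.sum_univ_castSucc]
  simp

lemma totalLoss_nonneg {t : ℕ} (h : Fin t → I.Policy) (s : Fin N) : 0 ≤ I.totalLoss h s :=
  Finset.sum_nonneg fun τ _ => I.scenarioUtility_nonneg (h τ) s

lemma totalLoss_le {t T : ℕ} (ht : t ≤ T) (h : Fin t → I.Policy) (s : Fin N) :
    I.totalLoss h s ≤ I.maxRounds * T := by
  calc I.totalLoss h s ≤ ∑ _τ : Fin t, (I.maxRounds : ℝ) :=
        Finset.sum_le_sum fun τ _ => I.scenarioUtility_le (h τ) s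
    _ = I.maxRounds * t := by simp [mul_comm]
    _ ≤ _ := by gcongr

/-- The memory after the round with history `h`. -/
structure RoundDone (K : Set (Fin N → ℝ)) (ε r : ℝ) (a : Fin N → ℝ) (b : Fin d → Fin N → ℝ) {t : ℕ}
    (h : Fin t → I.Policy) (σ : Mem) : Prop where
  input : I.HasInput ε r a b σ
  loss : ∀ s : Fin N, σ.real 4 s = I.totalLoss h s
  mem : σ.readVec N 3 ∈ K
  opt : ∀ q ∈ K, I.ftrlObjective ε h (σ.readVec N 3) ≤ I.ftrlObjective ε h q + ε / 64

lemma hasInput_inputMem (ε r : ℝ) (a : Fin N → ℝ) (b : Fin d → Fin N → ℝ) :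
    I.HasInput ε r a b (I.inputMem ε r a b) := ⟨fun _ _ => rfl, fun _ _ => rfl⟩

lemma storePolicy_action (σ : Mem) (π : I.Policy) (s : Fin N) {t : ℕ} (ht : t < I.maxRounds) :
    (I.storePolicy σ π).nat 4 (s * I.maxRounds + t) = I.actionCode π s t := by
  have e3 : (s * I.maxRounds + t : ℕ) / I.maxRounds = s := by
    rw [Nat.mul_comm, Nat.mul_add_div (by omega), Nat.div_eq_of_lt ht, add_zero]
  have e4 : (s * I.maxRounds + t : ℕ) % I.maxRounds = t := by
    rw [Nat.mul_add_mod', Nat.mod_eq_of_lt ht]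
  simp [storePolicy, e3, e4]

lemma HasInput.storePolicy {I : Env n N} {ε r : ℝ} {a : Fin N → ℝ} {b : Fin d → Fin N → ℝ}
    {σ : Mem} (h : I.HasInput ε r a b σ) (π : I.Policy) :
    I.HasInput ε r a b (I.storePolicy σ π) :=
  h.congr (fun k hk => by
    have : k ≠ 4 := by omega
    simp [Env.storePolicy, this]) fun _ _ => rfl

section Run

variable {K : Set (Fin N → ℝ)} (hK : K ⊆ stdSimplex ℝ (Fin N)) (hc : Convex ℝ K)
  (hcl : IsClosed K) (hne : K.Nonempty) (hsep : IsSeparationOracle K sep) {ε r : ℝ} (hε : 0 < ε)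
  {a : Fin N → ℝ} {b : Fin d → Fin N → ℝ} (hab : IsInnerBallData K a b r)

include hK hc hcl hne hsep hε hab

/-- The same program serves the first round: the zeros in natural array 4 code the policy that never
tests a key, so the update adds nothing. -/
lemma runs_first (h : Fin 0 → I.Policy) :
    Runs sep roundCmd (I.inputMem ε r a b) (I.roundSteps d ε r) (I.RoundDone K ε r a b h) := by
  have h0 : ∀ s, I.totalLoss h s = 0 := fun s => by simp [totalLoss]
  refine (I.runs_roundCmd hK hc hcl hne hsep hε hab (I.hasInput_inputMem ε r a b)
    (act := fun _ _ => 0) (by simp [inputMem]) (g := fun _ => 0) (G := I.totalLoss h)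
    (by simp [inputMem]) (by simp [h0, codeUtility_zero]) (I.totalLoss_nonneg h)
    (I.totalLoss_le (Nat.zero_le _) h)).mono le_rfl ?_
  rintro σ ⟨h1, h2, h3, h4⟩
  exact ⟨h1, h2, h3, fun q hq => by simpa only [ftrlObjective_eq] using h4 q hq⟩

lemma runs_next {t : ℕ} (ht : t + 1 < I.horizon ε) {h : Fin t → I.Policy} (π : I.Policy) {σ : Mem}
    (hσ : I.RoundDone K ε r a b h σ) :
    Runs sep roundCmd (I.storePolicy σ π) (I.roundSteps d ε r)
      (I.RoundDone K ε r a b (Fin.snoc h π : Fin (t + 1) → I.Policy)) := by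
  refine (I.runs_roundCmd hK hc hcl hne hsep hε hab (hσ.input.storePolicy π)
    (act := I.actionCode π) (fun s t ht => I.storePolicy_action σ π s ht) (g := I.totalLoss h)
    (G := I.totalLoss (Fin.snoc h π : Fin (t + 1) → I.Policy)) hσ.loss
    (fun s => by rw [totalLoss_snoc, codeUtility_actionCode]) (I.totalLoss_nonneg _)
    (I.totalLoss_le ht.le _)).mono le_rfl ?_
  rintro σ' ⟨h1, h2, h3, h4⟩
  exact ⟨h1, h2, h3, fun q hq => by simpa only [ftrlObjective_eq] using h4 q hq⟩

end Run

/-- A memory in which `roundCmd`, started in `σ`, halts with the round of history `h` done. -/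
def nextMem (sep : (Fin N → ℝ) → Option (Fin N → ℝ)) (K : Set (Fin N → ℝ)) (ε r : ℝ)
    (a : Fin N → ℝ) (b : Fin d → Fin N → ℝ) {t : ℕ} (h : Fin t → I.Policy) (σ : Mem) : Mem :=
  -- `Exec` is a relation, so a final memory is chosen. The choice is total, which lets `runMem` be
  -- defined for all histories before termination is known.
  @Classical.epsilon Mem ⟨σ⟩ fun σ' =>
    (∃ k ≤ I.roundSteps d ε r, Exec sep roundCmd σ k σ') ∧ I.RoundDone K ε r a b h σ'

lemma nextMem_spec {K : Set (Fin N → ℝ)} {ε r : ℝ} {a : Fin N → ℝ} {b : Fin d → Fin N → ℝ} {t : ℕ}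
    {h : Fin t → I.Policy} {σ : Mem}
    (hr : Runs sep roundCmd σ (I.roundSteps d ε r) (I.RoundDone K ε r a b h)) :
    (∃ k ≤ I.roundSteps d ε r, Exec sep roundCmd σ k (I.nextMem sep K ε r a b h σ)) ∧
      I.RoundDone K ε r a b h (I.nextMem sep K ε r a b h σ) := by
  obtain ⟨k, hk, σ', he, hd⟩ := hr
  exact Classical.epsilon_spec_aux ⟨σ⟩ (fun σ' =>
    (∃ k ≤ I.roundSteps d ε r, Exec sep roundCmd σ k σ') ∧ I.RoundDone K ε r a b h σ')
    ⟨σ', ⟨k, hk, he⟩, hd⟩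

/-- The memory after each round. -/
def runMem (sep : (Fin N → ℝ) → Option (Fin N → ℝ)) (K : Set (Fin N → ℝ)) (ε r : ℝ)
    (a : Fin N → ℝ) (b : Fin d → Fin N → ℝ) : (t : ℕ) → (Fin t → I.Policy) → Mem
  | 0, h => I.nextMem sep K ε r a b h (I.inputMem ε r a b)
  | t + 1, h => I.nextMem sep K ε r a b h
      (I.storePolicy (runMem sep K ε r a b t (Fin.init h)) (h (Fin.last t)))

lemma runMem_done {K : Set (Fin N → ℝ)} (hK : K ⊆ stdSimplex ℝ (Fin N)) (hc : Convex ℝ K)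
    (hcl : IsClosed K) (hne : K.Nonempty) (hsep : IsSeparationOracle K sep) {ε r : ℝ} (hε : 0 < ε)
    {a : Fin N → ℝ} {b : Fin d → Fin N → ℝ} (hab : IsInnerBallData K a b r) (t : ℕ)
    (ht : t < I.horizon ε) (h : Fin t → I.Policy) :
    I.RoundDone K ε r a b h (I.runMem sep K ε r a b t h) := by
  induction t with
  | zero => exact (I.nextMem_spec (I.runs_first hK hc hcl hne hsep hε hab h)).2
  | succ t ih =>
    have hr := I.runs_next hK hc hcl hne hsep hε hab ht (h (Fin.last t))
      (ih (by omega) (Fin.init h))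
    rw [Fin.snoc_init_self] at hr
    exact (I.nextMem_spec hr).2

theorem isRun_runMem {K : Set (Fin N → ℝ)} (hK : K ⊆ stdSimplex ℝ (Fin N)) (hc : Convex ℝ K)
    (hcl : IsClosed K) (hne : K.Nonempty) (hsep : IsSeparationOracle K sep) {ε r : ℝ} (hε : 0 < ε)
    {a : Fin N → ℝ} {b : Fin d → Fin N → ℝ} (hab : IsInnerBallData K a b r) {β : ℝ}
    (hβ : (I.roundSteps d ε r : ℝ) ≤ β) :
    I.IsRun sep roundCmd (I.inputMem ε r a b) (I.horizon ε) β (I.runMem sep K ε r a b) := by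
  refine ⟨fun h => ?_, fun t ht h π => ?_⟩
  · obtain ⟨k, hk, he⟩ := (I.nextMem_spec (I.runs_first hK hc hcl hne hsep hε hab h)).1
    exact ⟨k, (Nat.cast_le.2 hk).trans hβ, he⟩
  · have hr := I.runs_next hK hc hcl hne hsep hε hab ht π
      (I.runMem_done hK hc hcl hne hsep hε hab t (by omega) h)
    obtain ⟨k, hk, he⟩ := (I.nextMem_spec hr).1
    refine ⟨k, (Nat.cast_le.2 hk).trans hβ, ?_⟩
    rw [runMem, Fin.init_snoc, Fin.snoc_last]
    exact he

theorem isFTRL_runMem {K : Set (Fin N → ℝ)} (hK : K ⊆ stdSimplex ℝ (Fin N)) (hc : Convex ℝ K)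
    (hcl : IsClosed K) (hne : K.Nonempty) (hsep : IsSeparationOracle K sep) {ε r : ℝ} (hε : 0 < ε)
    {a : Fin N → ℝ} {b : Fin d → Fin N → ℝ} (hab : IsInnerBallData K a b r) :
    I.IsFTRL K ε (ε / 64) (I.ruleOfRun (I.runMem sep K ε r a b)) := fun t ht h =>
  have hd := I.runMem_done hK hc hcl hne hsep hε hab t ht h
  ⟨hd.mem, hd.opt⟩

end Env
end Keychain
end

/-! ### Assembly of the final statement -/

theorem propositionE1 :
    -- one program and one polynomial bound serve all instances
    ∃ (body : Keychain.Cmd) (c : ℕ),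
      ∀ (n N : ℕ) (I : Keychain.Env n N) (K : Set (Fin N → ℝ)),
        K ⊆ stdSimplex ℝ (Fin N) → Convex ℝ K → IsClosed K → K.Nonempty →
      ∀ ε : ℝ, 0 < ε →
        -- number of rounds
        ((I.horizon ε : ℝ) ≤ 4 * ((I.maxRounds : ℝ) ^ 2 * Real.log N / ε ^ 2) + 1) ∧
        -- the exact algorithm is well defined
        (∃ rule : I.PriorRule, I.IsFTRL K ε 0 rule) ∧
        -- its guarantee, which tolerates a small error in the argmin
        (∀ (α : ℝ) (A : (Fin N → ℝ) → PMF I.Policy), I.IsApproxOracle α A →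
          ∀ δ : ℝ, 0 ≤ δ → δ ≤ ε / 64 → ∀ rule : I.PriorRule, I.IsFTRL K ε δ rule →
            I.expectedWorstCase K A rule (I.horizon ε) ≥ α * I.minimax K - ε) ∧
        -- every round takes polynomial time, given a separation oracle
        (∀ sep : (Fin N → ℝ) → Option (Fin N → ℝ), Keychain.IsSeparationOracle K sep →
          ∀ (d : ℕ) (a : Fin N → ℝ) (b : Fin d → Fin N → ℝ) (r : ℝ),
            Keychain.IsInnerBallData K a b r →
          ∃ mem : (t : ℕ) → (Fin t → I.Policy) → Keychain.Mem,
            I.IsRun sep body (I.inputMem ε r a b) (I.horizon ε)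
              (c * ((n : ℝ) + N + I.maxRounds + Real.log (1 + 1 / ε) + Real.log (1 + 1 / r)) ^ c)
              mem ∧
            I.IsFTRL K ε (ε / 64) (I.ruleOfRun mem) ∧
            ∀ (α : ℝ) (A : (Fin N → ℝ) → PMF I.Policy), I.IsApproxOracle α A →
              I.expectedWorstCase K A (I.ruleOfRun mem) (I.horizon ε) ≥ α * I.minimax K - ε) := by
  refine ⟨Keychain.roundCmd, 30000000, fun n N I K hK hc hcl hne ε hε => ⟨I.horizon_le ε,
    I.exists_isFTRL hK hcl hne ε, fun α A hA δ _ hδε rule hr =>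
      I.expectedWorstCase_ge hK hc hcl hne hε hδε hA hr, fun sep hsep d a b r hab => ?_⟩⟩
  obtain ⟨p, hp⟩ := hne
  -- A point of `K` forces a scenario to exist, and its correct key forces n > 0; the base of the
  -- polynomial is then at least 1.
  have hN : 0 < N := Keychain.Env.pos_of_mem_stdSimplex (hK hp)
  have hn : 0 < n := (I.key ⟨0, hN⟩).pos
  have hr := I.isFTRL_runMem hK hc hcl ⟨p, hp⟩ hsep hε hab
  exact ⟨_, I.isRun_runMem hK hc hcl ⟨p, hp⟩ hsep hε hab
    (I.roundSteps_le le_rfl hn hN hab.dim_le hε hab.radius_pos), hr, fun α A hA =>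
      I.expectedWorstCase_ge hK hc hcl ⟨p, hp⟩ hε le_rfl hA hr⟩
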